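/- Let $\alpha_0,\beta_0>0$, $0<\gamma_0<1$, and consider, for $(\alpha,\beta,\gamma)=(\alpha_0+\mu,\beta_0+\nu,\gamma_0)$, the rescaled Bona--Smith system $$\eta_t+\beta u_x-\alpha\eta_{xxt}+\beta(u\eta)_x=0,\qquad u_t+\beta\eta_x-\gamma\alpha\beta\,\eta_{xxx}-\alpha u_{xxt}+\beta uu_x=0 .$$ Let $k\ge 2$. A standing wave is a real distributional solution $(\eta,u)$, $2\pi$-periodic in $x$ and in $t$, with $\eta,u\in H^k((\mathbb R/2\pi\mathbb Z)^2)$ (continuous representatives), $\eta$ even in $x$, $u$ odd in $x$, and the $x$-average of $\eta$ independent of $t$; $B$ denotes the average of $\eta$ over a period cell. Assume that $(p_0,q_0)$ is the only pair of positive integers $(p,q)$ with $q(1+\alpha_0p^2)=\beta_0p\sqrt{1+\gamma_0\alpha_0p^2}$, and that $\alpha_0q^2\ne\gamma_0\beta_0^2$ for every integer $q$. Put $s=\sqrt{1+\gamma_0\alpha_0p_0^2}$, $$d=4\alpha_0p_0q_0\left(2-\gamma_0+5\alpha_0p_0^2+4\gamma_0\alpha_0^2p_0^4\right),\quad \alpha_1=\frac{\beta_0(1+3\alpha_0p_0^2)s^3}{d},\quad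 \beta_1=-\frac{\beta_0(1+2\alpha_0p_0^2+3\gamma_0\alpha_0p_0^2+4\gamma_0\alpha_0^2p_0^4)s^2}{d},$$ $$\xi_0=e^{iq_0t}(\cos p_0x,\,-is\sin p_0x),\quad y^{(2,0)}=\Big(\frac{s^2}{2(1+4\gamma_0\alpha_0p_0^2)}\cos 2p_0x,\ 0\Big),\quad y^{(2,2)}=e^{2iq_0t}(\alpha_1\cos 2p_0x,\ i\beta_1\sin 2p_0x),$$ $$2\mathcal N\big((\eta_1,u_1),(\eta_2,u_2)\big)=\big((\mathbb I-\pi_0)(u_1u_2),\ u_1\eta_2+u_2\eta_1\big),\qquad \beta_2=\frac{\beta_0}{2\pi^2}\Big\langle 2\mathcal N(y^{(2,0)},\xi_0)+2\mathcal N(y^{(2,2)},\bar\xi_0),\,\xi_0\Big\rangle ,$$ where $\pi_0$ is the average in $x$ and $\langle\cdot,\cdot\rangle$ is the Hermitian product of $L^2((-\pi,\pi)^2)^2$. Assume $\beta_2\neq0$ and let $$R(\mu,\nu)=-\frac1{\beta_2}\left\{-\left(2p_0q_0s-\gamma_0\beta_0p_0^2\right)\mu+\left(2+2\gamma_0\alpha_0p_0^2\right)\nu\right\}.$$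 For real $\mu,\nu$ and $|A|\ge0$, let $(\ast)$ be the following assertion, with a constant $C$ in every $\mathrm O$: there is a pair $(\eta_0,u_0)$ such that for every $\tau\in\mathbb R$ the pair $(\eta_0,u_0)(x,t-\tau)$ is a standing wave with $B=0$ for the parameters $(\alpha_0+\mu,\beta_0+\nu,\gamma_0)$, with $$\eta_0=2|A|\cos q_0t\cos p_0x+\mathrm O\{|A|(|\mu|+|\nu|+|A|)\},\qquad u_0=2s|A|\sin q_0t\sin p_0x+\mathrm O\{|A|(|\mu|+|\nu|+|A|)\},$$ and $$\begin{aligned}\eta_0(x,t)={}&2|A|\cos q_0t\cos p_0x+2|A|\cos q_0t\cos p_0x\left\{\frac{\mu\left(\gamma_0\alpha_0p_0^4q_0s-\gamma_0\beta_0p_0^3s^2\right)-\nu\,\gamma_0\alpha_0p_0^3s^2}{\left(q_0(1+\alpha_0p_0^2)s+\beta_0p_0\right)\left(2+\gamma_0\alpha_0p_0^2\right)}\right\}\\&+|A|^2\left\{\frac{s^2}{2(1+4\gamma_0\alpha_0p_0^2)}\cos2p_0x+\frac{2\beta_0(1+3\alpha_0p_0^2)s^3}{d}\cos2q_0t\cos2p_0x\right\}+\mathrm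 O\{(|A|+|\mu|+|\nu|)^3\},\end{aligned}$$ the error terms being bounded both in $H^k$ and uniformly in $(x,t)$. Then: 1. There are $\varepsilon,C>0$ such that for all $|\mu|,|\nu|<\varepsilon$ with $R(\mu,\nu)\ge0$ there is $|A|\ge0$ with $\big||A|^2-R(\mu,\nu)\big|\le C(|\mu|+|\nu|)^2$ for which $(\ast)$ holds with the constant $C$. 2. For every $c>0$ there are $\varepsilon,C>0$ such that, for all $|\mu|,|\nu|<\varepsilon$ with $R(\mu,\nu)\ge c(|\mu|+|\nu|)$, $(\ast)$ holds with $|A|=\sqrt{R(\mu,\nu)}$ and the constant $C$. -/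

import Mathlib

open scoped ContDiff ComplexConjugate

noncomputable section

namespace BonaSmith

/-! ### Doubly periodic Sobolev spaces; functions are written `w x t` -/

/-- `w` is `2π`-periodic in `x` and in `t`. -/
def DoublyPeriodic (w : ℝ → ℝ → ℝ) : Prop :=
  ∀ x t, w (x + 2 * Real.pi) t = w x t ∧ w x (t + 2 * Real.pi) = w x t

/-- The Fourier coefficient of `w` at `e^{i(mx+nt)}`. -/
def fourierCoef (w : ℝ → ℝ → ℝ) (m n : ℤ) : ℂ :=
  (1 / (4 * (Real.pi : ℂ) ^ 2)) *
    ∫ x in (-Real.pi)..Real.pi, ∫ t in (-Real.pi)..Real.pi,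
      (w x t : ℂ) * Complex.exp (-(Complex.I * ((m : ℂ) * (x : ℂ) + (n : ℂ) * (t : ℂ))))

/-- The general term of the squared norm of `H^k((ℝ/2πℤ)²)`. -/
def sobolevTerm (k : ℕ) (w : ℝ → ℝ → ℝ) (mn : ℤ × ℤ) : ℝ :=
  (1 + (mn.1 : ℝ) ^ 2 + (mn.2 : ℝ) ^ 2) ^ k * ‖fourierCoef w mn.1 mn.2‖ ^ 2

/-- Membership in `H^k((ℝ/2πℤ)²)`. -/
structure MemH (k : ℕ) (w : ℝ → ℝ → ℝ) : Prop where
  periodic : DoublyPeriodic w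
  measurable : Measurable (Function.uncurry w)
  sq_integrable : MeasureTheory.IntegrableOn (fun z : ℝ × ℝ => w z.1 z.2 ^ 2)
    (Set.Icc (-Real.pi) Real.pi ×ˢ Set.Icc (-Real.pi) Real.pi)
  summable : Summable (sobolevTerm k w)

/-- The norm of `H^k((ℝ/2πℤ)²)`. -/
def sobolevNorm (k : ℕ) (w : ℝ → ℝ → ℝ) : ℝ :=
  Real.sqrt (∑' mn : ℤ × ℤ, sobolevTerm k w mn)

/-- `H^k` functions that are even in `x` and whose `x`-average does not depend on `t`. -/
def MemHEvenZero (k : ℕ) (w : ℝ → ℝ → ℝ) : Prop :=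
  MemH k w ∧ (∀ x t, w (-x) t = w x t) ∧ ∀ n : ℤ, n ≠ 0 → fourierCoef w 0 n = 0

/-- `H^k` functions that are odd in `x`. -/
def MemHOdd (k : ℕ) (w : ℝ → ℝ → ℝ) : Prop :=
  MemH k w ∧ ∀ x t, w (-x) t = -w x t

/-- The average of `w` over a period cell. -/
def average (w : ℝ → ℝ → ℝ) : ℝ :=
  (1 / (4 * Real.pi ^ 2)) *
    ∫ x in (-Real.pi)..Real.pi, ∫ t in (-Real.pi)..Real.pi, w x t

/-- `w` has size at most `e`, both in `H^k` and uniformly in `(x,t)`. -/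
def SizeLE (k : ℕ) (w : ℝ → ℝ → ℝ) (e : ℝ) : Prop :=
  MemH k w ∧ sobolevNorm k w ≤ e ∧ ∀ x t, |w x t| ≤ e

/-! ### The rescaled Bona-Smith system -/

/-- Partial derivative in `x`. -/
def dx (w : ℝ → ℝ → ℝ) : ℝ → ℝ → ℝ := fun x t => deriv (fun y => w y t) x

/-- Partial derivative in `t`. -/
def dt (w : ℝ → ℝ → ℝ) : ℝ → ℝ → ℝ := fun x t => deriv (fun r => w x r) t

/-- Doubly periodic distributional solutions of
`η_t + β u_x - α η_xxt + β (uη)_x = 0`,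
`u_t + β η_x - γαβ η_xxx - α u_xxt + β u u_x = 0`
(each equation is tested against smooth doubly periodic `φ`). -/
structure IsSolution (α β γ : ℝ) (η u : ℝ → ℝ → ℝ) : Prop where
  first : ∀ φ : ℝ → ℝ → ℝ, ContDiff ℝ ∞ (Function.uncurry φ) → DoublyPeriodic φ →
    ∫ x in (-Real.pi)..Real.pi, ∫ t in (-Real.pi)..Real.pi,
      (η x t * dt φ x t + β * u x t * dx φ x t - α * η x t * dt (dx (dx φ)) x t
        + β * (u x t * η x t) * dx φ x t) = 0
  second : ∀ φ : ℝ → ℝ → ℝ, ContDiff ℝ ∞ (Function.uncurry φ) → DoublyPeriodic φ →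
    ∫ x in (-Real.pi)..Real.pi, ∫ t in (-Real.pi)..Real.pi,
      (u x t * dt φ x t + β * η x t * dx φ x t - γ * α * β * η x t * dx (dx (dx φ)) x t
        - α * u x t * dt (dx (dx φ)) x t + β * (u x t ^ 2 / 2) * dx φ x t) = 0

/-- Standing waves `(η, u) ∈ H^{k,e}_{♮♮,0} × H^{k,o}_{♮♮}` (represented by continuous
functions) for which the average of `η` is `B`. -/
structure IsStandingWave (k : ℕ) (α β γ B : ℝ) (η u : ℝ → ℝ → ℝ) : Prop where
  eta_mem : MemHEvenZero k η
  u_mem : MemHOdd k u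
  eta_continuous : Continuous (Function.uncurry η)
  u_continuous : Continuous (Function.uncurry u)
  solution : IsSolution α β γ η u
  average_eq : average η = B

/-! ### Critical wave numbers and the coefficients of the expansion -/

/-- The set `Σ_{(α,β,γ)}` of pairs of positive integers. -/
def criticalSet (α β γ : ℝ) : Set (ℕ × ℕ) :=
  {pq | 0 < pq.1 ∧ 0 < pq.2 ∧
    (pq.2 : ℝ) * (1 + α * (pq.1 : ℝ) ^ 2)
      - β * (pq.1 : ℝ) * Real.sqrt (1 + γ * α * (pq.1 : ℝ) ^ 2) = 0}

/-- `√(1 + γ α p²)`. -/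
def sFac (α γ : ℝ) (p : ℕ) : ℝ := Real.sqrt (1 + γ * α * (p : ℝ) ^ 2)

/-- Coefficient of `|A|² cos 2px` in the first component of the quadratic part. -/
def alpha20 (α γ : ℝ) (p : ℕ) : ℝ :=
  (1 + γ * α * (p : ℝ) ^ 2) / (2 * (1 + 4 * γ * α * (p : ℝ) ^ 2))

/-- The common denominator of `α₁` and `β₁`. -/
def den22 (α γ : ℝ) (p q : ℕ) : ℝ :=
  4 * α * p * q * (2 - γ + 5 * α * (p : ℝ) ^ 2 + 4 * γ * α ^ 2 * (p : ℝ) ^ 4)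

/-- `α₁`: `η`-coefficient of the second harmonic. -/
def alpha1 (α β γ : ℝ) (p q : ℕ) : ℝ :=
  β * (1 + 3 * α * (p : ℝ) ^ 2) * sFac α γ p ^ 3 / den22 α γ p q

/-- `β₁`: `u`-coefficient of the second harmonic. -/
def beta1 (α β γ : ℝ) (p q : ℕ) : ℝ :=
  -β * (1 + 2 * α * (p : ℝ) ^ 2 + 3 * γ * α * (p : ℝ) ^ 2 + 4 * γ * α ^ 2 * (p : ℝ) ^ 4)
    * (1 + γ * α * (p : ℝ) ^ 2) / den22 α γ p q

/-- Pairs of complex functions of `(x,t)`. -/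
abbrev CPair : Type := (ℝ → ℝ → ℂ) × (ℝ → ℝ → ℂ)

/-- `(I - π₀) g`, with `π₀ g` the average in `x`. -/
def fluct (g : ℝ → ℝ → ℂ) : ℝ → ℝ → ℂ := fun x t =>
  g x t - (1 / (2 * (Real.pi : ℂ))) * ∫ y in (-Real.pi)..Real.pi, g y t

/-- `2 N(U, V) = ((I - π₀) u₁u₂, u₁η₂ + u₂η₁)` for `U = (η₁, u₁)`, `V = (η₂, u₂)`. -/
def twoN (U V : CPair) : CPair :=
  (fluct fun x t => U.2 x t * V.2 x t, fun x t => U.2 x t * V.1 x t + V.2 x t * U.1 x t)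

/-- The Hermitian product of `L² × L²` on the period cell. -/
def herm (F G : CPair) : ℂ :=
  ∫ x in (-Real.pi)..Real.pi, ∫ t in (-Real.pi)..Real.pi,
    (F.1 x t * conj (G.1 x t) + F.2 x t * conj (G.2 x t))

/-- The kernel vector `ξ₀ = e^{iqt} (cos px, -i √(1+γαp²) sin px)`. -/
def xi (α γ : ℝ) (p q : ℕ) : CPair :=
  (fun x t => Complex.exp (Complex.I * (q : ℂ) * (t : ℂ)) * (Real.cos (p * x) : ℂ),
   fun x t => -Complex.I * (sFac α γ p : ℂ) * Complex.exp (Complex.I * (q : ℂ) * (t : ℂ))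
      * (Real.sin (p * x) : ℂ))

/-- The complex conjugate of `ξ₀`. -/
def xiBar (α γ : ℝ) (p q : ℕ) : CPair :=
  (fun x t => conj ((xi α γ p q).1 x t), fun x t => conj ((xi α γ p q).2 x t))

/-- The coefficient `y^{(2,0)}` of `|A|²` in the quadratic part. -/
def y20 (α γ : ℝ) (p : ℕ) : CPair :=
  (fun x _ => (alpha20 α γ p : ℂ) * (Real.cos (2 * p * x) : ℂ), fun _ _ => 0)

/-- The coefficient `y^{(2,2)}` of `A²` in the quadratic part. -/
def y22 (α β γ : ℝ) (p q : ℕ) : CPair :=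
  (fun x t => (alpha1 α β γ p q : ℂ) * (Real.cos (2 * p * x) : ℂ)
      * Complex.exp (2 * Complex.I * (q : ℂ) * (t : ℂ)),
   fun x t => Complex.I * (beta1 α β γ p q : ℂ) * (Real.sin (2 * p * x) : ℂ)
      * Complex.exp (2 * Complex.I * (q : ℂ) * (t : ℂ)))

/-- The cubic coefficient
`β₂ = (β / 2π²) ⟨2N(y^{(2,0)}, ξ₀) + 2N(y^{(2,2)}, ξ̄₀), ξ₀⟩` (a real number). -/
def beta2 (α β γ : ℝ) (p q : ℕ) : ℝ :=
  (β / (2 * Real.pi ^ 2)) *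
    (herm (twoN (y20 α γ p) (xi α γ p q) + twoN (y22 α β γ p q) (xiBar α γ p q))
      (xi α γ p q)).re

/-- The principal part of `|A|²` as a function of `(μ, ν)`, for `B = 0`. -/
def ampSq (α β γ : ℝ) (p q : ℕ) (μ ν : ℝ) : ℝ :=
  -(1 / beta2 α β γ p q) *
    (-(2 * p * q * sFac α γ p - γ * β * (p : ℝ) ^ 2) * μ
      + (2 + 2 * γ * α * (p : ℝ) ^ 2) * ν)

/-- The denominator of the coefficients of `μ` and `ν` in the expansion. -/
def den11 (α β γ : ℝ) (p q : ℕ) : ℝ :=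
  (q * (1 + α * (p : ℝ) ^ 2) * sFac α γ p + β * p) * (2 + γ * α * (p : ℝ) ^ 2)

/-- The explicit part of the expansion of the free surface, with `A` standing for `|A|`. -/
def etaExpansion (α β γ : ℝ) (p q : ℕ) (μ ν A x t : ℝ) : ℝ :=
  2 * A * Real.cos (q * t) * Real.cos (p * x)
  + 2 * A * Real.cos (q * t) * Real.cos (p * x) *
    (μ * (γ * α * (p : ℝ) ^ 4 * q * sFac α γ p
        - γ * β * (p : ℝ) ^ 3 * (1 + γ * α * (p : ℝ) ^ 2)) / den11 α β γ p q
      - ν * (γ * α * (p : ℝ) ^ 3 * (1 + γ * α * (p : ℝ) ^ 2)) / den11 α β γ p q)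
  + A ^ 2 *
    ((1 + γ * α * (p : ℝ) ^ 2) / (2 * (1 + 4 * γ * α * (p : ℝ) ^ 2)) * Real.cos (2 * p * x)
      + 2 * β * (1 + 3 * α * (p : ℝ) ^ 2) * sFac α γ p ^ 3 / den22 α γ p q
        * Real.cos (2 * q * t) * Real.cos (2 * p * x))

/-- At the parameters `(α₀ + μ, β₀ + ν, γ₀)` there is a family of standing waves
`(η₀(x, t - τ), u₀(x, t - τ))`, `τ ∈ ℝ`, with `B = 0` and amplitude `A`: the profile
`(η₀, u₀)` has the leading terms `2A cos q₀t cos p₀x`, `2A √(1+γ₀α₀p₀²) sin q₀t sin p₀x`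
up to `C A (|μ| + |ν| + A)`, and `η₀` is the explicit expansion up to
`C (A + |μ| + |ν|)³`. -/
def HasWaveFamily (k : ℕ) (α₀ β₀ γ₀ : ℝ) (p₀ q₀ : ℕ) (μ ν A C : ℝ) : Prop :=
  ∃ η₀ u₀ : ℝ → ℝ → ℝ,
    (∀ τ : ℝ, IsStandingWave k (α₀ + μ) (β₀ + ν) γ₀ 0
      (fun x t => η₀ x (t - τ)) (fun x t => u₀ x (t - τ))) ∧
    SizeLE k (fun x t => η₀ x t - 2 * A * Real.cos (q₀ * t) * Real.cos (p₀ * x))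
      (C * (A * (|μ| + |ν| + A))) ∧
    SizeLE k (fun x t => u₀ x t
        - 2 * sFac α₀ γ₀ p₀ * A * Real.sin (q₀ * t) * Real.sin (p₀ * x))
      (C * (A * (|μ| + |ν| + A))) ∧
    SizeLE k (fun x t => η₀ x t - etaExpansion α₀ β₀ γ₀ p₀ q₀ μ ν A x t)
      (C * (A + |μ| + |ν|) ^ 3)

end BonaSmith

end

/-! Waves are sought as η = Σ a cos(mx) cos(l q₀ t), u = Σ b sin(mx) sin(l q₀ t). Fixing the parity
in time removes the freedom of time translation, which is restored at the end by shifting. The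
coefficients lie in a weighted ℓ¹ space (`Coefs`). Its weight is submultiplicative, so products are
bounded bilinear maps, and the space embeds both in H^k and in the bounded continuous functions, so
one coefficient estimate gives both error bounds. Continuous linear maps on it are determined by
their values on single modes, so the products, the weak equations and the Fourier coefficients are
all checked mode by mode.

Linear part. At frequencies (m, n) the determinant is `symb` = β²m²(1+γαm²) − n²(1+αm²)². For m ≠ 0
it vanishes only at (p₀, q₀), and nonresonance gives |symb| ≥ c(1+n²)m⁴ elsewhere
(`exists_symb_lower_bound`). With the unknowns (m η_m, u_m), this makes the inverse off the critical
mode bounded even when composed with the unbounded operators by which μ and ν perturb the equations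
(`bdd_monomial`). The problem then depends smoothly on P = (μ, ν), with no loss of derivatives.

Elimination of the amplitude. Odd time frequencies are multiplied by A and even ones by A². Products
of two odd parts are even, so after division by these factors only A² appears, in front of all
products other than odd times odd (`Graded.scale_mul`). The amplitude is normalised by prescribing
the first harmonic of η as 2A(1+κ(P)) cos p₀x cos q₀t; this is a free choice, and it makes the μ, ν
coefficients of the expansion hold by construction. One critical equation determines the
corresponding coefficient of u, and the other becomes the scalar relation A² · `cubicFactor` =
−2(1+κ) · `critDet`. It is solved for A² (`ampSqOf`), leaving the equation `residual` (P, z) = 0 for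
the state z alone (`mode_equations_of_residual`).

Branch. At P = 0 the critical determinant vanishes, so A² = 0 and the equation is z − ξ + βN(z, z) =
0. Here N sees only odd time frequencies and produces only even ones, hence it is nilpotent. The
solution is z₀ = ξ − βN(ξ, ξ), whose second harmonics are those of the statement (`baseState_eq`),
and the derivative is id + T with T² = 0. The implicit function theorem gives z = z₀ + O(P)
(`exists_branch_of_nilpotent`). Since `cubicFactor` equals 2βp₀²β₂ at z₀, linearising `critDet`
gives A² = R + O(|P|²).

Conclusions. If the computed A² is negative while R ≥ 0, then R itself is O(|P|²) and the zero
solution with A = 0 serves. If R ≥ c(|μ|+|ν|), then A differs from √R by a relative amount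
O(|μ|+|ν|), and |μ|+|ν| is at most R/c, so replacing A by √R costs only cubic terms
(`HasCoefFamily.change`). -/

open scoped ContDiff ComplexConjugate

noncomputable section

namespace BonaSmith

/-! ### Weighted summable coefficient families -/

/-- The weight of the mode `(m, l)`. -/
def wt (k q : ℕ) (i : ℕ × ℕ) : ℝ := (1 + (i.1 : ℝ) + (q : ℝ) * (i.2 : ℝ)) ^ k

theorem one_le_wt (k q : ℕ) (i : ℕ × ℕ) : 1 ≤ wt k q i := by
  unfold wt
  apply one_le_pow₀
  have : (0 : ℝ) ≤ (q : ℝ) * (i.2 : ℝ) := by positivity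
  have : (0 : ℝ) ≤ (i.1 : ℝ) := by positivity
  linarith

theorem wt_pos (k q : ℕ) (i : ℕ × ℕ) : 0 < wt k q i := lt_of_lt_of_le one_pos (one_le_wt k q i)

/-- From 1 + x + y ≤ (1 + x)(1 + y) for x, y ≥ 0. Products of modes only create frequencies |i ± j|
≤ i + j, so this makes multiplication bounded on `Coefs`. -/
theorem wt_le_mul {k q : ℕ} {i j s : ℕ × ℕ} (h1 : s.1 ≤ i.1 + j.1) (h2 : s.2 ≤ i.2 + j.2) :
    wt k q s ≤ wt k q i * wt k q j := by
  unfold wt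
  rw [← mul_pow]
  have h1' : (s.1 : ℝ) ≤ i.1 + j.1 := by exact_mod_cast h1
  have h2' : (s.2 : ℝ) ≤ i.2 + j.2 := by exact_mod_cast h2
  have hq : (0 : ℝ) ≤ q := by positivity
  have := mul_le_mul_of_nonneg_left h2' hq
  have e1 : (0 : ℝ) ≤ i.1 := by positivity
  have e2 : (0 : ℝ) ≤ j.1 := by positivity
  have e3 : (0 : ℝ) ≤ q * i.2 := by positivity
  have e4 : (0 : ℝ) ≤ q * j.2 := by positivity
  apply pow_le_pow_left₀ (by positivity)
  nlinarith [mul_nonneg e1 e2, mul_nonneg e1 e4, mul_nonneg e3 e2, mul_nonneg e3 e4]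

/-- A bounded family of multipliers. -/
def BddFamily (φ : ℕ × ℕ → ℝ) : Prop := ∃ C, ∀ i, |φ i| ≤ C

/-- Absolutely summable families indexed by the modes `(m, l)`; the entry at `(m, l)` is the
coefficient multiplied by `wt k q (m, l)`. -/
def Coefs (_k _q : ℕ) : Type := lp (fun _ : ℕ × ℕ => ℝ) 1

namespace Coefs

variable {k q : ℕ}

instance : NormedAddCommGroup (Coefs k q) :=
  inferInstanceAs (NormedAddCommGroup (lp (fun _ : ℕ × ℕ => ℝ) 1))

instance : NormedSpace ℝ (Coefs k q) :=
  inferInstanceAs (NormedSpace ℝ (lp (fun _ : ℕ × ℕ => ℝ) 1))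

instance : CompleteSpace (Coefs k q) :=
  inferInstanceAs (CompleteSpace (lp (fun _ : ℕ × ℕ => ℝ) 1))

/-- The weighted entries. -/
def entry (f : Coefs k q) (i : ℕ × ℕ) : ℝ := (f.1 : ∀ _ : ℕ × ℕ, ℝ) i

theorem entry_add (f g : Coefs k q) (i : ℕ × ℕ) : entry (f + g) i = entry f i + entry g i := rfl

theorem entry_smul (c : ℝ) (f : Coefs k q) (i : ℕ × ℕ) : entry (c • f) i = c * entry f i := rfl

theorem summable_entry (f : Coefs k q) : Summable fun i => ‖entry f i‖ := by
  have := (lp.hasSum_norm (E := fun _ : ℕ × ℕ => ℝ) (p := 1) (by norm_num) f).summable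
  simp only [ENNReal.toReal_one, Real.rpow_one] at this
  exact this

theorem norm_eq (f : Coefs k q) : ‖f‖ = ∑' i, ‖entry f i‖ := by
  have := lp.hasSum_norm (E := fun _ : ℕ × ℕ => ℝ) (p := 1) (by norm_num) f
  simp only [ENNReal.toReal_one, Real.rpow_one] at this
  exact this.tsum_eq.symm

/-- The family with coefficient `1` at the mode `i` and `0` elsewhere. -/
def basis (i : ℕ × ℕ) : Coefs k q := lp.single (E := fun _ : ℕ × ℕ => ℝ) 1 i (wt k q i)

theorem entry_basis (i j : ℕ × ℕ) :
    entry (basis i : Coefs k q) j = if j = i then wt k q i else 0 := by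
  change (lp.single (E := fun _ : ℕ × ℕ => ℝ) 1 i (wt k q i)) j = _
  rw [lp.single_apply, Pi.single_apply]

theorem norm_basis (i : ℕ × ℕ) : ‖(basis i : Coefs k q)‖ = wt k q i := by
  have := lp.norm_single (E := fun _ : ℕ × ℕ => ℝ) (p := 1) (by norm_num) i (wt k q i)
  rw [Real.norm_of_nonneg (wt_pos k q i).le] at this
  exact this

theorem hasSum_basis (f : Coefs k q) :
    HasSum (fun i => (entry f i / wt k q i) • (basis i : Coefs k q)) f := by
  have key : (fun i => (entry f i / wt k q i) • (basis i : Coefs k q)) =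
      fun i => lp.single (E := fun _ : ℕ × ℕ => ℝ) 1 i (entry f i) := by
    funext i
    have h := lp.single_smul (E := fun _ : ℕ × ℕ => ℝ) (𝕜 := ℝ) 1 i
      (entry f i / wt k q i) (wt k q i)
    rw [smul_eq_mul, div_mul_cancel₀ _ (wt_pos k q i).ne'] at h
    exact h.symm
  rw [key]
  exact lp.hasSum_single (E := fun _ : ℕ × ℕ => ℝ) (p := 1) (by norm_num) f

variable {G : Type*} [NormedAddCommGroup G] [NormedSpace ℝ G]

/-- Continuous linear maps on `Coefs` are determined by their values on the basis. -/
theorem ext_basis {S T : Coefs k q →L[ℝ] G} (h : ∀ i, S (basis i) = T (basis i)) : S = T := by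
  ext f
  have h1 := (hasSum_basis f).mapL S
  have h2 := (hasSum_basis f).mapL T
  simp only [map_smul, h] at h1 h2
  exact h1.unique h2

/-- Reduces bilinear identities, such as the product formulas and the parity rule, to pairs of
single modes. -/
theorem ext_basis₂ {k' q' : ℕ} {S T : Coefs k q →L[ℝ] Coefs k' q' →L[ℝ] G}
    (h : ∀ i j, S (basis i) (basis j) = T (basis i) (basis j)) : S = T :=
  ext_basis fun i => ext_basis fun j => h i j

/-- The universal property of ℓ¹: vectors growing no faster than the norms of the basis elements are
the values of a bounded linear map. -/
theorem summable_lift {v : ℕ × ℕ → G} {C : ℝ} (h : ∀ i, ‖v i‖ ≤ C * wt k q i) (f : Coefs k q) :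
    Summable (fun i => ‖(entry f i / wt k q i) • v i‖) ∧
      ∑' i, ‖(entry f i / wt k q i) • v i‖ ≤ C * ‖f‖ := by
  have hb : ∀ i, ‖(entry f i / wt k q i) • v i‖ ≤ C * ‖entry f i‖ := fun i => by
    have hw := wt_pos k q i
    rw [norm_smul, norm_div, Real.norm_of_nonneg hw.le, div_mul_eq_mul_div, div_le_iff₀ hw]
    calc _ ≤ ‖entry f i‖ * (C * wt k q i) := by gcongr; exact h i
      _ = _ := by ring
  have hs := (summable_entry f).mul_left C
  have h1 := Summable.of_nonneg_of_le (fun i => norm_nonneg _) hb hs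
  refine ⟨h1, ?_⟩
  rw [norm_eq, ← tsum_mul_left]
  exact h1.tsum_le_tsum hb hs

section lift

variable [CompleteSpace G]

/-- The continuous linear map with prescribed values on the basis. -/
def lift (v : ℕ × ℕ → G) (h : ∃ C, ∀ i, ‖v i‖ ≤ C * wt k q i) : Coefs k q →L[ℝ] G :=
  LinearMap.mkContinuous
    { toFun := fun f => ∑' i, (entry f i / wt k q i) • v i
      map_add' := fun f g => by
        obtain ⟨C, hC⟩ := h
        rw [← (summable_lift hC f).1.of_norm.tsum_add (summable_lift hC g).1.of_norm]
        simp only [entry_add, add_div, add_smul]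
      map_smul' := fun c f => by
        obtain ⟨C, hC⟩ := h
        simp only [entry_smul, RingHom.id_apply, mul_div_assoc, mul_smul]
        exact (summable_lift hC f).1.of_norm.tsum_const_smul c }
    h.choose fun f =>
      (norm_tsum_le_tsum_norm (summable_lift h.choose_spec f).1).trans
        (summable_lift h.choose_spec f).2

theorem lift_apply (v : ℕ × ℕ → G) (h : ∃ C, ∀ i, ‖v i‖ ≤ C * wt k q i) (f : Coefs k q) :
    lift v h f = ∑' i, (entry f i / wt k q i) • v i := rfl

@[simp] theorem lift_basis (v : ℕ × ℕ → G) (h : ∃ C, ∀ i, ‖v i‖ ≤ C * wt k q i) (i : ℕ × ℕ) :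
    lift v h (basis i) = v i := by
  rw [lift_apply, tsum_eq_single i]
  · simp [entry_basis, div_self (wt_pos k q i).ne']
  · intro j hj
    simp [entry_basis, hj]

theorem norm_lift_apply_le {v : ℕ × ℕ → G} {C : ℝ} (h : ∀ i, ‖v i‖ ≤ C * wt k q i)
    (f : Coefs k q) : ‖lift v ⟨C, h⟩ f‖ ≤ C * ‖f‖ := by
  rw [lift_apply]
  exact (norm_tsum_le_tsum_norm (summable_lift h f).1).trans (summable_lift h f).2

theorem norm_lift_le {v : ℕ × ℕ → G} {C : ℝ} (hC : 0 ≤ C) (h : ∀ i, ‖v i‖ ≤ C * wt k q i) :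
    ‖lift v ⟨C, h⟩‖ ≤ C :=
  ContinuousLinearMap.opNorm_le_bound _ hC (norm_lift_apply_le h)

end lift

/-- The coefficient at the mode `i`. -/
def coef (i : ℕ × ℕ) : Coefs k q →L[ℝ] ℝ :=
  lift (fun j => if j = i then 1 else 0) ⟨1, fun j => by
    have := one_le_wt k q j
    split_ifs <;> simp <;> linarith⟩

@[simp] theorem coef_basis (i j : ℕ × ℕ) :
    coef i (basis j : Coefs k q) = if j = i then 1 else 0 := by simp [coef]

theorem coef_eq (i : ℕ × ℕ) (f : Coefs k q) : coef i f = entry f i / wt k q i := by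
  rw [coef, lift_apply, tsum_eq_single i]
  · simp
  · intro j hj
    simp [hj]

theorem ext_coef {f g : Coefs k q} (h : ∀ i, coef i f = coef i g) : f = g := by
  have h1 := hasSum_basis f
  have h2 := hasSum_basis g
  simp only [← coef_eq, h] at h1 h2
  exact h1.unique h2

theorem hasSum_coef_smul (T : Coefs k q →L[ℝ] G) (f : Coefs k q) :
    HasSum (fun i => coef i f • T (basis i)) (T f) := by
  simpa only [map_smul, ← coef_eq] using (hasSum_basis f).mapL T

/-- The diagonal operator with the entries `φ`. -/
def diag (φ : ℕ × ℕ → ℝ) (h : BddFamily φ) : Coefs k q →L[ℝ] Coefs k q :=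
  lift (fun i => φ i • basis i) (by
    obtain ⟨C, hC⟩ := h
    refine ⟨C, fun i => ?_⟩
    rw [norm_smul, norm_basis, Real.norm_eq_abs]
    exact mul_le_mul_of_nonneg_right (hC i) (wt_pos k q i).le)

@[simp] theorem diag_basis (φ : ℕ × ℕ → ℝ) (h : BddFamily φ) (i : ℕ × ℕ) :
    diag φ h (basis i : Coefs k q) = φ i • basis i := by simp [diag]

@[simp] theorem coef_diag (φ : ℕ × ℕ → ℝ) (h : BddFamily φ) (i : ℕ × ℕ)
    (f : Coefs k q) : coef i (diag φ h f) = φ i * coef i f := by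
  have : (coef i).comp (diag φ h) = φ i • (coef i : Coefs k q →L[ℝ] ℝ) :=
    ext_basis fun j => by
      by_cases hj : j = i <;> simp [hj]
  exact DFunLike.congr_fun this f

end Coefs

end BonaSmith

namespace BonaSmith

namespace Coefs

variable {k q : ℕ}

/-! ### Products of cosine and sine series -/

/-- The coefficients of `cos (a x) cos (b q t)`. -/
def cosEl (k q : ℕ) (a b : ℤ) : Coefs k q := basis (a.natAbs, b.natAbs)

/-- The coefficients of `sin (a x) sin (b q t)`. -/
def sinEl (k q : ℕ) (a b : ℤ) : Coefs k q :=
  ((a.sign * b.sign : ℤ) : ℝ) • basis (a.natAbs, b.natAbs)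

theorem abs_sign_cast_le (a : ℤ) : |((a.sign : ℤ) : ℝ)| ≤ 1 := by
  rcases lt_trichotomy a 0 with h | h | h
  · simp [Int.sign_eq_neg_one_of_neg h]
  · simp [h]
  · simp [Int.sign_eq_one_of_pos h]

theorem norm_cosEl_le {a b : ℤ} {i j : ℕ × ℕ} (h1 : a.natAbs ≤ i.1 + j.1)
    (h2 : b.natAbs ≤ i.2 + j.2) : ‖cosEl k q a b‖ ≤ wt k q i * wt k q j := by
  rw [cosEl, norm_basis]
  exact wt_le_mul h1 h2

theorem norm_sinEl_le {a b : ℤ} {i j : ℕ × ℕ} (h1 : a.natAbs ≤ i.1 + j.1)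
    (h2 : b.natAbs ≤ i.2 + j.2) : ‖sinEl k q a b‖ ≤ wt k q i * wt k q j := by
  rw [sinEl, norm_smul, norm_basis, Real.norm_eq_abs, Int.cast_mul, abs_mul]
  calc _ ≤ 1 * 1 * wt k q (a.natAbs, b.natAbs) := by
        have := (wt_pos k q (a.natAbs, b.natAbs)).le
        gcongr <;> exact abs_sign_cast_le _
    _ ≤ _ := by
        rw [one_mul, one_mul]
        exact wt_le_mul h1 h2

/-- The bilinear extension of a family of products of basis elements. -/
def bilin (v : ℕ × ℕ → ℕ × ℕ → Coefs k q) (h : ∀ i j, ‖v i j‖ ≤ wt k q i * wt k q j) :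
    Coefs k q →L[ℝ] Coefs k q →L[ℝ] Coefs k q :=
  lift (fun i => lift (v i) ⟨wt k q i, h i⟩)
    ⟨1, fun i => by
      rw [one_mul]
      exact norm_lift_le (wt_pos k q i).le (h i)⟩

@[simp] theorem bilin_basis (v : ℕ × ℕ → ℕ × ℕ → Coefs k q)
    (h : ∀ i j, ‖v i j‖ ≤ wt k q i * wt k q j) (i j : ℕ × ℕ) :
    bilin v h (basis i) (basis j) = v i j := by simp [bilin]

theorem norm_quarter_sum_le {a b c d : Coefs k q} {C : ℝ} (ha : ‖a‖ ≤ C) (hb : ‖b‖ ≤ C)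
    (hc : ‖c‖ ≤ C) (hd : ‖d‖ ≤ C) : ‖(1 / 4 : ℝ) • (a + b + c + d)‖ ≤ C := by
  rw [norm_smul, Real.norm_of_nonneg (by norm_num)]
  have := norm_add_le (a + b + c) d
  have := norm_add_le (a + b) c
  have := norm_add_le a b
  linarith

/-- The product of a double sine series and a double cosine series. -/
def mulSC (k q : ℕ) : Coefs k q →L[ℝ] Coefs k q →L[ℝ] Coefs k q :=
  bilin (fun i j => (1 / 4 : ℝ) •
      (sinEl k q (i.1 + j.1) (i.2 + j.2) + sinEl k q (i.1 + j.1) (i.2 - j.2)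
        + sinEl k q (i.1 - j.1) (i.2 + j.2) + sinEl k q (i.1 - j.1) (i.2 - j.2)))
    fun i j => by
      apply norm_quarter_sum_le <;> apply norm_sinEl_le <;> omega

/-- The product of two double sine series. -/
def mulSS (k q : ℕ) : Coefs k q →L[ℝ] Coefs k q →L[ℝ] Coefs k q :=
  bilin (fun i j => (1 / 4 : ℝ) •
      (cosEl k q (i.1 + j.1) (i.2 + j.2) + -cosEl k q (i.1 + j.1) (i.2 - j.2)
        + -cosEl k q (i.1 - j.1) (i.2 + j.2) + cosEl k q (i.1 - j.1) (i.2 - j.2)))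
    fun i j => by
      apply norm_quarter_sum_le <;> try rw [norm_neg]
      all_goals apply norm_cosEl_le <;> omega

theorem mulSC_basis (i j : ℕ × ℕ) : mulSC k q (basis i) (basis j) = (1 / 4 : ℝ) •
      (sinEl k q (i.1 + j.1) (i.2 + j.2) + sinEl k q (i.1 + j.1) (i.2 - j.2)
        + sinEl k q (i.1 - j.1) (i.2 + j.2) + sinEl k q (i.1 - j.1) (i.2 - j.2)) :=
  bilin_basis _ _ i j

theorem mulSS_basis (i j : ℕ × ℕ) : mulSS k q (basis i) (basis j) = (1 / 4 : ℝ) •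
      (cosEl k q (i.1 + j.1) (i.2 + j.2) + -cosEl k q (i.1 + j.1) (i.2 - j.2)
        + -cosEl k q (i.1 - j.1) (i.2 + j.2) + cosEl k q (i.1 - j.1) (i.2 - j.2)) :=
  bilin_basis _ _ i j

/-! ### Parity of the time frequency -/

theorem bddFamily_odd : BddFamily fun i => if Odd i.2 then 1 else 0 :=
  ⟨1, fun i => by
    beta_reduce
    split_ifs <;> simp⟩

/-- The projection onto the modes `(m, l)` with `l` odd. -/
def oddPart : Coefs k q →L[ℝ] Coefs k q :=
  diag _ bddFamily_odd

@[simp] theorem oddPart_basis (i : ℕ × ℕ) :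
    oddPart (basis i : Coefs k q) = if Odd i.2 then basis i else 0 := by
  rw [oddPart, diag_basis]; split_ifs <;> simp

@[simp] theorem coef_oddPart (i : ℕ × ℕ) (f : Coefs k q) :
    coef i (oddPart f) = if Odd i.2 then coef i f else 0 := by
  rw [oddPart, coef_diag]; split_ifs <;> simp

@[simp] theorem oddPart_oddPart (f : Coefs k q) : oddPart (oddPart f) = oddPart f :=
  ext_coef fun i => by simp only [coef_oddPart]; split_ifs <;> rfl

theorem oddPart_diag (φ : ℕ × ℕ → ℝ) (h : BddFamily φ) (f : Coefs k q) :
    oddPart (diag φ h f) = diag φ h (oddPart f) :=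
  ext_coef fun i => by simp

/-- A bilinear map compatible with the parity of the time frequency. -/
def Graded (B : Coefs k q →L[ℝ] Coefs k q →L[ℝ] Coefs k q) : Prop :=
  ∀ f g, oddPart (B f g) = B (oddPart f) (g - oddPart g) + B (f - oddPart f) (oddPart g)

/-- A sum of two frequencies is odd exactly when one of them is odd and the other even; both sides
are bilinear, so single modes suffice. -/
theorem graded_of_basis {B : Coefs k q →L[ℝ] Coefs k q →L[ℝ] Coefs k q}
    (h : ∀ i j, oddPart (B (basis i) (basis j)) =
      if Odd (i.2 + j.2) then B (basis i) (basis j) else 0) : Graded B := by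
  intro f g
  have := ext_basis₂ (S := (ContinuousLinearMap.compL ℝ _ _ _ oddPart).comp B)
    (T := B.bilinearComp oddPart (.id ℝ _ - oddPart) + B.bilinearComp (.id ℝ _ - oddPart) oddPart)
    fun i j => by
      simp only [ContinuousLinearMap.comp_apply, ContinuousLinearMap.compL_apply, h,
        add_apply, ContinuousLinearMap.bilinearComp_apply,
        sub_apply, ContinuousLinearMap.id_apply, oddPart_basis]
      by_cases hi : Odd i.2 <;> by_cases hj : Odd j.2 <;>
        simp [hi, hj, Nat.odd_add, ← Nat.not_odd_iff_even]
  simpa using DFunLike.congr_fun (DFunLike.congr_fun this f) g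

/-- The two time frequencies produced, the sum and the absolute difference, have the same parity. -/
theorem graded_mulSC : Graded (mulSC k q) := graded_of_basis fun i j => by
  have h1 : Odd ((i.2 : ℤ) + j.2).natAbs ↔ Odd (i.2 + j.2) := by
    rw [Int.natAbs_odd]; exact_mod_cast Iff.rfl
  have h2 : Odd ((i.2 : ℤ) - j.2).natAbs ↔ Odd (i.2 + j.2) := by
    rw [← h1, Int.natAbs_odd, Int.natAbs_odd, Int.odd_sub, Int.odd_add]
  simp only [mulSC_basis, sinEl, map_smul, map_add, oddPart_basis, h1, h2]
  split_ifs <;> simp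

theorem graded_mulSS : Graded (mulSS k q) := graded_of_basis fun i j => by
  have h1 : Odd ((i.2 : ℤ) + j.2).natAbs ↔ Odd (i.2 + j.2) := by
    rw [Int.natAbs_odd]; exact_mod_cast Iff.rfl
  have h2 : Odd ((i.2 : ℤ) - j.2).natAbs ↔ Odd (i.2 + j.2) := by
    rw [← h1, Int.natAbs_odd, Int.natAbs_odd, Int.odd_sub, Int.odd_add]
  simp only [mulSS_basis, cosEl, map_smul, map_add, map_neg, oddPart_basis, h1, h2]
  split_ifs <;> simp

/-- `B` restricted to odd time frequencies. -/
def oddMul (B : Coefs k q →L[ℝ] Coefs k q →L[ℝ] Coefs k q) :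
    Coefs k q →L[ℝ] Coefs k q →L[ℝ] Coefs k q := B.bilinearComp oddPart oddPart

@[simp] theorem oddMul_apply (B : Coefs k q →L[ℝ] Coefs k q →L[ℝ] Coefs k q) (f g : Coefs k q) :
    oddMul B f g = B (oddPart f) (oddPart g) := rfl

/-- Odd plus odd is even. This is the source both of the nilpotency of the limiting quadratic map
and of the absence of quadratic terms in the critical equation. -/
theorem Graded.oddPart_oddMul {B : Coefs k q →L[ℝ] Coefs k q →L[ℝ] Coefs k q} (h : Graded B)
    (f g : Coefs k q) : oddPart (oddMul B f g) = 0 := by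
  simp [h (oddPart f) (oddPart g)]

/-- Odd time frequencies are multiplied by `A` and even ones by `A²`. -/
def scale (A : ℝ) (f : Coefs k q) : Coefs k q := A • oddPart f + A ^ 2 • (f - oddPart f)

theorem coef_scale (A : ℝ) (f : Coefs k q) (i : ℕ × ℕ) :
    coef i (scale A f) = (if Odd i.2 then A else A ^ 2) * coef i f := by
  simp only [scale, map_add, map_smul, map_sub, coef_oddPart, smul_eq_mul]
  split_ifs <;> ring

/-- Odd·odd carries A², the factor of its even image. Odd·even carries A³ = A·A² and lands in odd
frequencies; even·even carries A⁴ = A²·A² and lands in even ones. After removal of `scale A` only A²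
remains, so it can be treated as an unknown of either sign. -/
theorem Graded.scale_mul {B : Coefs k q →L[ℝ] Coefs k q →L[ℝ] Coefs k q} (h : Graded B)
    (A : ℝ) (f g : Coefs k q) :
    B (scale A f) (scale A g) = scale A (oddMul B f g + A ^ 2 • (B f g - oddMul B f g)) := by
  have h1 : oddPart (B (oddPart f) (oddPart g)) = 0 := h.oddPart_oddMul f g
  have h2 := h f g
  simp only [scale, map_add, map_smul, map_sub, oddMul_apply, h1, h2, add_apply,
    sub_apply, smul_apply]
  module

end Coefs

end BonaSmith

namespace BonaSmith

namespace Coefs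

variable {k q : ℕ}

open BoundedContinuousFunction

/-! ### Sums of double cosine and sine series -/

/-- Bounded continuous functions on the plane. -/
abbrev PlaneBCF : Type := BoundedContinuousFunction (ℝ × ℝ) ℝ

/-- `cos (a x) cos (b q t)`. -/
def cosFun (q : ℕ) (i : ℕ × ℕ) : PlaneBCF :=
  .ofNormedAddCommGroup (fun z => Real.cos (i.1 * z.1) * Real.cos (q * i.2 * z.2))
    (by fun_prop) 1 fun z => by
      rw [norm_mul]
      exact mul_le_one₀ (Real.abs_cos_le_one _) (norm_nonneg _) (Real.abs_cos_le_one _)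

/-- `sin (a x) sin (b q t)`. -/
def sinFun (q : ℕ) (i : ℕ × ℕ) : PlaneBCF :=
  .ofNormedAddCommGroup (fun z => Real.sin (i.1 * z.1) * Real.sin (q * i.2 * z.2))
    (by fun_prop) 1 fun z => by
      rw [norm_mul]
      exact mul_le_one₀ (Real.abs_sin_le_one _) (norm_nonneg _) (Real.abs_sin_le_one _)

theorem cosFun_apply (i : ℕ × ℕ) (z : ℝ × ℝ) :
    cosFun q i z = Real.cos (i.1 * z.1) * Real.cos (q * i.2 * z.2) := rfl

theorem sinFun_apply (i : ℕ × ℕ) (z : ℝ × ℝ) :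
    sinFun q i z = Real.sin (i.1 * z.1) * Real.sin (q * i.2 * z.2) := rfl

theorem norm_cosFun_le (i : ℕ × ℕ) : ‖cosFun q i‖ ≤ 1 * wt k q i := by
  rw [one_mul]
  exact (norm_ofNormedAddCommGroup_le _ zero_le_one _).trans (one_le_wt k q i)

theorem norm_sinFun_le (i : ℕ × ℕ) : ‖sinFun q i‖ ≤ 1 * wt k q i := by
  rw [one_mul]
  exact (norm_ofNormedAddCommGroup_le _ zero_le_one _).trans (one_le_wt k q i)

/-- The double cosine series with the given coefficients. -/
def cosSeries (k q : ℕ) : Coefs k q →L[ℝ] PlaneBCF := lift (cosFun q) ⟨1, norm_cosFun_le⟩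

/-- The double sine series with the given coefficients. -/
def sinSeries (k q : ℕ) : Coefs k q →L[ℝ] PlaneBCF := lift (sinFun q) ⟨1, norm_sinFun_le⟩

@[simp] theorem cosSeries_basis (i : ℕ × ℕ) : cosSeries k q (basis i) = cosFun q i :=
  lift_basis _ _ _

@[simp] theorem sinSeries_basis (i : ℕ × ℕ) : sinSeries k q (basis i) = sinFun q i :=
  lift_basis _ _ _

theorem abs_cosSeries_le (f : Coefs k q) (z : ℝ × ℝ) : |cosSeries k q f z| ≤ ‖f‖ := by
  have := norm_lift_apply_le (norm_cosFun_le (k := k) (q := q)) f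
  rw [one_mul] at this
  exact ((cosSeries k q f).norm_coe_le_norm z).trans this

theorem abs_sinSeries_le (f : Coefs k q) (z : ℝ × ℝ) : |sinSeries k q f z| ≤ ‖f‖ := by
  have := norm_lift_apply_le (norm_sinFun_le (k := k) (q := q)) f
  rw [one_mul] at this
  exact ((sinSeries k q f).norm_coe_le_norm z).trans this

theorem cos_natAbs_mul (a : ℤ) (x : ℝ) : Real.cos ((a.natAbs : ℝ) * x) = Real.cos (a * x) := by
  rcases Int.natAbs_eq a with h | h
  · conv_rhs => rw [h]
    simp
  · conv_rhs => rw [h]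
    simp

theorem sign_mul_sin_natAbs_mul (a : ℤ) (x : ℝ) :
    (a.sign : ℝ) * Real.sin ((a.natAbs : ℝ) * x) = Real.sin (a * x) := by
  rcases lt_trichotomy a 0 with h | h | h
  · have : ((a.natAbs : ℤ) : ℝ) = ((-a : ℤ) : ℝ) := by congr 1; omega
    rw [Int.cast_natCast] at this
    rw [Int.sign_eq_neg_one_of_neg h, this]
    simp
  · simp [h]
  · have : ((a.natAbs : ℤ) : ℝ) = (a : ℝ) := by congr 1; omega
    rw [Int.cast_natCast] at this
    rw [Int.sign_eq_one_of_pos h, this]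
    simp

theorem cosSeries_cosEl (a b : ℤ) (z : ℝ × ℝ) :
    cosSeries k q (cosEl k q a b) z = Real.cos (a * z.1) * Real.cos (b * (q * z.2)) := by
  rw [cosEl, cosSeries_basis, cosFun_apply, cos_natAbs_mul, mul_comm (q : ℝ), mul_assoc,
    cos_natAbs_mul]

theorem sinSeries_sinEl (a b : ℤ) (z : ℝ × ℝ) :
    sinSeries k q (sinEl k q a b) z = Real.sin (a * z.1) * Real.sin (b * (q * z.2)) := by
  rw [sinEl, map_smul, sinSeries_basis, BoundedContinuousFunction.smul_apply, sinFun_apply,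
    ← sign_mul_sin_natAbs_mul, ← sign_mul_sin_natAbs_mul]
  push_cast
  rw [smul_eq_mul, mul_comm (q : ℝ), mul_assoc (_ : ℝ) (q : ℝ)]
  ring

/-- Evaluation at a point. -/
def evalAt (z : ℝ × ℝ) : PlaneBCF →L[ℝ] ℝ := evalCLM ℝ z

@[simp] theorem evalAt_apply (z : ℝ × ℝ) (w : PlaneBCF) : evalAt z w = w z := rfl

/-- By continuity it is enough to take two modes, where this is the product-to-sum formula in x and
in t. -/
theorem sinSeries_mulSC (f g : Coefs k q) (z : ℝ × ℝ) :
    sinSeries k q (mulSC k q f g) z = sinSeries k q f z * cosSeries k q g z := by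
  have := ext_basis₂
    (S := (ContinuousLinearMap.compL ℝ _ _ _ ((evalAt z).comp (sinSeries k q))).comp (mulSC k q))
    (T := (ContinuousLinearMap.mul ℝ ℝ).bilinearComp ((evalAt z).comp (sinSeries k q))
      ((evalAt z).comp (cosSeries k q)))
    fun i j => by
      simp only [ContinuousLinearMap.comp_apply, ContinuousLinearMap.compL_apply, mulSC_basis,
        ContinuousLinearMap.bilinearComp_apply, map_smul, map_add, evalAt_apply, sinSeries_sinEl,
        sinSeries_basis, cosSeries_basis, ContinuousLinearMap.mul_apply', sinFun_apply,
        cosFun_apply]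
      push_cast
      simp only [add_mul, sub_mul, Real.sin_add, Real.sin_sub, smul_eq_mul, mul_comm (q : ℝ),
        mul_assoc]
      ring
  exact DFunLike.congr_fun (DFunLike.congr_fun this f) g

theorem cosSeries_mulSS (f g : Coefs k q) (z : ℝ × ℝ) :
    cosSeries k q (mulSS k q f g) z = sinSeries k q f z * sinSeries k q g z := by
  have := ext_basis₂
    (S := (ContinuousLinearMap.compL ℝ _ _ _ ((evalAt z).comp (cosSeries k q))).comp (mulSS k q))
    (T := (ContinuousLinearMap.mul ℝ ℝ).bilinearComp ((evalAt z).comp (sinSeries k q))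
      ((evalAt z).comp (sinSeries k q)))
    fun i j => by
      simp only [ContinuousLinearMap.comp_apply, ContinuousLinearMap.compL_apply, mulSS_basis,
        ContinuousLinearMap.bilinearComp_apply, map_smul, map_add, map_neg, evalAt_apply,
        cosSeries_cosEl, sinSeries_basis, ContinuousLinearMap.mul_apply', sinFun_apply]
      push_cast
      simp only [add_mul, sub_mul, Real.cos_add, Real.cos_sub, smul_eq_mul, mul_comm (q : ℝ),
        mul_assoc]
      ring
  exact DFunLike.congr_fun (DFunLike.congr_fun this f) g

/-- The function `(x, t) ↦ ∑ coef · cos (m x) cos (l q t)`. -/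
def cosSum (f : Coefs k q) : ℝ → ℝ → ℝ := fun x t => cosSeries k q f (x, t)

/-- The function `(x, t) ↦ ∑ coef · sin (m x) sin (l q t)`. -/
def sinSum (f : Coefs k q) : ℝ → ℝ → ℝ := fun x t => sinSeries k q f (x, t)

/-- A property of values which is linear and holds on the basis. -/
theorem series_eq_of_basis {T : Coefs k q →L[ℝ] PlaneBCF} {c : ℝ} {z z' : ℝ × ℝ}
    (h : ∀ i, T (basis i) z = c * T (basis i) z') (f : Coefs k q) : T f z = c * T f z' := by
  have := ext_basis (S := (evalAt z).comp T) (T := c • (evalAt z').comp T) fun i => by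
    simpa using h i
  simpa using DFunLike.congr_fun this f

theorem cos_nat_mul_add_two_pi (n : ℕ) (x : ℝ) :
    Real.cos (n * (x + 2 * Real.pi)) = Real.cos (n * x) := by
  rw [mul_add]; exact Real.cos_add_nat_mul_two_pi _ _

theorem sin_nat_mul_add_two_pi (n : ℕ) (x : ℝ) :
    Real.sin (n * (x + 2 * Real.pi)) = Real.sin (n * x) := by
  rw [mul_add]; exact Real.sin_add_nat_mul_two_pi _ _

theorem doublyPeriodic_cosSum (f : Coefs k q) : DoublyPeriodic (cosSum f) := fun x t => by
  constructor
  · have := series_eq_of_basis (T := cosSeries k q) (c := 1) (z := (x + 2 * Real.pi, t))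
      (z' := (x, t)) (fun i => by simp [cosFun_apply, cos_nat_mul_add_two_pi]) f
    rwa [one_mul] at this
  · have := series_eq_of_basis (T := cosSeries k q) (c := 1) (z := (x, t + 2 * Real.pi))
      (z' := (x, t)) (fun i => by
        have := cos_nat_mul_add_two_pi (q * i.2) t
        push_cast at this
        simp [cosFun_apply, this]) f
    rwa [one_mul] at this

theorem doublyPeriodic_sinSum (f : Coefs k q) : DoublyPeriodic (sinSum f) := fun x t => by
  constructor
  · have := series_eq_of_basis (T := sinSeries k q) (c := 1) (z := (x + 2 * Real.pi, t))
      (z' := (x, t)) (fun i => by simp [sinFun_apply, sin_nat_mul_add_two_pi]) f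
    rwa [one_mul] at this
  · have := series_eq_of_basis (T := sinSeries k q) (c := 1) (z := (x, t + 2 * Real.pi))
      (z' := (x, t)) (fun i => by
        have := sin_nat_mul_add_two_pi (q * i.2) t
        push_cast at this
        simp [sinFun_apply, this]) f
    rwa [one_mul] at this

theorem cosSum_neg (f : Coefs k q) (x t : ℝ) : cosSum f (-x) t = cosSum f x t := by
  have := series_eq_of_basis (T := cosSeries k q) (c := 1) (z := (-x, t))
      (z' := (x, t)) (fun i => by simp [cosFun_apply]) f
  rwa [one_mul] at this

theorem sinSum_neg (f : Coefs k q) (x t : ℝ) : sinSum f (-x) t = -sinSum f x t := by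
  have := series_eq_of_basis (T := sinSeries k q) (c := -1) (z := (-x, t))
      (z' := (x, t)) (fun i => by simp [sinFun_apply]) f
  rwa [neg_one_mul] at this

theorem continuous_cosSum (f : Coefs k q) : Continuous (Function.uncurry (cosSum f)) :=
  (cosSeries k q f).continuous

theorem continuous_sinSum (f : Coefs k q) : Continuous (Function.uncurry (sinSum f)) :=
  (sinSeries k q f).continuous

end Coefs

end BonaSmith

namespace BonaSmith

/-! ### Integrals over the period cell -/

section cell

variable {G : Type*} [NormedAddCommGroup G] [NormedSpace ℝ G]

theorem continuous_inner_integral {f : ℝ × ℝ → G} (hf : Continuous f) (a b : ℝ) :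
    Continuous fun x : ℝ => ∫ t in a..b, f (x, t) :=
  intervalIntegral.continuous_parametric_intervalIntegral_of_continuous'
    (f := fun x t => f (x, t)) (by simpa [Function.uncurry_def] using hf) a b

/-- Integration over the period cell against the continuous function `ψ`. -/
def cellInt (ψ : ℝ × ℝ → G) (hψ : Continuous ψ) : Coefs.PlaneBCF →L[ℝ] G :=
  LinearMap.mkContinuousOfExistsBound
    { toFun := fun w => ∫ x in (-Real.pi)..Real.pi, ∫ t in (-Real.pi)..Real.pi,
        w (x, t) • ψ (x, t)
      map_add' := fun w w' => by
        have h1 : Continuous fun z => w z • ψ z := w.continuous.smul hψ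
        have h2 : Continuous fun z => w' z • ψ z := w'.continuous.smul hψ
        rw [← intervalIntegral.integral_add
          ((continuous_inner_integral h1 _ _).intervalIntegrable _ _)
          ((continuous_inner_integral h2 _ _).intervalIntegrable _ _)]
        congr 1
        funext x
        have h3 : Continuous fun t => w (x, t) • ψ (x, t) :=
          h1.comp (by fun_prop : Continuous fun t : ℝ => (x, t))
        have h4 : Continuous fun t => w' (x, t) • ψ (x, t) :=
          h2.comp (by fun_prop : Continuous fun t : ℝ => (x, t))
        rw [← intervalIntegral.integral_add (h3.intervalIntegrable _ _)
          (h4.intervalIntegrable _ _)]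
        simp only [BoundedContinuousFunction.add_apply, add_smul]
      map_smul' := fun c w => by
        simp only [BoundedContinuousFunction.smul_apply, smul_assoc,
          intervalIntegral.integral_smul, RingHom.id_apply] }
    (by
      obtain ⟨M, hM⟩ := (isCompact_Icc (a := -Real.pi) (b := Real.pi)).prod
        (isCompact_Icc (a := -Real.pi) (b := Real.pi)) |>.exists_bound_of_continuousOn
        hψ.continuousOn
      refine ⟨M * (2 * Real.pi) * (2 * Real.pi), fun w => ?_⟩
      have hpi := Real.pi_pos
      have e : |Real.pi - -Real.pi| = 2 * Real.pi := by
        rw [abs_of_nonneg (by linarith)]; ring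
      have hx : ∀ x ∈ Set.uIoc (-Real.pi) Real.pi,
          ‖∫ t in (-Real.pi)..Real.pi, w (x, t) • ψ (x, t)‖ ≤ ‖w‖ * M * (2 * Real.pi) := by
        intro x hx
        rw [← e]
        refine intervalIntegral.norm_integral_le_of_norm_le_const fun t ht => ?_
        rw [Set.uIoc_of_le (by linarith)] at hx ht
        rw [norm_smul]
        exact mul_le_mul (w.norm_coe_le_norm _)
          (hM (x, t) ⟨Set.Ioc_subset_Icc_self hx, Set.Ioc_subset_Icc_self ht⟩) (norm_nonneg _)
          (norm_nonneg _)
      have := intervalIntegral.norm_integral_le_of_norm_le_const hx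
      rw [e] at this
      exact this.trans (le_of_eq (by ring)))

theorem cellInt_apply (ψ : ℝ × ℝ → G) (hψ : Continuous ψ) (w : Coefs.PlaneBCF) :
    cellInt ψ hψ w = ∫ x in (-Real.pi)..Real.pi, ∫ t in (-Real.pi)..Real.pi,
      w (x, t) • ψ (x, t) := rfl

end cell

/-! ### Fourier coefficients -/

theorem integral_exp_int (a : ℤ) :
    ∫ x in (-Real.pi)..Real.pi, Complex.exp (Complex.I * (a : ℂ) * (x : ℂ)) =
      if a = 0 then 2 * (Real.pi : ℂ) else 0 := by
  split_ifs with h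
  · simp only [h, Int.cast_zero, mul_zero, zero_mul, Complex.exp_zero,
      intervalIntegral.integral_const, sub_neg_eq_add, Complex.real_smul, mul_one]
    push_cast
    ring
  · have hc : Complex.I * (a : ℂ) ≠ 0 := mul_ne_zero Complex.I_ne_zero (by exact_mod_cast h)
    rw [integral_exp_mul_complex hc, div_eq_zero_iff]
    left
    rw [sub_eq_zero, Complex.exp_eq_exp_iff_exists_int]
    exact ⟨a, by push_cast; ring⟩

/-- The Fourier coefficient of `w` as a continuous linear functional. -/
def fourierFunctional (m n : ℤ) : Coefs.PlaneBCF →L[ℝ] ℂ :=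
  (1 / (4 * Real.pi ^ 2) : ℝ) • cellInt
    (fun z => Complex.exp (-(Complex.I * ((m : ℂ) * (z.1 : ℂ) + (n : ℂ) * (z.2 : ℂ)))))
    (by fun_prop)

theorem fourierFunctional_apply (m n : ℤ) (w : Coefs.PlaneBCF) :
    fourierFunctional m n w = fourierCoef (fun x t => w (x, t)) m n := by
  simp only [fourierFunctional, smul_apply, cellInt_apply, fourierCoef,
    Complex.real_smul]
  push_cast
  rfl

/-- `ψ x = (e^{ijx} + s e^{-ijx})` integrated against `e^{-imx}`. -/
theorem integral_two_exp (j m : ℤ) (s : ℂ) :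
    ∫ x in (-Real.pi)..Real.pi, (Complex.exp (Complex.I * (j : ℂ) * (x : ℂ))
      + s * Complex.exp (-(Complex.I * (j : ℂ) * (x : ℂ)))) *
        Complex.exp (-(Complex.I * (m : ℂ) * (x : ℂ))) =
      2 * (Real.pi : ℂ) * ((if m = j then 1 else 0) + s * if m = -j then 1 else 0) := by
  have h1 := integral_exp_int (j - m)
  have h2 := integral_exp_int (-j - m)
  have e : ∀ x : ℝ, (Complex.exp (Complex.I * (j : ℂ) * (x : ℂ))
      + s * Complex.exp (-(Complex.I * (j : ℂ) * (x : ℂ)))) *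
        Complex.exp (-(Complex.I * (m : ℂ) * (x : ℂ))) =
      Complex.exp (Complex.I * ((j - m : ℤ) : ℂ) * (x : ℂ)) +
        s * Complex.exp (Complex.I * ((-j - m : ℤ) : ℂ) * (x : ℂ)) := fun x => by
    rw [add_mul, mul_assoc s, ← Complex.exp_add, ← Complex.exp_add]
    push_cast
    ring_nf
  simp only [e]
  rw [intervalIntegral.integral_add (Continuous.intervalIntegrable (by fun_prop) _ _)
    (Continuous.intervalIntegrable (by fun_prop) _ _), intervalIntegral.integral_const_mul, h1, h2]
  have a1 : j - m = 0 ↔ m = j := by omega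
  have a2 : -j - m = 0 ↔ m = -j := by omega
  simp only [a1, a2]
  split_ifs <;> ring

/-- The Fourier coefficients of `cos (a x) cos (b t)` (`s = 1`) and `sin (a x) sin (b t)`
(`s = -1`). -/
def harmonicCoef (s : ℝ) (a b m n : ℤ) : ℂ :=
  (s / 4 : ℝ) * (((if m = a then 1 else 0) + s * if m = -a then 1 else 0) *
    ((if n = b then 1 else 0) + s * if n = -b then 1 else 0))

/-- The prefactor s/4 is 1/(2·2) for two cosines (s = 1) and 1/(2i)² for two sines (s = −1), so both
cases share one computation. -/
theorem fourierCoef_of_exp {w : ℝ → ℝ → ℝ} {s : ℝ} {a b : ℤ}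
    (hw : ∀ x t, (w x t : ℂ) = (s / 4 : ℝ) * ((Complex.exp (Complex.I * (a : ℂ) * (x : ℂ))
      + s * Complex.exp (-(Complex.I * (a : ℂ) * (x : ℂ)))) *
      (Complex.exp (Complex.I * (b : ℂ) * (t : ℂ))
      + s * Complex.exp (-(Complex.I * (b : ℂ) * (t : ℂ)))))) (m n : ℤ) :
    fourierCoef w m n = harmonicCoef s a b m n := by
  have e : ∀ x t : ℝ, (w x t : ℂ) *
      Complex.exp (-(Complex.I * ((m : ℂ) * (x : ℂ) + (n : ℂ) * (t : ℂ)))) =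
      ((s / 4 : ℝ) : ℂ) * ((Complex.exp (Complex.I * (a : ℂ) * (x : ℂ))
      + s * Complex.exp (-(Complex.I * (a : ℂ) * (x : ℂ)))) *
        Complex.exp (-(Complex.I * (m : ℂ) * (x : ℂ)))) *
      ((Complex.exp (Complex.I * (b : ℂ) * (t : ℂ))
      + s * Complex.exp (-(Complex.I * (b : ℂ) * (t : ℂ)))) *
        Complex.exp (-(Complex.I * (n : ℂ) * (t : ℂ)))) := fun x t => by
    rw [hw, mul_add Complex.I, neg_add, Complex.exp_add]
    simp only [mul_assoc]
    ring
  have hpi : (Real.pi : ℂ) ≠ 0 := by exact_mod_cast Real.pi_ne_zero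
  simp only [fourierCoef, e, intervalIntegral.integral_const_mul,
    intervalIntegral.integral_mul_const, integral_two_exp, harmonicCoef]
  field_simp
  ring

theorem fourierCoef_cosFun (q : ℕ) (i : ℕ × ℕ) (m n : ℤ) :
    fourierFunctional m n (Coefs.cosFun q i) = harmonicCoef 1 i.1 (q * i.2) m n := by
  rw [fourierFunctional_apply]
  refine fourierCoef_of_exp (fun x t => ?_) m n
  rw [Coefs.cosFun_apply]
  push_cast
  rw [Complex.cos, Complex.cos]
  ring_nf

theorem fourierCoef_sinFun (q : ℕ) (i : ℕ × ℕ) (m n : ℤ) :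
    fourierFunctional m n (Coefs.sinFun q i) = harmonicCoef (-1) i.1 (q * i.2) m n := by
  rw [fourierFunctional_apply]
  refine fourierCoef_of_exp (fun x t => ?_) m n
  rw [Coefs.sinFun_apply]
  push_cast
  rw [Complex.sin, Complex.sin]
  ring_nf
  simp only [Complex.I_sq]
  ring_nf

/-- The square root of the weight of `H^k`. -/
def sobWt (k : ℕ) (mn : ℤ × ℤ) : ℝ := Real.sqrt ((1 + (mn.1 : ℝ) ^ 2 + (mn.2 : ℝ) ^ 2) ^ k)

/-- The weighted Fourier coefficients of the basis functions, as a square summable family. -/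
def harmonicVec (k : ℕ) (s : ℝ) (a b : ℤ) : lp (fun _ : ℤ × ℤ => ℂ) 2 :=
  lp.single 2 (a, b) ((s / 4 * sobWt k (a, b) : ℝ) : ℂ)
    + lp.single 2 (a, -b) ((s / 4 * s * sobWt k (a, b) : ℝ) : ℂ)
    + lp.single 2 (-a, b) ((s / 4 * s * sobWt k (a, b) : ℝ) : ℂ)
    + lp.single 2 (-a, -b) ((s / 4 * s * s * sobWt k (a, b) : ℝ) : ℂ)

theorem sobWt_nonneg (k : ℕ) (mn : ℤ × ℤ) : 0 ≤ sobWt k mn := Real.sqrt_nonneg _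

theorem harmonicVec_apply (k : ℕ) (s : ℝ) (a b : ℤ) (mn : ℤ × ℤ) :
    harmonicVec k s a b mn = sobWt k mn * harmonicCoef s a b mn.1 mn.2 := by
  obtain ⟨m, n⟩ := mn
  have h : ∀ a' b' : ℤ, (a' = a ∨ a' = -a) → (b' = b ∨ b' = -b) → ∀ c : ℝ,
      (lp.single 2 (a', b') ((c * sobWt k (a, b) : ℝ) : ℂ) : lp (fun _ : ℤ × ℤ => ℂ) 2) (m, n) =
      sobWt k (m, n) * (c * ((if m = a' then 1 else 0) * if n = b' then 1 else 0)) := by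
    intro a' b' ha hb c
    rw [lp.single_apply, Pi.single_apply]
    have : sobWt k (a', b') = sobWt k (a, b) := by
      rcases ha with rfl | rfl <;> rcases hb with rfl | rfl <;> simp [sobWt]
    by_cases h1 : m = a' <;> by_cases h2 : n = b' <;> simp [h1, h2, this, mul_comm]
  simp only [harmonicVec, lp.coeFn_add, Pi.add_apply]
  rw [h a b (.inl rfl) (.inl rfl), h a (-b) (.inl rfl) (.inr rfl), h (-a) b (.inr rfl) (.inl rfl),
    h (-a) (-b) (.inr rfl) (.inr rfl), harmonicCoef]
  push_cast
  ring

theorem norm_harmonicVec_le (k q : ℕ) {s : ℝ} (hs : |s| = 1) (i : ℕ × ℕ) :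
    ‖harmonicVec k s i.1 (q * i.2)‖ ≤ 1 * wt k q i := by
  -- Since 1 + m² + n² ≤ (1 + m + n)² for m, n ≥ 0, the ℓ¹ weight dominates the square root of the
  -- Sobolev weight.
  have hw : sobWt k ((i.1 : ℤ), (q : ℤ) * i.2) ≤ wt k q i := by
    rw [sobWt, Real.sqrt_le_left (wt_pos k q i).le, wt, ← pow_mul, mul_comm k 2, pow_mul]
    apply pow_le_pow_left₀ (by positivity)
    have e1 : (0 : ℝ) ≤ (i.1 : ℝ) := by positivity
    have e2 : (0 : ℝ) ≤ (q : ℝ) * i.2 := by positivity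
    push_cast
    nlinarith [mul_nonneg e1 e2]
  have h0 := sobWt_nonneg k ((i.1 : ℤ), (q : ℤ) * i.2)
  have hn : ∀ (c : ℝ) (mn : ℤ × ℤ), |c| = 1 / 4 →
      ‖(lp.single 2 mn ((c * sobWt k ((i.1 : ℤ), (q : ℤ) * i.2) : ℝ) : ℂ) :
        lp (fun _ : ℤ × ℤ => ℂ) 2)‖ ≤ wt k q i / 4 := by
    intro c mn hc
    rw [lp.norm_single (by norm_num), Complex.norm_real, norm_mul, Real.norm_eq_abs, hc,
      Real.norm_of_nonneg h0]
    linarith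
  have h1 : |s / 4| = 1 / 4 := by rw [abs_div, hs]; norm_num
  have h2 : |s / 4 * s| = 1 / 4 := by rw [abs_mul, h1, hs, mul_one]
  have h3 : |s / 4 * s * s| = 1 / 4 := by rw [abs_mul, h2, hs, mul_one]
  have := hn _ ((i.1 : ℤ), (q : ℤ) * i.2) h1
  have := hn _ ((i.1 : ℤ), -((q : ℤ) * i.2)) h2
  have := hn _ (-(i.1 : ℤ), (q : ℤ) * i.2) h2
  have := hn _ (-(i.1 : ℤ), -((q : ℤ) * i.2)) h3
  rw [harmonicVec, one_mul]
  refine (norm_add_le _ _).trans ?_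
  refine (add_le_add_left (norm_add_le _ _) _).trans ?_
  refine (add_le_add_left (add_le_add_left (norm_add_le _ _) _) _).trans ?_
  linarith

theorem sobolevTerm_eq (k : ℕ) (w : ℝ → ℝ → ℝ) (mn : ℤ × ℤ) :
    sobolevTerm k w mn = ‖(sobWt k mn : ℂ) * fourierCoef w mn.1 mn.2‖ ^ 2 := by
  rw [norm_mul, mul_pow, Complex.norm_real, Real.norm_of_nonneg (sobWt_nonneg k mn), sobWt,
    Real.sq_sqrt (by positivity), sobolevTerm]

theorem memH_of_continuous {k : ℕ} {w : ℝ → ℝ → ℝ} (hc : Continuous (Function.uncurry w))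
    (hp : DoublyPeriodic w) (hs : Summable (sobolevTerm k w)) : MemH k w where
  periodic := hp
  measurable := hc.measurable
  sq_integrable := by
    apply ContinuousOn.integrableOn_compact (isCompact_Icc.prod isCompact_Icc)
    exact (hc.pow 2).continuousOn
  summable := hs

/-! ### Sobolev regularity of the sums of the series -/

namespace Coefs

variable {k q : ℕ}

/-- Sending each mode to its weighted Fourier coefficients is a map into ℓ²(ℤ²) of norm at most 1.
Its entries agree with the weighted Fourier coefficients of the sum because both depend continuously
on f and agree on modes. -/
theorem summable_and_sobolevNorm_le {S : Coefs k q →L[ℝ] PlaneBCF} {s : ℝ} (hs : |s| = 1)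
    (hS : ∀ i m n, fourierFunctional m n (S (basis i)) = harmonicCoef s i.1 (q * i.2) m n)
    (f : Coefs k q) : Summable (sobolevTerm k fun x t => S f (x, t)) ∧
      sobolevNorm k (fun x t => S f (x, t)) ≤ ‖f‖ := by
  let T : Coefs k q →L[ℝ] lp (fun _ : ℤ × ℤ => ℂ) 2 :=
    lift (fun i => harmonicVec k s i.1 (q * i.2)) ⟨1, norm_harmonicVec_le k q hs⟩
  have hT : ∀ mn : ℤ × ℤ, T f mn = sobWt k mn * fourierCoef (fun x t => S f (x, t)) mn.1 mn.2 := by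
    intro mn
    have := ext_basis (S := ((lp.evalCLM ℝ (fun _ : ℤ × ℤ => ℂ) 2 mn).comp T))
      (T := sobWt k mn • (fourierFunctional mn.1 mn.2).comp S) fun i => by
        simp only [ContinuousLinearMap.comp_apply, smul_apply, hS,
          Complex.real_smul]
        rw [← harmonicVec_apply]
        change T (basis i) mn = _
        simp only [T, lift_basis]
    have h := DFunLike.congr_fun this f
    simp only [ContinuousLinearMap.comp_apply, smul_apply,
          Complex.real_smul, fourierFunctional_apply] at h
    exact h
  have h2 := lp.hasSum_norm (E := fun _ : ℤ × ℤ => ℂ) (p := 2) (by norm_num) (T f)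
  have e : ∀ x : ℝ, x ^ (2 : ENNReal).toReal = x ^ 2 := fun x => by simp
  simp only [e, hT, ← sobolevTerm_eq] at h2
  refine ⟨h2.summable, ?_⟩
  rw [sobolevNorm, h2.tsum_eq, Real.sqrt_sq (norm_nonneg _)]
  have := norm_lift_apply_le (norm_harmonicVec_le k q hs) f
  rwa [one_mul] at this

theorem memH_cosSum (f : Coefs k q) : MemH k (cosSum f) :=
  memH_of_continuous (continuous_cosSum f) (doublyPeriodic_cosSum f)
    (summable_and_sobolevNorm_le (S := cosSeries k q) (s := 1) (by simp)
      (fun i m n => by rw [cosSeries_basis, fourierCoef_cosFun]) f).1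

theorem memH_sinSum (f : Coefs k q) : MemH k (sinSum f) :=
  memH_of_continuous (continuous_sinSum f) (doublyPeriodic_sinSum f)
    (summable_and_sobolevNorm_le (S := sinSeries k q) (s := -1) (by simp)
      (fun i m n => by rw [sinSeries_basis, fourierCoef_sinFun]) f).1

theorem sizeLE_cosSum {f : Coefs k q} {e : ℝ} (h : ‖f‖ ≤ e) : SizeLE k (cosSum f) e :=
  ⟨memH_cosSum f, (summable_and_sobolevNorm_le (S := cosSeries k q) (s := 1) (by simp)
      (fun i m n => by rw [cosSeries_basis, fourierCoef_cosFun]) f).2.trans h,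
    fun x t => (abs_cosSeries_le f (x, t)).trans h⟩

theorem sizeLE_sinSum {f : Coefs k q} {e : ℝ} (h : ‖f‖ ≤ e) : SizeLE k (sinSum f) e :=
  ⟨memH_sinSum f, (summable_and_sobolevNorm_le (S := sinSeries k q) (s := -1) (by simp)
      (fun i m n => by rw [sinSeries_basis, fourierCoef_sinFun]) f).2.trans h,
    fun x t => (abs_sinSeries_le f (x, t)).trans h⟩

/-- Modes with m > 0 have mean zero in x. The case n = 0 gives the vanishing average, the others the
time independence of the x-average. -/
theorem fourierCoef_cosSum_zero {f : Coefs k q} (hf : ∀ l, coef (0, l) f = 0) (n : ℤ) :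
    fourierCoef (cosSum f) 0 n = 0 := by
  have h := hasSum_coef_smul ((fourierFunctional 0 n).comp (cosSeries k q)) f
  have h0 : ∀ i, coef i f • ((fourierFunctional 0 n).comp (cosSeries k q)) (basis i) = 0 := by
    rintro ⟨m, l⟩
    rcases Nat.eq_zero_or_pos m with rfl | hm
    · rw [hf, zero_smul]
    · have : ¬(0 = (m : ℤ)) := by omega
      simp [fourierCoef_cosFun, harmonicCoef, this, hm.ne']
  simp only [h0] at h
  have h1 := hasSum_zero.unique h
  rw [ContinuousLinearMap.comp_apply, fourierFunctional_apply] at h1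
  exact h1.symm

end Coefs

theorem average_eq_fourierCoef (w : ℝ → ℝ → ℝ) : (average w : ℂ) = fourierCoef w 0 0 := by
  simp only [average, fourierCoef, Int.cast_zero, zero_mul, add_zero, mul_zero, neg_zero,
    Complex.exp_zero, mul_one, intervalIntegral.integral_ofReal]
  push_cast
  rfl

end BonaSmith

namespace BonaSmith

/-! ### Smooth doubly periodic test functions -/

/-- Smooth doubly periodic functions. -/
structure IsTest (φ : ℝ → ℝ → ℝ) : Prop where
  contDiff : ContDiff ℝ ∞ (Function.uncurry φ)
  periodic : DoublyPeriodic φ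

namespace IsTest

variable {φ : ℝ → ℝ → ℝ}

theorem hasDerivAt_x (h : IsTest φ) (x t : ℝ) :
    HasDerivAt (fun y => φ y t) (fderiv ℝ (Function.uncurry φ) (x, t) (1, 0)) x := by
  have h1 : HasFDerivAt (Function.uncurry φ) (fderiv ℝ (Function.uncurry φ) (x, t)) (x, t) :=
    (h.contDiff.differentiable (by simp) _).hasFDerivAt
  exact h1.comp_hasDerivAt x ((hasDerivAt_id x).prodMk (hasDerivAt_const x t))

theorem hasDerivAt_t (h : IsTest φ) (x t : ℝ) :
    HasDerivAt (fun r => φ x r) (fderiv ℝ (Function.uncurry φ) (x, t) (0, 1)) t := by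
  have h1 : HasFDerivAt (Function.uncurry φ) (fderiv ℝ (Function.uncurry φ) (x, t)) (x, t) :=
    (h.contDiff.differentiable (by simp) _).hasFDerivAt
  exact h1.comp_hasDerivAt t ((hasDerivAt_const t x).prodMk (hasDerivAt_id t))

theorem hasDerivAt_dx (h : IsTest φ) (x t : ℝ) : HasDerivAt (fun y => φ y t) (dx φ x t) x := by
  rw [dx, (h.hasDerivAt_x x t).deriv]
  exact h.hasDerivAt_x x t

theorem hasDerivAt_dt (h : IsTest φ) (x t : ℝ) : HasDerivAt (fun r => φ x r) (dt φ x t) t := by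
  rw [dt, (h.hasDerivAt_t x t).deriv]
  exact h.hasDerivAt_t x t

theorem dx (h : IsTest φ) : IsTest (dx φ) where
  contDiff := by
    have e : Function.uncurry (BonaSmith.dx φ) =
        fun z => fderiv ℝ (Function.uncurry φ) z (1, 0) := by
      funext z
      exact (h.hasDerivAt_x z.1 z.2).deriv
    rw [e]
    exact (h.contDiff.fderiv_right (m := ∞) (by simp)).clm_apply contDiff_const
  periodic x t := by
    constructor
    · have e := deriv_comp_add_const (f := fun y => φ y t) (2 * Real.pi) x
      simp only [(h.periodic _ t).1] at e
      exact e.symm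
    · simp only [BonaSmith.dx, (h.periodic _ t).2]

theorem dt (h : IsTest φ) : IsTest (dt φ) where
  contDiff := by
    have e : Function.uncurry (BonaSmith.dt φ) =
        fun z => fderiv ℝ (Function.uncurry φ) z (0, 1) := by
      funext z
      exact (h.hasDerivAt_t z.1 z.2).deriv
    rw [e]
    exact (h.contDiff.fderiv_right (m := ∞) (by simp)).clm_apply contDiff_const
  periodic x t := by
    constructor
    · simp only [BonaSmith.dt, (h.periodic x _).1]
    · have e := deriv_comp_add_const (f := fun r => φ x r) (2 * Real.pi) t
      simp only [(h.periodic x _).2] at e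
      exact e.symm

theorem continuous (h : IsTest φ) : Continuous (Function.uncurry φ) := h.contDiff.continuous

theorem continuous' (h : IsTest φ) : Continuous fun z : ℝ × ℝ => φ z.1 z.2 := h.continuous

theorem periodic_pi (h : IsTest φ) (x t : ℝ) :
    φ Real.pi t = φ (-Real.pi) t ∧ φ x Real.pi = φ x (-Real.pi) := by
  have h1 := (h.periodic (-Real.pi) t).1
  have h2 := (h.periodic x (-Real.pi)).2
  rw [show -Real.pi + 2 * Real.pi = Real.pi by ring] at h1 h2
  exact ⟨h1, h2⟩

theorem shift (h : IsTest φ) (τ : ℝ) : IsTest fun x t => φ x (t + τ) where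
  contDiff := h.contDiff.comp (f := fun z : ℝ × ℝ => (z.1, z.2 + τ)) (by fun_prop)
  periodic x t := by
    refine ⟨(h.periodic x (t + τ)).1, ?_⟩
    have e := (h.periodic x (t + τ)).2
    rw [add_right_comm] at e
    exact e

end IsTest

theorem dt_shift (φ : ℝ → ℝ → ℝ) (τ : ℝ) :
    dt (fun x t => φ x (t + τ)) = fun x t => dt φ x (t + τ) := by
  funext x t
  exact deriv_comp_add_const (f := fun r => φ x r) τ t

theorem dx_shift (φ : ℝ → ℝ → ℝ) (τ : ℝ) :
    dx (fun x t => φ x (t + τ)) = fun x t => dx φ x (t + τ) := rfl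

/-- Integration by parts over a period. -/
theorem integral_mul_deriv_period {f f' g g' : ℝ → ℝ} (hf : ∀ x, HasDerivAt f (f' x) x)
    (hf' : Continuous f') (hg : ∀ x, HasDerivAt g (g' x) x) (hg' : Continuous g')
    (pf : f Real.pi = f (-Real.pi)) (pg : g Real.pi = g (-Real.pi)) :
    ∫ x in (-Real.pi)..Real.pi, f x * g' x = -∫ x in (-Real.pi)..Real.pi, f' x * g x := by
  rw [intervalIntegral.integral_mul_deriv_eq_deriv_mul (fun x _ => hf x) (fun x _ => hg x)
    (hf'.intervalIntegrable _ _) (hg'.intervalIntegrable _ _), pf, pg]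
  ring

theorem integral_integral_swap_of_continuous {f : ℝ → ℝ → ℝ}
    (hf : Continuous (Function.uncurry f)) (a b c d : ℝ) :
    ∫ x in a..b, ∫ t in c..d, f x t = ∫ t in c..d, ∫ x in a..b, f x t := by
  apply MeasureTheory.intervalIntegral_intervalIntegral_swap
  have := (hf.continuousOn (s := Set.uIcc a b ×ˢ Set.uIcc c d)).integrableOn_compact
    (μ := (MeasureTheory.volume : MeasureTheory.Measure (ℝ × ℝ)))
    (isCompact_uIcc.prod isCompact_uIcc)
  exact this.mono_set (Set.prod_mono Set.uIoc_subset_uIcc Set.uIoc_subset_uIcc)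

theorem ibp_dt {φ : ℝ → ℝ → ℝ} (h : IsTest φ) {f g g' : ℝ → ℝ}
    (hg : ∀ t, HasDerivAt g (g' t) t) (hg' : Continuous g') (pg : g Real.pi = g (-Real.pi)) :
    ∫ x in (-Real.pi)..Real.pi, ∫ t in (-Real.pi)..Real.pi, f x * g t * dt φ x t =
      -∫ x in (-Real.pi)..Real.pi, ∫ t in (-Real.pi)..Real.pi, f x * g' t * φ x t := by
  rw [← intervalIntegral.integral_neg]
  congr 1
  funext x
  simp only [mul_assoc, intervalIntegral.integral_const_mul]
  rw [integral_mul_deriv_period hg hg' (fun t => h.hasDerivAt_dt x t)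
    (h.dt.continuous.comp (by fun_prop : Continuous fun t : ℝ => (x, t))) pg
    (h.periodic_pi x 0).2]
  ring

theorem ibp_dx {φ : ℝ → ℝ → ℝ} (h : IsTest φ) {f f' g : ℝ → ℝ}
    (hf : ∀ x, HasDerivAt f (f' x) x) (hf' : Continuous f') (hg : Continuous g)
    (pf : f Real.pi = f (-Real.pi)) :
    ∫ x in (-Real.pi)..Real.pi, ∫ t in (-Real.pi)..Real.pi, f x * g t * dx φ x t =
      -∫ x in (-Real.pi)..Real.pi, ∫ t in (-Real.pi)..Real.pi, f' x * g t * φ x t := by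
  have cf : Continuous f := continuous_iff_continuousAt.2 fun x => (hf x).continuousAt
  have c1 := h.continuous'
  have c2 := h.dx.continuous'
  -- The order of integration is exchanged so that the integration by parts takes place in the inner
  -- variable x.
  rw [integral_integral_swap_of_continuous (f := fun x t => f x * g t * dx φ x t)
    (by simp only [Function.uncurry_def]; fun_prop),
    integral_integral_swap_of_continuous (f := fun x t => f' x * g t * φ x t)
    (by simp only [Function.uncurry_def]; fun_prop), ← intervalIntegral.integral_neg]
  congr 1
  funext t
  simp only [fun a b : ℝ => mul_right_comm a (g t) b, intervalIntegral.integral_mul_const]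
  rw [integral_mul_deriv_period hf hf' (fun x => h.hasDerivAt_dx x t)
    (h.dx.continuous.comp (by fun_prop : Continuous fun x : ℝ => (x, t))) pf
    (h.periodic_pi 0 t).1]
  ring

/-! ### Time shifts -/

theorem cell_integral_shift {G : Type*} [NormedAddCommGroup G] [NormedSpace ℝ G]
    {F : ℝ → ℝ → G} (hF : ∀ x, Function.Periodic (F x) (2 * Real.pi)) (τ : ℝ) :
    ∫ x in (-Real.pi)..Real.pi, ∫ t in (-Real.pi)..Real.pi, F x (t - τ) =
      ∫ x in (-Real.pi)..Real.pi, ∫ t in (-Real.pi)..Real.pi, F x t := by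
  congr 1
  funext x
  rw [intervalIntegral.integral_comp_sub_right]
  have := (hF x).intervalIntegral_add_eq (-Real.pi - τ) (-Real.pi)
  rw [show -Real.pi - τ + 2 * Real.pi = Real.pi - τ by ring,
    show -Real.pi + 2 * Real.pi = Real.pi by ring] at this
  exact this

theorem doublyPeriodic_shift {w : ℝ → ℝ → ℝ} (h : DoublyPeriodic w) (τ : ℝ) :
    DoublyPeriodic fun x t => w x (t - τ) := fun x t => by
  refine ⟨(h x (t - τ)).1, ?_⟩
  have e := (h x (t - τ)).2
  rw [sub_add_eq_add_sub] at e
  exact e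

theorem fourierCoef_shift {w : ℝ → ℝ → ℝ} (h : DoublyPeriodic w) (τ : ℝ) (m n : ℤ) :
    fourierCoef (fun x t => w x (t - τ)) m n =
      Complex.exp (-(Complex.I * (n * τ : ℝ))) * fourierCoef w m n := by
  have e : ∀ x t : ℝ, (w x (t - τ) : ℂ) *
      Complex.exp (-(Complex.I * ((m : ℂ) * (x : ℂ) + (n : ℂ) * (t : ℂ)))) =
      Complex.exp (-(Complex.I * (n * τ : ℝ))) * ((w x (t - τ) : ℂ) *
        Complex.exp (-(Complex.I * ((m : ℂ) * (x : ℂ) + (n : ℂ) * ((t - τ : ℝ) : ℂ))))) := by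
    intro x t
    rw [mul_left_comm, ← Complex.exp_add]
    push_cast
    ring_nf
  simp only [fourierCoef, e, intervalIntegral.integral_const_mul]
  rw [cell_integral_shift (F := fun x t => (w x t : ℂ) *
        Complex.exp (-(Complex.I * ((m : ℂ) * (x : ℂ) + (n : ℂ) * (t : ℂ)))))]
  · ring
  · intro x t
    simp only [(h x t).2]
    congr 1
    rw [Complex.exp_eq_exp_iff_exists_int]
    exact ⟨-n, by push_cast; ring⟩

theorem sobolevTerm_shift {w : ℝ → ℝ → ℝ} (h : DoublyPeriodic w) (τ : ℝ) (k : ℕ) :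
    sobolevTerm k (fun x t => w x (t - τ)) = sobolevTerm k w := by
  funext mn
  rw [sobolevTerm, sobolevTerm, fourierCoef_shift h, norm_mul, mul_comm Complex.I, ← neg_mul,
    ← Complex.ofReal_neg, Complex.norm_exp_ofReal_mul_I, one_mul]

theorem memH_shift {k : ℕ} {w : ℝ → ℝ → ℝ} (h : MemH k w) (hc : Continuous (Function.uncurry w))
    (τ : ℝ) : MemH k fun x t => w x (t - τ) := by
  refine memH_of_continuous ?_ (doublyPeriodic_shift h.periodic τ) ?_
  · exact hc.comp (by fun_prop : Continuous fun z : ℝ × ℝ => (z.1, z.2 - τ))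
  · rw [sobolevTerm_shift h.periodic]
    exact h.summable

/-- The shift is moved to the test function in the opposite direction; integrals over a period do
not see it. -/
theorem isSolution_shift {α β γ : ℝ} {η u : ℝ → ℝ → ℝ} (h : IsSolution α β γ η u)
    (hη : DoublyPeriodic η) (hu : DoublyPeriodic u) (τ : ℝ) :
    IsSolution α β γ (fun x t => η x (t - τ)) fun x t => u x (t - τ) := by
  constructor
  · intro φ h1 h2
    have hφ : IsTest φ := ⟨h1, h2⟩
    have hs := hφ.shift τ
    obtain ⟨ψ, hψ⟩ : ∃ ψ : ℝ → ℝ → ℝ, ψ = fun x t => φ x (t + τ) := ⟨_, rfl⟩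
    rw [← hψ] at hs
    have key := cell_integral_shift (F := fun x t => η x t * dt ψ x t + β * u x t * dx ψ x t
        - α * η x t * dt (dx (dx ψ)) x t + β * (u x t * η x t) * dx ψ x t) (fun x t => by
      simp only [(hη x _).2, (hu x _).2, (hs.dx.periodic x _).2, (hs.dt.periodic x _).2,
        (hs.dx.dx.dt.periodic x _).2]) τ
    rw [h.first _ hs.contDiff hs.periodic] at key
    simpa only [hψ, dx_shift, dt_shift, sub_add_cancel] using key
  · intro φ h1 h2
    have hφ : IsTest φ := ⟨h1, h2⟩
    have hs := hφ.shift τ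
    obtain ⟨ψ, hψ⟩ : ∃ ψ : ℝ → ℝ → ℝ, ψ = fun x t => φ x (t + τ) := ⟨_, rfl⟩
    rw [← hψ] at hs
    have key := cell_integral_shift (F := fun x t => u x t * dt ψ x t + β * η x t * dx ψ x t
        - γ * α * β * η x t * dx (dx (dx ψ)) x t - α * u x t * dt (dx (dx ψ)) x t
        + β * (u x t ^ 2 / 2) * dx ψ x t) (fun x t => by
      simp only [(hη x _).2, (hu x _).2, (hs.dx.periodic x _).2, (hs.dt.periodic x _).2,
        (hs.dx.dx.dt.periodic x _).2,
        (hs.dx.dx.dx.periodic x _).2]) τ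
    rw [h.second _ hs.contDiff hs.periodic] at key
    simpa only [hψ, dx_shift, dt_shift, sub_add_cancel] using key

theorem isStandingWave_shift {k : ℕ} {α β γ B : ℝ} {η u : ℝ → ℝ → ℝ}
    (h : IsStandingWave k α β γ B η u) (τ : ℝ) :
    IsStandingWave k α β γ B (fun x t => η x (t - τ)) fun x t => u x (t - τ) where
  eta_mem := by
    refine ⟨memH_shift h.eta_mem.1 h.eta_continuous τ, fun x t => h.eta_mem.2.1 x _, ?_⟩
    intro n hn
    rw [fourierCoef_shift h.eta_mem.1.periodic, h.eta_mem.2.2 n hn, mul_zero]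
  u_mem := ⟨memH_shift h.u_mem.1 h.u_continuous τ, fun x t => h.u_mem.2 x _⟩
  eta_continuous :=
    h.eta_continuous.comp (by fun_prop : Continuous fun z : ℝ × ℝ => (z.1, z.2 - τ))
  u_continuous :=
    h.u_continuous.comp (by fun_prop : Continuous fun z : ℝ × ℝ => (z.1, z.2 - τ))
  solution := isSolution_shift h.solution h.eta_mem.1.periodic h.u_mem.1.periodic τ
  average_eq := by
    rw [← h.average_eq]
    have e := fourierCoef_shift h.eta_mem.1.periodic τ 0 0
    rw [← average_eq_fourierCoef, ← average_eq_fourierCoef] at e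
    simp only [Int.cast_zero, zero_mul, Complex.ofReal_zero, mul_zero, neg_zero,
      Complex.exp_zero, one_mul] at e
    exact_mod_cast e

end BonaSmith

namespace BonaSmith

/-! ### Weak solutions from coefficients -/

theorem cell_add {F H : ℝ × ℝ → ℝ} (hF : Continuous F) (hH : Continuous H) :
    ∫ x in (-Real.pi)..Real.pi, ∫ t in (-Real.pi)..Real.pi, (F (x, t) + H (x, t)) =
      (∫ x in (-Real.pi)..Real.pi, ∫ t in (-Real.pi)..Real.pi, F (x, t)) +
      ∫ x in (-Real.pi)..Real.pi, ∫ t in (-Real.pi)..Real.pi, H (x, t) := by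
  rw [← intervalIntegral.integral_add
    ((continuous_inner_integral hF _ _).intervalIntegrable _ _)
    ((continuous_inner_integral hH _ _).intervalIntegrable _ _)]
  congr 1
  funext x
  have h3 : Continuous fun t => F (x, t) := hF.comp (by fun_prop : Continuous fun t : ℝ => (x, t))
  have h4 : Continuous fun t => H (x, t) := hH.comp (by fun_prop : Continuous fun t : ℝ => (x, t))
  rw [← intervalIntegral.integral_add (h3.intervalIntegrable _ _) (h4.intervalIntegrable _ _)]

/-- The pairing of a bounded continuous function with a test function. -/
def pairing (φ : ℝ → ℝ → ℝ) (h : IsTest φ) : Coefs.PlaneBCF →L[ℝ] ℝ :=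
  cellInt (fun z => φ z.1 z.2) h.continuous'

theorem pairing_apply {φ : ℝ → ℝ → ℝ} (h : IsTest φ) (w : Coefs.PlaneBCF) :
    pairing φ h w =
      ∫ x in (-Real.pi)..Real.pi, ∫ t in (-Real.pi)..Real.pi, w (x, t) * φ x t := rfl

theorem hasDerivAt_cos_mul (a x : ℝ) :
    HasDerivAt (fun y => Real.cos (a * y)) (-a * Real.sin (a * x)) x := by
  have := ((hasDerivAt_id x).const_mul a).cos
  simp only [id, mul_one] at this
  convert this using 1
  ring

theorem hasDerivAt_sin_mul (a x : ℝ) :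
    HasDerivAt (fun y => Real.sin (a * y)) (a * Real.cos (a * x)) x := by
  have := ((hasDerivAt_id x).const_mul a).sin
  simp only [id, mul_one] at this
  convert this using 1
  ring

theorem cos_mul_pi (a : ℝ) : Real.cos (a * Real.pi) = Real.cos (a * -Real.pi) := by simp

theorem sin_nat_mul_pi' (n : ℕ) : Real.sin (n * Real.pi) = Real.sin (n * -Real.pi) := by
  rw [mul_neg, Real.sin_neg, Real.sin_nat_mul_pi, neg_zero]

section modes

variable {φ : ℝ → ℝ → ℝ}

/-- The integral of `φ` against `cos (m x) sin (l q t)`. -/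
def cosSinInt (q : ℕ) (i : ℕ × ℕ) (φ : ℝ → ℝ → ℝ) : ℝ :=
  ∫ x in (-Real.pi)..Real.pi, ∫ t in (-Real.pi)..Real.pi,
    Real.cos (i.1 * x) * Real.sin (q * i.2 * t) * φ x t

/-- The integral of `φ` against `sin (m x) cos (l q t)`. -/
def sinCosInt (q : ℕ) (i : ℕ × ℕ) (φ : ℝ → ℝ → ℝ) : ℝ :=
  ∫ x in (-Real.pi)..Real.pi, ∫ t in (-Real.pi)..Real.pi,
    Real.sin (i.1 * x) * Real.cos (q * i.2 * t) * φ x t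

theorem pull_const (c : ℝ) (F : ℝ → ℝ → ℝ) :
    ∫ x in (-Real.pi)..Real.pi, ∫ t in (-Real.pi)..Real.pi, c * F x t =
      c * ∫ x in (-Real.pi)..Real.pi, ∫ t in (-Real.pi)..Real.pi, F x t := by
  simp only [intervalIntegral.integral_const_mul]

theorem cell_congr {F H : ℝ → ℝ → ℝ} (h : ∀ x t, F x t = H x t) :
    ∫ x in (-Real.pi)..Real.pi, ∫ t in (-Real.pi)..Real.pi, F x t =
      ∫ x in (-Real.pi)..Real.pi, ∫ t in (-Real.pi)..Real.pi, H x t := by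
  simp only [h]

theorem sin_mul_pi_eq (q : ℕ) (i : ℕ × ℕ) :
    Real.sin (q * i.2 * Real.pi) = Real.sin (q * i.2 * -Real.pi) := by
  exact_mod_cast sin_nat_mul_pi' (q * i.2)

theorem pairing_dt_cosFun (h : IsTest φ) (q : ℕ) (i : ℕ × ℕ) :
    pairing _ h.dt (Coefs.cosFun q i) = (q * i.2) * cosSinInt q i φ := by
  rw [pairing_apply]
  simp only [Coefs.cosFun_apply]
  rw [ibp_dt h (fun t => hasDerivAt_cos_mul (q * i.2) t) (by fun_prop) (cos_mul_pi _), cosSinInt,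
    ← pull_const, ← intervalIntegral.integral_neg]
  simp only [← intervalIntegral.integral_neg]
  exact cell_congr fun x t => by ring

theorem pairing_dt_sinFun (h : IsTest φ) (q : ℕ) (i : ℕ × ℕ) :
    pairing _ h.dt (Coefs.sinFun q i) = -(q * i.2) * sinCosInt q i φ := by
  rw [pairing_apply]
  simp only [Coefs.sinFun_apply]
  rw [ibp_dt h (fun t => hasDerivAt_sin_mul (q * i.2) t) (by fun_prop) (sin_mul_pi_eq q i),
    sinCosInt, ← pull_const, ← intervalIntegral.integral_neg]
  simp only [← intervalIntegral.integral_neg]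
  exact cell_congr fun x t => by ring

theorem pairing_dx_cosFun (h : IsTest φ) (q : ℕ) (i : ℕ × ℕ) :
    pairing _ h.dx (Coefs.cosFun q i) = i.1 * sinCosInt q i φ := by
  rw [pairing_apply]
  simp only [Coefs.cosFun_apply]
  rw [ibp_dx h (fun x => hasDerivAt_cos_mul i.1 x) (by fun_prop) (by fun_prop) (cos_mul_pi _),
    sinCosInt, ← pull_const, ← intervalIntegral.integral_neg]
  simp only [← intervalIntegral.integral_neg]
  exact cell_congr fun x t => by ring

theorem pairing_dx_sinFun (h : IsTest φ) (q : ℕ) (i : ℕ × ℕ) :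
    pairing _ h.dx (Coefs.sinFun q i) = -i.1 * cosSinInt q i φ := by
  rw [pairing_apply]
  simp only [Coefs.sinFun_apply]
  rw [ibp_dx h (fun x => hasDerivAt_sin_mul i.1 x) (by fun_prop) (by fun_prop)
    (sin_nat_mul_pi' i.1), cosSinInt, ← pull_const, ← intervalIntegral.integral_neg]
  simp only [← intervalIntegral.integral_neg]
  exact cell_congr fun x t => by ring

theorem cosSinInt_dx_dx (h : IsTest φ) (q : ℕ) (i : ℕ × ℕ) :
    cosSinInt q i (dx (dx φ)) = -(i.1 : ℝ) ^ 2 * cosSinInt q i φ := by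
  rw [cosSinInt, ibp_dx h.dx (fun x => hasDerivAt_cos_mul i.1 x) (by fun_prop) (by fun_prop)
    (cos_mul_pi _)]
  have e : ∀ x t : ℝ, -(i.1 : ℝ) * Real.sin (i.1 * x) * Real.sin (q * i.2 * t) * dx φ x t =
      -(i.1 : ℝ) * (Real.sin (i.1 * x) * Real.sin (q * i.2 * t) * dx φ x t) := fun x t => by ring
  simp only [e]
  rw [pull_const]
  have := pairing_dx_sinFun h q i
  rw [pairing_apply] at this
  simp only [Coefs.sinFun_apply] at this
  rw [this]
  ring

theorem sinCosInt_dx_dx (h : IsTest φ) (q : ℕ) (i : ℕ × ℕ) :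
    sinCosInt q i (dx (dx φ)) = -(i.1 : ℝ) ^ 2 * sinCosInt q i φ := by
  rw [sinCosInt, ibp_dx h.dx (fun x => hasDerivAt_sin_mul i.1 x) (by fun_prop) (by fun_prop)
    (sin_nat_mul_pi' i.1)]
  have e : ∀ x t : ℝ, (i.1 : ℝ) * Real.cos (i.1 * x) * Real.cos (q * i.2 * t) * dx φ x t =
      (i.1 : ℝ) * (Real.cos (i.1 * x) * Real.cos (q * i.2 * t) * dx φ x t) := fun x t => by ring
  simp only [e]
  rw [pull_const]
  have := pairing_dx_cosFun h q i
  rw [pairing_apply] at this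
  simp only [Coefs.cosFun_apply] at this
  rw [this]
  ring

end modes

theorem dt_dx_comm_pairing_cos {φ : ℝ → ℝ → ℝ} (h : IsTest φ) (q : ℕ) (i : ℕ × ℕ) :
    pairing _ h.dx.dx.dt (Coefs.cosFun q i) =
      -(i.1 : ℝ) ^ 2 * (q * i.2) * cosSinInt q i φ := by
  rw [pairing_dt_cosFun h.dx.dx, cosSinInt_dx_dx h]
  ring

theorem dt_dx_comm_pairing_sin {φ : ℝ → ℝ → ℝ} (h : IsTest φ) (q : ℕ) (i : ℕ × ℕ) :
    pairing _ h.dx.dx.dt (Coefs.sinFun q i) =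
      (i.1 : ℝ) ^ 2 * (q * i.2) * sinCosInt q i φ := by
  rw [pairing_dt_sinFun h.dx.dx, sinCosInt_dx_dx h]
  ring

theorem pairing_dxxx_cosFun {φ : ℝ → ℝ → ℝ} (h : IsTest φ) (q : ℕ) (i : ℕ × ℕ) :
    pairing _ h.dx.dx.dx (Coefs.cosFun q i) = -(i.1 : ℝ) ^ 3 * sinCosInt q i φ := by
  rw [pairing_dx_cosFun h.dx.dx, sinCosInt_dx_dx h]
  ring

/-- The equations satisfied by the coefficients `a` of `η` and `b` of `u`. -/
structure ModeEquations {k q : ℕ} (α β γ : ℝ) (a b : Coefs k q) : Prop where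
  first : ∀ i : ℕ × ℕ, -(q * i.2) * (1 + α * (i.1 : ℝ) ^ 2) * Coefs.coef i a
    + β * i.1 * Coefs.coef i b + β * i.1 * Coefs.coef i (Coefs.mulSC k q b a) = 0
  second : ∀ i : ℕ × ℕ, (q * i.2) * (1 + α * (i.1 : ℝ) ^ 2) * Coefs.coef i b
    - β * i.1 * (1 + γ * α * (i.1 : ℝ) ^ 2) * Coefs.coef i a
    - β * i.1 * Coefs.coef i (Coefs.mulSS k q b b) / 2 = 0

namespace Coefs

variable {k q : ℕ}

/-- Allows a weak equation, which is a sum of continuous functionals of the coefficients, to be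
verified one mode at a time. -/
theorem sum_functionals_eq_zero {T₁ T₂ T₃ : Coefs k q →L[ℝ] ℝ} {f g h : Coefs k q}
    (H : ∀ i, coef i f * T₁ (basis i) + coef i g * T₂ (basis i) + coef i h * T₃ (basis i) = 0) :
    T₁ f + T₂ g + T₃ h = 0 := by
  have h1 := ((hasSum_coef_smul T₁ f).add (hasSum_coef_smul T₂ g)).add (hasSum_coef_smul T₃ h)
  simp only [smul_eq_mul, H] at h1
  exact (hasSum_zero.unique h1).symm

/-- On a single mode, integration by parts turns every term of the first equation into a multiple of
the integral of φ against cos(mx) sin(lqt), and every term of the second into a multiple of the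
integral against sin(mx) cos(lqt). The factors add up to the mode equations. -/
theorem isSolution_of_modeEquations {α β γ : ℝ} {a b : Coefs k q}
    (H : ModeEquations α β γ a b) : IsSolution α β γ (cosSum a) (sinSum b) := by
  constructor
  · intro φ h1 h2
    have h : IsTest φ := ⟨h1, h2⟩
    have key := sum_functionals_eq_zero
      (T₁ := (pairing _ h.dt - α • pairing _ h.dx.dx.dt).comp (cosSeries k q))
      (T₂ := (β • pairing _ h.dx).comp (sinSeries k q))
      (T₃ := (β • pairing _ h.dx).comp (sinSeries k q)) (f := a) (g := b) (h := mulSC k q b a)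
      fun i => by
        simp only [ContinuousLinearMap.comp_apply, sub_apply, smul_apply, cosSeries_basis,
          sinSeries_basis, smul_eq_mul, pairing_dt_cosFun h, dt_dx_comm_pairing_cos h,
          pairing_dx_sinFun h]
        linear_combination (-cosSinInt q i φ) * H.first i
    rw [← key]
    simp only [ContinuousLinearMap.comp_apply, sub_apply, smul_apply, smul_eq_mul, pairing_apply]
    rw [sub_eq_add_neg, ← neg_mul]
    simp only [← pull_const]
    have c0 := h.continuous'
    have c1 := h.dx.continuous'
    have c2 := h.dt.continuous'
    have c3 := h.dx.dx.dt.continuous'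
    rw [← cell_add (F := fun z => cosSeries k q a z * dt φ z.1 z.2)
        (H := fun z => -α * (cosSeries k q a z * dt (dx (dx φ)) z.1 z.2))
        (by fun_prop) (by fun_prop),
      ← cell_add (F := fun z => cosSeries k q a z * dt φ z.1 z.2
          + -α * (cosSeries k q a z * dt (dx (dx φ)) z.1 z.2))
        (H := fun z => β * (sinSeries k q b z * dx φ z.1 z.2)) (by fun_prop) (by fun_prop),
      ← cell_add (F := fun z => cosSeries k q a z * dt φ z.1 z.2
          + -α * (cosSeries k q a z * dt (dx (dx φ)) z.1 z.2)
          + β * (sinSeries k q b z * dx φ z.1 z.2))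
        (H := fun z => β * (sinSeries k q (mulSC k q b a) z * dx φ z.1 z.2))
        (by fun_prop) (by fun_prop)]
    simp only [sinSeries_mulSC, cosSum, sinSum]
    exact cell_congr fun x t => by ring
  · intro φ h1 h2
    have h : IsTest φ := ⟨h1, h2⟩
    have key := sum_functionals_eq_zero
      (T₁ := (β • pairing _ h.dx - (γ * α * β) • pairing _ h.dx.dx.dx).comp (cosSeries k q))
      (T₂ := (pairing _ h.dt - α • pairing _ h.dx.dx.dt).comp (sinSeries k q))
      (T₃ := ((β / 2) • pairing _ h.dx).comp (cosSeries k q)) (f := a) (g := b)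
      (h := mulSS k q b b)
      fun i => by
        simp only [ContinuousLinearMap.comp_apply, sub_apply, smul_apply, cosSeries_basis,
          sinSeries_basis, smul_eq_mul, pairing_dt_sinFun h, dt_dx_comm_pairing_sin h,
          pairing_dx_cosFun h, pairing_dxxx_cosFun h]
        linear_combination (-sinCosInt q i φ) * H.second i
    rw [← key]
    simp only [ContinuousLinearMap.comp_apply, sub_apply, smul_apply, smul_eq_mul, pairing_apply]
    simp only [sub_eq_add_neg, ← neg_mul]
    simp only [← pull_const]
    have c0 := h.continuous'
    have c1 := h.dx.continuous'
    have c2 := h.dt.continuous'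
    have c3 := h.dx.dx.dt.continuous'
    have c4 := h.dx.dx.dx.continuous'
    rw [← cell_add (F := fun z => β * (cosSeries k q a z * dx φ z.1 z.2))
        (H := fun z => -γ * α * β * (cosSeries k q a z * dx (dx (dx φ)) z.1 z.2))
        (by fun_prop) (by fun_prop),
      ← cell_add (F := fun z => sinSeries k q b z * dt φ z.1 z.2)
        (H := fun z => -α * (sinSeries k q b z * dt (dx (dx φ)) z.1 z.2))
        (by fun_prop) (by fun_prop),
      ← cell_add (F := fun z => β * (cosSeries k q a z * dx φ z.1 z.2)
          + -γ * α * β * (cosSeries k q a z * dx (dx (dx φ)) z.1 z.2))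
        (H := fun z => sinSeries k q b z * dt φ z.1 z.2
          + -α * (sinSeries k q b z * dt (dx (dx φ)) z.1 z.2)) (by fun_prop) (by fun_prop),
      ← cell_add (F := fun z => β * (cosSeries k q a z * dx φ z.1 z.2)
          + -γ * α * β * (cosSeries k q a z * dx (dx (dx φ)) z.1 z.2)
          + (sinSeries k q b z * dt φ z.1 z.2
          + -α * (sinSeries k q b z * dt (dx (dx φ)) z.1 z.2)))
        (H := fun z => β / 2 * (cosSeries k q (mulSS k q b b) z * dx φ z.1 z.2))
        (by fun_prop) (by fun_prop)]
    simp only [cosSeries_mulSS, cosSum, sinSum]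
    exact cell_congr fun x t => by ring

theorem isStandingWave_of_modeEquations {α β γ : ℝ} {a b : Coefs k q}
    (H : ModeEquations α β γ a b) (h0 : ∀ l, coef (0, l) a = 0) :
    IsStandingWave k α β γ 0 (cosSum a) (sinSum b) where
  eta_mem := ⟨memH_cosSum a, cosSum_neg a, fun n _ => fourierCoef_cosSum_zero h0 n⟩
  u_mem := ⟨memH_sinSum b, sinSum_neg b⟩
  eta_continuous := continuous_cosSum a
  u_continuous := continuous_sinSum b
  solution := isSolution_of_modeEquations H
  average_eq := by
    have := average_eq_fourierCoef (cosSum a)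
    rw [fourierCoef_cosSum_zero h0] at this
    exact_mod_cast this

end Coefs

end BonaSmith

namespace BonaSmith

/-! ### Nonresonance -/

/-- Parameters with exactly one critical pair of wave numbers and no asymptotic resonance. -/
structure CriticalData where
  (α β γ : ℝ)
  (p q : ℕ)
  α_pos : 0 < α
  β_pos : 0 < β
  γ_pos : 0 < γ
  γ_lt_one : γ < 1
  p_pos : 0 < p
  q_pos : 0 < q
  kernel : (q : ℝ) * (1 + α * (p : ℝ) ^ 2) = β * p * sFac α γ p
  unique : ∀ m n : ℕ, 0 < m → 0 < n →
    (n : ℝ) * (1 + α * (m : ℝ) ^ 2) = β * m * sFac α γ m → m = p ∧ n = q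
  nonres : ∀ n : ℕ, α * (n : ℝ) ^ 2 ≠ γ * β ^ 2

namespace BddFamily

theorem add {φ ψ : ℕ × ℕ → ℝ} (h : BddFamily φ) (h' : BddFamily ψ) :
    BddFamily fun i => φ i + ψ i := by
  obtain ⟨C, hC⟩ := h
  obtain ⟨C', hC'⟩ := h'
  exact ⟨C + C', fun i => (abs_add_le _ _).trans (add_le_add (hC i) (hC' i))⟩

theorem const_mul {φ : ℕ × ℕ → ℝ} (c : ℝ) (h : BddFamily φ) : BddFamily fun i => c * φ i := by
  obtain ⟨C, hC⟩ := h
  exact ⟨|c| * C, fun i => by rw [abs_mul]; exact mul_le_mul_of_nonneg_left (hC i) (abs_nonneg c)⟩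

theorem congr {φ ψ : ℕ × ℕ → ℝ} (h : BddFamily φ) (e : ∀ i, ψ i = φ i) : BddFamily ψ := by
  rwa [show ψ = φ from funext e]

/-- At m = 0 the value is 0⁻¹ = 0, so division by the space frequency deletes the modes constant in
x; this builds the zero x-average into η. -/
theorem natInv : BddFamily fun i => ((i.1 : ℝ))⁻¹ := by
  refine ⟨1, fun i => ?_⟩
  rw [abs_inv, Nat.abs_cast]
  exact Nat.cast_inv_le_one i.1

end BddFamily

/-- The reciprocals converge, hence are bounded. -/
theorem exists_pos_lower_bound {u : ℕ → ℝ} {L : ℝ} (hu : ∀ m, 0 < u m) (hL : 0 < L)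
    (h : Filter.Tendsto u Filter.atTop (nhds L)) : ∃ c > 0, ∀ m, c ≤ u m := by
  have h1 := (h.inv₀ hL.ne').bddAbove_range
  obtain ⟨K, hK⟩ := h1
  have hK' : ∀ m, (u m)⁻¹ ≤ K := fun m => hK ⟨m, rfl⟩
  have hK0 : 0 < K := lt_of_lt_of_le (inv_pos.2 (hu 0)) (hK' 0)
  exact ⟨K⁻¹, inv_pos.2 hK0, fun m => inv_le_of_inv_le₀ (hu m) (hK' m)⟩

theorem exists_pos_lower_bound_lt {u : ℕ → ℕ → ℝ} (h : ∀ n, ∃ c > 0, ∀ m, c ≤ u n m) (N : ℕ) :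
    ∃ c > 0, ∀ n < N, ∀ m, c ≤ u n m := by
  induction N with
  | zero => exact ⟨1, one_pos, fun n hn => absurd hn (Nat.not_lt_zero n)⟩
  | succ N ih =>
    obtain ⟨c, hc, h1⟩ := ih
    obtain ⟨c', hc', h2⟩ := h N
    refine ⟨min c c', lt_min hc hc', fun n hn m => ?_⟩
    rcases Nat.lt_succ_iff_lt_or_eq.1 hn with h3 | rfl
    · exact (min_le_left _ _).trans (h1 n h3 m)
    · exact (min_le_right _ _).trans (h2 m)

namespace CriticalData

variable (D : CriticalData)

/-- The symbol `β² m² (1 + γ α m²) - n² (1 + α m²)²`. -/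
def symb (m n : ℕ) : ℝ :=
  D.β ^ 2 * (m : ℝ) ^ 2 * (1 + D.γ * D.α * (m : ℝ) ^ 2) - (n : ℝ) ^ 2 * (1 + D.α * (m : ℝ) ^ 2) ^ 2

theorem sFac_sq (m : ℕ) : sFac D.α D.γ m ^ 2 = 1 + D.γ * D.α * (m : ℝ) ^ 2 := by
  have := D.α_pos
  have := D.γ_pos
  rw [sFac, Real.sq_sqrt (by positivity)]

theorem sFac_pos (m : ℕ) : 0 < sFac D.α D.γ m := by
  have := D.α_pos
  have := D.γ_pos
  exact Real.sqrt_pos.2 (by positivity)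

/-- The symbol is a difference of squares; one factor is positive and the other is the dispersion
relation, which has a unique solution. -/
theorem symb_ne_zero {m n : ℕ} (hm : m ≠ 0) (h : ¬(m = D.p ∧ n = D.q)) : D.symb m n ≠ 0 := by
  have hα := D.α_pos
  have hβ := D.β_pos
  have hγ := D.γ_pos
  have hs := D.sFac_pos m
  have hm' : 0 < (m : ℝ) := by exact_mod_cast Nat.pos_of_ne_zero hm
  have e : D.symb m n = (D.β * m * sFac D.α D.γ m - n * (1 + D.α * (m : ℝ) ^ 2)) *
      (D.β * m * sFac D.α D.γ m + n * (1 + D.α * (m : ℝ) ^ 2)) := by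
    rw [symb, ← D.sFac_sq]; ring
  rw [e]
  refine mul_ne_zero (fun h0 => ?_) (by positivity)
  rcases Nat.eq_zero_or_pos n with rfl | hn
  · have : 0 < D.β * m * sFac D.α D.γ m := by positivity
    simp only [Nat.cast_zero, zero_mul, sub_zero] at h0
    linarith
  · exact h (D.unique m n (Nat.pos_of_ne_zero hm) hn (by linarith))

/-- The limit is the coefficient of m⁴, and the nonresonance assumption says exactly that it is not
zero. -/
theorem tendsto_symb (n : ℕ) : Filter.Tendsto (fun m : ℕ => |D.symb m n| / (m : ℝ) ^ 4)
    Filter.atTop (nhds |D.α * (D.γ * D.β ^ 2 - D.α * (n : ℝ) ^ 2)|) := by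
  have h0 : Filter.Tendsto (fun m : ℕ => ((m : ℝ) ^ 2)⁻¹) Filter.atTop (nhds 0) :=
    tendsto_inv_atTop_zero.comp
      ((Filter.tendsto_pow_atTop two_ne_zero).comp tendsto_natCast_atTop_atTop)
  have h1 : Filter.Tendsto (fun m : ℕ => |D.β ^ 2 * (((m : ℝ) ^ 2)⁻¹ + D.γ * D.α)
      - (n : ℝ) ^ 2 * (((m : ℝ) ^ 2)⁻¹ + D.α) ^ 2|) Filter.atTop
      (nhds |D.β ^ 2 * (0 + D.γ * D.α) - (n : ℝ) ^ 2 * (0 + D.α) ^ 2|) :=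
    (((h0.add_const _).const_mul _).sub (((h0.add_const _).pow 2).const_mul _)).abs
  have e : D.β ^ 2 * (0 + D.γ * D.α) - (n : ℝ) ^ 2 * (0 + D.α) ^ 2 =
      D.α * (D.γ * D.β ^ 2 - D.α * (n : ℝ) ^ 2) := by ring
  rw [e] at h1
  refine h1.congr' ?_
  filter_upwards [Filter.eventually_ge_atTop 1] with m hm
  have hm' : (0 : ℝ) < m := by exact_mod_cast hm
  have h4 : |(m : ℝ) ^ 4| = (m : ℝ) ^ 4 := abs_of_pos (by positivity)
  rw [← h4, ← abs_div, symb]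
  congr 1
  field_simp

/-- The value 1 at the excluded modes keeps the sequence positive, and it is irrelevant for m > p.
-/
theorem exists_symb_lower_bound_fixed (n : ℕ) : ∃ c > 0, ∀ m : ℕ,
    c ≤ if m ≠ 0 ∧ ¬(m = D.p ∧ n = D.q) then |D.symb m n| / (m : ℝ) ^ 4 else 1 := by
  have hα := D.α_pos
  refine exists_pos_lower_bound (L := |D.α * (D.γ * D.β ^ 2 - D.α * (n : ℝ) ^ 2)|)
    (fun m => ?_) (abs_pos.2 (mul_ne_zero hα.ne' (sub_ne_zero.2 (D.nonres n).symm))) ?_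
  · split_ifs with h
    · have := abs_pos.2 (D.symb_ne_zero h.1 h.2)
      have hm' : (0 : ℝ) < m := by exact_mod_cast Nat.pos_of_ne_zero h.1
      positivity
    · exact one_pos
  · refine (D.tendsto_symb n).congr' ?_
    filter_upwards [Filter.eventually_gt_atTop D.p] with m hm
    rw [if_pos ⟨by omega, by omega⟩]

/-- With K = β²(1+γα), the positive part of the symbol is at most K m⁴ and the negative part at
least n²α²m⁴. The threshold gives n ≥ 1 and n²α² ≥ 2K, so half of n²α²m⁴ survives, and n² ≥
(1+n²)/2. -/
theorem symb_large {m n : ℕ} (hm : m ≠ 0)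
    (hn : 2 * (D.β ^ 2 * (1 + D.γ * D.α)) / D.α ^ 2 + 1 ≤ (n : ℝ)) :
    D.α ^ 2 / 4 * (1 + (n : ℝ) ^ 2) * (m : ℝ) ^ 4 ≤ |D.symb m n| := by
  have hα := D.α_pos
  have hβ := D.β_pos
  have hγ := D.γ_pos
  have hm' : (1 : ℝ) ≤ m := by exact_mod_cast Nat.one_le_iff_ne_zero.2 hm
  have hK : 0 < 2 * (D.β ^ 2 * (1 + D.γ * D.α)) / D.α ^ 2 := by positivity
  have hn1 : (1 : ℝ) ≤ n := by linarith
  have hn2 : 2 * (D.β ^ 2 * (1 + D.γ * D.α)) ≤ (n : ℝ) ^ 2 * D.α ^ 2 := by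
    have : 2 * (D.β ^ 2 * (1 + D.γ * D.α)) / D.α ^ 2 ≤ (n : ℝ) ^ 2 := by nlinarith
    rwa [div_le_iff₀ (by positivity)] at this
  have hm2 : (1 : ℝ) ≤ (m : ℝ) ^ 2 := one_le_pow₀ hm'
  have e1 : D.β ^ 2 * (m : ℝ) ^ 2 * (1 + D.γ * D.α * (m : ℝ) ^ 2) ≤
      D.β ^ 2 * (1 + D.γ * D.α) * (m : ℝ) ^ 4 := by
    have : 0 ≤ D.β ^ 2 * (m : ℝ) ^ 2 * ((m : ℝ) ^ 2 - 1) :=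
      mul_nonneg (by positivity) (by linarith)
    nlinarith
  have e2 : (n : ℝ) ^ 2 * D.α ^ 2 * (m : ℝ) ^ 4 ≤ (n : ℝ) ^ 2 * (1 + D.α * (m : ℝ) ^ 2) ^ 2 := by
    have : 0 ≤ (n : ℝ) ^ 2 * (1 + 2 * D.α * (m : ℝ) ^ 2) := by positivity
    nlinarith
  have hm4 : (0 : ℝ) < (m : ℝ) ^ 4 := by positivity
  have e3 := mul_le_mul_of_nonneg_right hn2 hm4.le
  have e4 : D.α ^ 2 / 4 * (1 + (n : ℝ) ^ 2) * (m : ℝ) ^ 4 ≤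
      (n : ℝ) ^ 2 * D.α ^ 2 / 2 * (m : ℝ) ^ 4 := by
    apply mul_le_mul_of_nonneg_right _ hm4.le
    have : 0 ≤ D.α ^ 2 * ((n : ℝ) ^ 2 - 1) :=
      mul_nonneg (by positivity) (by nlinarith)
    nlinarith
  have := neg_abs_le (D.symb m n)
  rw [symb] at *
  linarith

theorem exists_symb_lower_bound : ∃ c > 0, ∀ m n : ℕ, m ≠ 0 → ¬(m = D.p ∧ n = D.q) →
    c * (1 + (n : ℝ) ^ 2) * (m : ℝ) ^ 4 ≤ |D.symb m n| := by
  have hα := D.α_pos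
  obtain ⟨N, hN⟩ := exists_nat_ge (2 * (D.β ^ 2 * (1 + D.γ * D.α)) / D.α ^ 2 + 1)
  obtain ⟨c, hc, h⟩ := exists_pos_lower_bound_lt D.exists_symb_lower_bound_fixed N
  -- Large n use the first constant. The finitely many n < N share the bound c, and dividing by 1 +
  -- N² absorbs the factor 1 + n².
  refine ⟨min (D.α ^ 2 / 4) (c / (1 + (N : ℝ) ^ 2)), lt_min (by positivity) (by positivity),
    fun m n hm hmn => ?_⟩
  rcases lt_or_ge n N with hn | hn
  · have h1 := h n hn m
    rw [if_pos ⟨hm, hmn⟩] at h1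
    have hm' : (0 : ℝ) < m := by exact_mod_cast Nat.pos_of_ne_zero hm
    rw [le_div_iff₀ (by positivity)] at h1
    refine le_trans ?_ h1
    have hnN : (n : ℝ) ^ 2 ≤ (N : ℝ) ^ 2 := by
      have : (n : ℝ) ≤ N := by exact_mod_cast hn.le
      gcongr
    apply mul_le_mul_of_nonneg_right _ (by positivity)
    calc _ ≤ c / (1 + (N : ℝ) ^ 2) * (1 + (N : ℝ) ^ 2) := by
          gcongr
          exact min_le_right _ _
      _ = c := by field_simp
  · refine le_trans ?_ (D.symb_large hm (hN.trans (by exact_mod_cast hn)))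
    gcongr
    exact min_le_left _ _

/-- The inverse of the symbol, set to `0` at `m = 0` and at the critical mode. -/
def invSymb (i : ℕ × ℕ) : ℝ :=
  if i.1 ≠ 0 ∧ i ≠ (D.p, 1) then (D.symb i.1 (D.q * i.2))⁻¹ else 0

theorem mode_eq_iff (i : ℕ × ℕ) : (i.1 = D.p ∧ D.q * i.2 = D.q) ↔ i = (D.p, 1) := by
  rw [Prod.ext_iff, Nat.mul_eq_left D.q_pos.ne']

/-- The exponents 4 and 2 are those of the lower bound for the symbol, so four x-derivatives and two
t-derivatives are gained off the critical mode. -/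
theorem bdd_monomial {a b : ℕ} (ha : a ≤ 4) (hb : b ≤ 2) :
    BddFamily fun i => (i.1 : ℝ) ^ a * ((D.q : ℝ) * i.2) ^ b * D.invSymb i := by
  obtain ⟨c, hc, h⟩ := D.exists_symb_lower_bound
  refine ⟨c⁻¹, fun i => ?_⟩
  simp only [invSymb]
  split_ifs with hi
  · have hm : (1 : ℝ) ≤ i.1 := by exact_mod_cast Nat.one_le_iff_ne_zero.2 hi.1
    have h1 := h i.1 (D.q * i.2) hi.1 (by rw [D.mode_eq_iff]; exact hi.2)
    push_cast at h1
    have h0 : 0 < |D.symb i.1 (D.q * i.2)| := lt_of_lt_of_le (by positivity) h1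
    rw [abs_mul, abs_inv, ← div_eq_mul_inv, div_le_iff₀ h0, abs_of_nonneg (by positivity)]
    have h2 : ((D.q : ℝ) * i.2) ^ b ≤ 1 + ((D.q : ℝ) * i.2) ^ 2 := by
      interval_cases b
      · simp only [pow_zero]; nlinarith [sq_nonneg ((D.q : ℝ) * i.2)]
      · nlinarith [sq_nonneg ((D.q : ℝ) * i.2 - 1)]
      · linarith
    calc (i.1 : ℝ) ^ a * ((D.q : ℝ) * i.2) ^ b
        ≤ (i.1 : ℝ) ^ 4 * (1 + ((D.q : ℝ) * i.2) ^ 2) :=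
          mul_le_mul (pow_le_pow_right₀ hm ha) h2 (by positivity) (by positivity)
      _ = c⁻¹ * (c * (1 + ((D.q : ℝ) * i.2) ^ 2) * (i.1 : ℝ) ^ 4) := by field_simp
      _ ≤ _ := by gcongr
  · simp only [mul_zero, abs_zero]
    positivity

/-- The inverse of `β p` at the critical mode, `0` elsewhere. -/
def critInv (i : ℕ × ℕ) : ℝ := if i = (D.p, 1) then (D.β * D.p)⁻¹ else 0

theorem bdd_critInv (f : ℕ × ℕ → ℝ) : BddFamily fun i => f i * D.critInv i := by
  refine ⟨|f (D.p, 1) * (D.β * D.p)⁻¹|, fun i => ?_⟩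
  simp only [critInv]
  split_ifs with h
  · rw [h]
  · rw [mul_zero, abs_zero]
    positivity

/-- The entries of the partial inverse of the linearised mode equations. -/
def t11 (i : ℕ × ℕ) : ℝ := i.1 * (D.q * i.2) * (1 + D.α * (i.1 : ℝ) ^ 2) * D.invSymb i

/-- See `t11`. -/
def t12 (i : ℕ × ℕ) : ℝ := -D.β * (i.1 : ℝ) ^ 2 * D.invSymb i

/-- See `t11`. -/
def t21 (i : ℕ × ℕ) : ℝ :=
  D.β * i.1 * (1 + D.γ * D.α * (i.1 : ℝ) ^ 2) * D.invSymb i + D.critInv i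

/-- See `t11`. -/
def t22 (i : ℕ × ℕ) : ℝ := -(D.q * i.2) * (1 + D.α * (i.1 : ℝ) ^ 2) * D.invSymb i

/-- Here and below, an entry of the inverse is multiplied by a symbol of a perturbation or of a
nonlinear term and expanded into monomials covered by `bdd_monomial`. The third derivative of η in
the second equation would need a fifth power of m if the unknown were η_m; with m η_m the fourth
power suffices. -/
theorem bdd_t11_nm : BddFamily fun i => D.t11 i * (D.q * i.2 * i.1) :=
  ((D.bdd_monomial (a := 2) (b := 2) (by norm_num) (by norm_num)).add
    ((D.bdd_monomial (a := 4) (b := 2) (by norm_num) (by norm_num)).const_mul D.α)).congr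
    fun i => by rw [t11]; ring

theorem bdd_t11_m : BddFamily fun i => D.t11 i * i.1 :=
  ((D.bdd_monomial (a := 2) (b := 1) (by norm_num) (by norm_num)).add
    ((D.bdd_monomial (a := 4) (b := 1) (by norm_num) (by norm_num)).const_mul D.α)).congr
    fun i => by rw [t11]; ring

theorem bdd_t12_nmm : BddFamily fun i => D.t12 i * (D.q * i.2 * (i.1 : ℝ) ^ 2) :=
  ((D.bdd_monomial (a := 4) (b := 1) (by norm_num) (by norm_num)).const_mul (-D.β)).congr
    fun i => by rw [t12]; ring

theorem bdd_t12_y : BddFamily fun i => D.t12 i * (1 + D.γ * D.α * (i.1 : ℝ) ^ 2) :=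
  (((D.bdd_monomial (a := 2) (b := 0) (by norm_num) (by norm_num)).const_mul (-D.β)).add
    ((D.bdd_monomial (a := 4) (b := 0) (by norm_num) (by norm_num)).const_mul
      (-D.β * (D.γ * D.α)))).congr
    fun i => by rw [t12]; ring

theorem bdd_t12_mm : BddFamily fun i => D.t12 i * (i.1 : ℝ) ^ 2 :=
  ((D.bdd_monomial (a := 4) (b := 0) (by norm_num) (by norm_num)).const_mul (-D.β)).congr
    fun i => by rw [t12]; ring

theorem bdd_t12_m : BddFamily fun i => D.t12 i * i.1 :=
  ((D.bdd_monomial (a := 3) (b := 0) (by norm_num) (by norm_num)).const_mul (-D.β)).congr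
    fun i => by rw [t12]; ring

theorem bdd_t21_nm : BddFamily fun i => D.t21 i * (D.q * i.2 * i.1) :=
  ((((D.bdd_monomial (a := 2) (b := 1) (by norm_num) (by norm_num)).const_mul D.β).add
    ((D.bdd_monomial (a := 4) (b := 1) (by norm_num) (by norm_num)).const_mul
      (D.β * (D.γ * D.α)))).add (D.bdd_critInv fun i => D.q * i.2 * i.1)).congr
    fun i => by rw [t21]; ring

theorem bdd_t21_m : BddFamily fun i => D.t21 i * i.1 :=
  ((((D.bdd_monomial (a := 2) (b := 0) (by norm_num) (by norm_num)).const_mul D.β).add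
    ((D.bdd_monomial (a := 4) (b := 0) (by norm_num) (by norm_num)).const_mul
      (D.β * (D.γ * D.α)))).add (D.bdd_critInv fun i => i.1)).congr
    fun i => by rw [t21]; ring

theorem bdd_t22_nmm : BddFamily fun i => D.t22 i * (D.q * i.2 * (i.1 : ℝ) ^ 2) :=
  (((D.bdd_monomial (a := 2) (b := 2) (by norm_num) (by norm_num)).const_mul (-1)).add
    ((D.bdd_monomial (a := 4) (b := 2) (by norm_num) (by norm_num)).const_mul (-D.α))).congr
    fun i => by rw [t22]; ring

theorem bdd_t22_y : BddFamily fun i => D.t22 i * (1 + D.γ * D.α * (i.1 : ℝ) ^ 2) :=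
  ((((D.bdd_monomial (a := 0) (b := 1) (by norm_num) (by norm_num)).const_mul (-1)).add
    ((D.bdd_monomial (a := 2) (b := 1) (by norm_num) (by norm_num)).const_mul
      (-D.α - D.γ * D.α))).add
    ((D.bdd_monomial (a := 4) (b := 1) (by norm_num) (by norm_num)).const_mul
      (-(D.γ * D.α ^ 2)))).congr
    fun i => by rw [t22]; ring

theorem bdd_t22_mm : BddFamily fun i => D.t22 i * (i.1 : ℝ) ^ 2 :=
  (((D.bdd_monomial (a := 2) (b := 1) (by norm_num) (by norm_num)).const_mul (-1)).add
    ((D.bdd_monomial (a := 4) (b := 1) (by norm_num) (by norm_num)).const_mul (-D.α))).congr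
    fun i => by rw [t22]; ring

theorem bdd_t22_m : BddFamily fun i => D.t22 i * i.1 :=
  (((D.bdd_monomial (a := 1) (b := 1) (by norm_num) (by norm_num)).const_mul (-1)).add
    ((D.bdd_monomial (a := 3) (b := 1) (by norm_num) (by norm_num)).const_mul (-D.α))).congr
    fun i => by rw [t22]; ring

end CriticalData

end BonaSmith

namespace BonaSmith

/-! ### The fixed point form of the mode equations -/

/-- Unknowns `(m η_m, u_m)`. -/
abbrev State (k q : ℕ) : Type := Coefs k q × Coefs k q

namespace CriticalData

variable (D : CriticalData) (k : ℕ)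

open Coefs

/-- The operator with the given matrix of operators. -/
def blockOp {k q : ℕ} (a b c d : Coefs k q →L[ℝ] Coefs k q) : State k q →L[ℝ] State k q :=
  (a.coprod b).prod (c.coprod d)

@[simp] theorem blockOp_apply {k q : ℕ} (a b c d : Coefs k q →L[ℝ] Coefs k q) (z : State k q) :
    blockOp a b c d z = (a z.1 + b z.2, c z.1 + d z.2) := rfl

/-- Division by the space frequency. -/
def divX : Coefs k D.q →L[ℝ] Coefs k D.q := diag _ BddFamily.natInv

/-- The part of the linear operator proportional to the change of `α`. -/
def opAlpha : State k D.q →L[ℝ] State k D.q :=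
  blockOp (-diag _ D.bdd_t11_nm) (diag _ D.bdd_t12_nmm) (-diag _ D.bdd_t21_nm)
    (diag _ D.bdd_t22_nmm)

/-- The part of the linear operator proportional to the change of `β`. -/
def opBeta : State k D.q →L[ℝ] State k D.q :=
  blockOp (-diag _ D.bdd_t12_y) (diag _ D.bdd_t11_m) (-diag _ D.bdd_t22_y) (diag _ D.bdd_t21_m)

/-- The part of the linear operator proportional to `β` times the change of `α`. -/
def opMixed : State k D.q →L[ℝ] State k D.q :=
  blockOp (-D.γ • diag _ D.bdd_t12_mm) 0 (-D.γ • diag _ D.bdd_t22_mm) 0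

/-- The operator applied to the quadratic terms. -/
def opQuad : State k D.q →L[ℝ] State k D.q :=
  blockOp (diag _ D.bdd_t11_m) (-(1 / 2 : ℝ) • diag _ D.bdd_t12_m) (diag _ D.bdd_t21_m)
    (-(1 / 2 : ℝ) • diag _ D.bdd_t22_m)

variable {k} in
/-- The quadratic term `(u η, u²)` for given products. -/
def prodPair (B₁ B₂ : Coefs k D.q →L[ℝ] Coefs k D.q →L[ℝ] Coefs k D.q) :
    State k D.q →L[ℝ] State k D.q →L[ℝ] State k D.q :=
  (ContinuousLinearMap.compL ℝ _ _ _ (.inl ℝ _ _)).comp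
      (B₁.bilinearComp (.snd ℝ _ _) ((D.divX k).comp (.fst ℝ _ _)))
    + (ContinuousLinearMap.compL ℝ _ _ _ (.inr ℝ _ _)).comp
      (B₂.bilinearComp (.snd ℝ _ _) (.snd ℝ _ _))

@[simp] theorem prodPair_apply (B₁ B₂ : Coefs k D.q →L[ℝ] Coefs k D.q →L[ℝ] Coefs k D.q)
    (z w : State k D.q) :
    D.prodPair B₁ B₂ z w = (B₁ z.2 (D.divX k w.1), B₂ z.2 w.2) := by
  simp [prodPair]

/-- The quadratic terms of products of odd time frequencies. -/
def pairOdd : State k D.q →L[ℝ] State k D.q →L[ℝ] State k D.q :=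
  D.prodPair (oddMul (mulSC k D.q)) (oddMul (mulSS k D.q))

/-- The remaining quadratic terms. -/
def pairRest : State k D.q →L[ℝ] State k D.q →L[ℝ] State k D.q :=
  D.prodPair (mulSC k D.q - oddMul (mulSC k D.q)) (mulSS k D.q - oddMul (mulSS k D.q))

theorem pairOdd_apply (z w : State k D.q) : D.pairOdd k z w =
    (oddMul (mulSC k D.q) z.2 (D.divX k w.1), oddMul (mulSS k D.q) z.2 w.2) :=
  D.prodPair_apply k _ _ z w

theorem pairRest_apply (z w : State k D.q) : D.pairRest k z w =
    (mulSC k D.q z.2 (D.divX k w.1) - oddMul (mulSC k D.q) z.2 (D.divX k w.1),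
      mulSS k D.q z.2 w.2 - oddMul (mulSS k D.q) z.2 w.2) := by
  simp only [pairRest, prodPair_apply, sub_apply]

/-- `pairOdd` followed by `opQuad`. -/
def quadOdd : State k D.q →L[ℝ] State k D.q →L[ℝ] State k D.q :=
  (ContinuousLinearMap.compL ℝ _ _ _ (D.opQuad k)).comp (D.pairOdd k)

/-- `pairRest` followed by `opQuad`. -/
def quadRest : State k D.q →L[ℝ] State k D.q →L[ℝ] State k D.q :=
  (ContinuousLinearMap.compL ℝ _ _ _ (D.opQuad k)).comp (D.pairRest k)

theorem quadOdd_apply (z w : State k D.q) : D.quadOdd k z w = D.opQuad k (D.pairOdd k z w) := rfl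

/-- The kernel vector `(2 p cos, 2 s sin)`. -/
def xiState : State k D.q :=
  ((2 * D.p : ℝ) • basis (D.p, 1), (2 * sFac D.α D.γ D.p : ℝ) • basis (D.p, 1))

/-- The coefficient of the normalisation of the first harmonic. -/
def kappa (P : ℝ × ℝ) : ℝ :=
  P.1 * (D.γ * D.α * (D.p : ℝ) ^ 4 * D.q * sFac D.α D.γ D.p
        - D.γ * D.β * (D.p : ℝ) ^ 3 * (1 + D.γ * D.α * (D.p : ℝ) ^ 2)) / den11 D.α D.β D.γ D.p D.q
      - P.2 * (D.γ * D.α * (D.p : ℝ) ^ 3 * (1 + D.γ * D.α * (D.p : ℝ) ^ 2))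
        / den11 D.α D.β D.γ D.p D.q

/-- The determinant of the critical mode at the perturbed parameters. -/
def critDet (P : ℝ × ℝ) : ℝ :=
  (D.β + P.2) ^ 2 * (D.p : ℝ) ^ 2 * (1 + D.γ * (D.α + P.1) * (D.p : ℝ) ^ 2)
    - (D.q : ℝ) ^ 2 * (1 + (D.α + P.1) * (D.p : ℝ) ^ 2) ^ 2

/-- The factor of `A²` in the scalar equation of the critical mode. -/
def cubicFactor (P : ℝ × ℝ) (z : State k D.q) : ℝ :=
  (D.β + P.2) * D.p * (D.q * (1 + (D.α + P.1) * (D.p : ℝ) ^ 2) *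
      coef (D.p, 1) (D.pairRest k z z).1
    + (D.β + P.2) * D.p * coef (D.p, 1) (D.pairRest k z z).2 / 2)

/-- `A²` as a function of the parameters and the state. -/
def ampSqOf (P : ℝ × ℝ) (z : State k D.q) : ℝ :=
  -(2 * (1 + D.kappa P)) * D.critDet P / D.cubicFactor k P z

/-- The equation for the state. -/
def residual (Pz : (ℝ × ℝ) × State k D.q) : State k D.q :=
  Pz.2 - (1 + D.kappa Pz.1) • D.xiState k + Pz.1.1 • D.opAlpha k Pz.2 + Pz.1.2 • D.opBeta k Pz.2
    + ((D.β + Pz.1.2) * Pz.1.1) • D.opMixed k Pz.2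
    + (D.β + Pz.1.2) • (D.quadOdd k Pz.2 Pz.2
      + D.ampSqOf k Pz.1 Pz.2 • D.quadRest k Pz.2 Pz.2)

/-- The linear combinations of the mode equations which appear in `residual`. -/
theorem coef_residual {P : ℝ × ℝ} {z : State k D.q} (h : D.residual k (P, z) = 0) (i : ℕ × ℕ)
    {w : State k D.q} (hw : w = D.pairOdd k z z + D.ampSqOf k P z • D.pairRest k z z) :
    coef i z.1 - (1 + D.kappa P) * coef i (D.xiState k).1
      + D.t11 i * (-P.1 * (D.q * i.2 * i.1) * coef i z.1 + P.2 * i.1 * coef i z.2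
        + (D.β + P.2) * i.1 * coef i w.1)
      + D.t12 i * (P.1 * (D.q * i.2 * (i.1 : ℝ) ^ 2) * coef i z.2
        - P.2 * (1 + D.γ * D.α * (i.1 : ℝ) ^ 2) * coef i z.1
        - (D.β + P.2) * D.γ * P.1 * (i.1 : ℝ) ^ 2 * coef i z.1
        - (D.β + P.2) * i.1 * coef i w.2 / 2) = 0 ∧
    coef i z.2 - (1 + D.kappa P) * coef i (D.xiState k).2
      + D.t21 i * (-P.1 * (D.q * i.2 * i.1) * coef i z.1 + P.2 * i.1 * coef i z.2
        + (D.β + P.2) * i.1 * coef i w.1)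
      + D.t22 i * (P.1 * (D.q * i.2 * (i.1 : ℝ) ^ 2) * coef i z.2
        - P.2 * (1 + D.γ * D.α * (i.1 : ℝ) ^ 2) * coef i z.1
        - (D.β + P.2) * D.γ * P.1 * (i.1 : ℝ) ^ 2 * coef i z.1
        - (D.β + P.2) * i.1 * coef i w.2 / 2) = 0 := by
  have hq : D.quadOdd k z z + D.ampSqOf k P z • D.quadRest k z z = D.opQuad k w := by
    rw [hw, map_add, map_smul]; rfl
  rw [residual] at h
  simp only [hq] at h
  have h1 := congrArg (fun z => coef i z.1) h
  have h2 := congrArg (fun z => coef i z.2) h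
  simp only [opAlpha, opBeta, opMixed, opQuad, blockOp_apply, Prod.fst_add, Prod.fst_sub,
    Prod.smul_fst, Prod.snd_add, Prod.snd_sub, Prod.smul_snd, map_add, map_sub, map_smul,
    neg_apply, map_neg, smul_apply, zero_apply, coef_diag, smul_eq_mul, Prod.fst_zero,
    Prod.snd_zero, map_zero] at h1 h2
  constructor
  · linear_combination h1
  · linear_combination h2

theorem coef_xiState (i : ℕ × ℕ) : coef i (D.xiState k).1 = (if i = (D.p, 1) then (2 * D.p : ℝ) else 0) ∧
    coef i (D.xiState k).2 = if i = (D.p, 1) then 2 * sFac D.α D.γ D.p else 0 := by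
  simp only [xiState, map_smul, coef_basis, smul_eq_mul, eq_comm (a := i)]
  constructor <;> split_ifs <;> simp

/-- The critical mode has the odd time frequency 1, while products of two odd frequencies are even;
hence the solvability condition starts with the factor A². -/
theorem coef_pairOdd (z w : State k D.q) :
    coef (D.p, 1) (D.pairOdd k z w).1 = 0 ∧ coef (D.p, 1) (D.pairOdd k z w).2 = 0 := by
  have h1 := congrArg (coef (D.p, 1)) (graded_mulSC.oddPart_oddMul z.2 (D.divX k w.1))
  have h2 := congrArg (coef (D.p, 1)) (graded_mulSS.oddPart_oddMul z.2 w.2)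
  rw [coef_oddPart, if_pos odd_one, map_zero] at h1 h2
  rw [pairOdd_apply]
  exact ⟨h1, h2⟩

/-- The matrix M with rows (−nX, b) and (−bY, nX) satisfies M² = −(b²Y − n²X²) id. Its inverse is
therefore −gM, and the hypotheses are the solved form of M(a, y) = −(f₁, f₂). -/
theorem solve_good {a y f₁ f₂ n X b Y g : ℝ} (hg : (b ^ 2 * Y - n ^ 2 * X ^ 2) * g = 1)
    (ha : a + n * X * g * f₁ - b * g * f₂ = 0) (hy : y + b * Y * g * f₁ - n * X * g * f₂ = 0) :
    -n * X * a + b * y + f₁ = 0 ∧ n * X * y - b * Y * a + f₂ = 0 := by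
  constructor
  · linear_combination -n * X * ha + b * hy - f₁ * hg
  · linear_combination n * X * hy - b * Y * ha - f₂ * hg

/-- The mode equations of the rescaled coefficients. -/
theorem mode_equations_of_residual {P : ℝ × ℝ} {z : State k D.q} (hβ : D.β + P.2 ≠ 0)
    (hz : D.cubicFactor k P z ≠ 0) (h : D.residual k (P, z) = 0) (i : ℕ × ℕ)
    {w : State k D.q} (hw : w = D.pairOdd k z z + D.ampSqOf k P z • D.pairRest k z z) :
    (-(D.q * i.2) * (1 + (D.α + P.1) * (i.1 : ℝ) ^ 2) * coef i (D.divX k z.1)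
      + (D.β + P.2) * i.1 * coef i z.2 + (D.β + P.2) * i.1 * coef i w.1 = 0) ∧
    ((D.q * i.2) * (1 + (D.α + P.1) * (i.1 : ℝ) ^ 2) * coef i z.2
      - (D.β + P.2) * i.1 * (1 + D.γ * (D.α + P.1) * (i.1 : ℝ) ^ 2) * coef i (D.divX k z.1)
      - (D.β + P.2) * i.1 * coef i w.2 / 2 = 0) ∧ (i.1 = 0 → coef i (D.divX k z.1) = 0) := by
  obtain ⟨h1, h2⟩ := D.coef_residual k h i hw
  rw [(D.coef_xiState k i).1] at h1
  rw [(D.coef_xiState k i).2] at h2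
  -- At m = 0 the entries of the inverse in the second row vanish, so the residual forces the
  -- coefficient of u to be zero, and division by m removes that of η; both equations become
  -- trivial.
  rcases Nat.eq_zero_or_pos i.1 with hm | hm
  · have hi : ¬(i = (D.p, 1)) := by
      intro hi
      rw [hi] at hm
      exact D.p_pos.ne' hm
    have e0 : D.invSymb i = 0 := by simp [invSymb, hm]
    have e1 : D.critInv i = 0 := by simp [critInv, hi]
    simp only [t21, t22, e0, e1, if_neg hi, mul_zero, add_zero, zero_mul, sub_zero] at h2
    simp [hm, h2, divX]
  · have hm' : (i.1 : ℝ) ≠ 0 := by exact_mod_cast hm.ne'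
    have hx : coef i z.1 = i.1 * coef i (D.divX k z.1) := by
      rw [divX, coef_diag, mul_inv_cancel_left₀ hm']
    rw [hx] at h1 h2
    generalize coef i (D.divX k z.1) = a at *
    have hcd : i = (D.p, 1) → coef i w.1 = D.ampSqOf k P z * coef i (D.pairRest k z z).1 ∧
        coef i w.2 = D.ampSqOf k P z * coef i (D.pairRest k z z).2 := by
      rintro rfl
      simp only [hw, Prod.fst_add, Prod.snd_add, Prod.smul_fst, Prod.smul_snd, map_add, map_smul,
        smul_eq_mul, (D.coef_pairOdd k z z).1, (D.coef_pairOdd k z z).2, zero_add, and_self]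
    generalize coef i z.2 = y at *
    generalize coef i w.1 = c at *
    generalize coef i w.2 = d at *
    by_cases hi : i = (D.p, 1)
    · obtain ⟨hc, hd⟩ := hcd hi
      have e0 : D.invSymb i = 0 := by simp [invSymb, hi]
      have e1 : D.critInv i = (D.β * D.p)⁻¹ := by simp [critInv, hi]
      simp only [t11, t12, t21, t22, e0, e1, if_pos hi, mul_zero, zero_mul, add_zero,
        zero_add] at h1 h2
      subst hi
      simp only [Nat.cast_one, mul_one] at *
      -- The solvability condition, in the form in which it defines A².
      have hr : D.ampSqOf k P z * D.cubicFactor k P z = -(2 * (1 + D.kappa P)) * D.critDet P := by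
        rw [ampSqOf, div_mul_cancel₀ _ hz]
      have hβ0 := D.β_pos.ne'
      have hker := D.kernel
      rw [cubicFactor, critDet] at hr
      -- The entries `t11` and `t12` vanish at the critical mode, so the first component of the
      -- residual is just the normalisation.
      have ha : a = 2 * (1 + D.kappa P) := by
        apply mul_left_cancel₀ hm'
        linear_combination h1
      have hg : D.β * D.p * (D.β * D.p)⁻¹ = 1 := mul_inv_cancel₀ (mul_ne_zero hβ0 hm')
      generalize (D.β * (D.p : ℝ))⁻¹ = g at *
      -- The second component of the residual is the first mode equation divided by βp; the
      -- dispersion relation at the critical pair matches the two entries of ξ.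
      have E1 : -D.q * (1 + (D.α + P.1) * (D.p : ℝ) ^ 2) * a
          + (D.β + P.2) * D.p * y + (D.β + P.2) * D.p * c = 0 := by
        rw [ha] at h2 ⊢
        linear_combination D.β * D.p * h2 - 2 * (1 + D.kappa P) * hker -
          (-P.1 * (D.q * D.p) * (D.p * (2 * (1 + D.kappa P))) + P.2 * D.p * y
            + (D.β + P.2) * D.p * c) * hg
      refine ⟨E1, ?_, fun h => absurd h hm.ne'⟩
      -- Multiplied by (β+ν)p, the second equation is q(1+(α+μ)p²) times the first minus the
      -- relation defining A²: elimination of the coefficient of u leaves the perturbed determinant.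
      apply mul_left_cancel₀ (mul_ne_zero hβ hm')
      rw [ha] at E1 ⊢
      rw [hc] at E1
      rw [hd]
      linear_combination D.q * (1 + (D.α + P.1) * (D.p : ℝ) ^ 2) * E1 - hr
    · have e1 : D.critInv i = 0 := by simp [critInv, hi]
      have e0 : D.invSymb i = (D.symb i.1 (D.q * i.2))⁻¹ := by
        rw [invSymb, if_pos ⟨hm.ne', hi⟩]
      have hs : D.symb i.1 (D.q * i.2) ≠ 0 :=
        D.symb_ne_zero hm.ne' (by rw [D.mode_eq_iff]; exact hi)
      have hg : D.symb i.1 (D.q * i.2) * D.invSymb i = 1 := by rw [e0, mul_inv_cancel₀ hs]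
      simp only [t11, t12, t21, t22, e1, if_neg hi, mul_zero, sub_zero, add_zero] at h1 h2
      rw [symb] at hg
      push_cast at hg
      generalize D.invSymb i = g at *
      have key := solve_good (a := a) (y := y)
        (f₁ := -P.1 * (D.q * i.2 * i.1) * (i.1 * a) + P.2 * i.1 * y + (D.β + P.2) * i.1 * c)
        (f₂ := P.1 * (D.q * i.2 * (i.1 : ℝ) ^ 2) * y
          - P.2 * (1 + D.γ * D.α * (i.1 : ℝ) ^ 2) * (i.1 * a)
          - (D.β + P.2) * D.γ * P.1 * (i.1 : ℝ) ^ 2 * (i.1 * a)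
          - (D.β + P.2) * i.1 * d / 2) (n := D.q * i.2) (X := 1 + D.α * (i.1 : ℝ) ^ 2)
        (b := D.β * i.1) (Y := 1 + D.γ * D.α * (i.1 : ℝ) ^ 2) (g := g)
        (by linear_combination hg)
        (by
          apply mul_left_cancel₀ hm'
          linear_combination h1)
        (by linear_combination h2)
      refine ⟨?_, ?_, fun h => absurd h hm.ne'⟩
      · linear_combination key.1
      · linear_combination key.2

/-- A zero of `residual` with `A²` the value of `ampSqOf` yields a standing wave. -/
theorem modeEquations_of_residual {P : ℝ × ℝ} {z : State k D.q} (hβ : D.β + P.2 ≠ 0)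
    (hz : D.cubicFactor k P z ≠ 0) (h : D.residual k (P, z) = 0) {A : ℝ}
    (hA : A ^ 2 = D.ampSqOf k P z) :
    ModeEquations (D.α + P.1) (D.β + P.2) D.γ (scale A (D.divX k z.1)) (scale A z.2) ∧
      ∀ l, coef (0, l) (scale A (D.divX k z.1)) = 0 := by
  have key := fun i => D.mode_equations_of_residual k hβ hz h i rfl
  have e1 : mulSC k D.q (scale A z.2) (scale A (D.divX k z.1)) =
      scale A (D.pairOdd k z z + D.ampSqOf k P z • D.pairRest k z z).1 := by
    rw [graded_mulSC.scale_mul, hA, pairOdd_apply, pairRest_apply]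
    rfl
  have e2 : mulSS k D.q (scale A z.2) (scale A z.2) =
      scale A (D.pairOdd k z z + D.ampSqOf k P z • D.pairRest k z z).2 := by
    rw [graded_mulSS.scale_mul, hA, pairOdd_apply, pairRest_apply]
    rfl
  refine ⟨⟨fun i => ?_, fun i => ?_⟩, fun l => ?_⟩
  · rw [e1]
    simp only [coef_scale]
    linear_combination (if Odd i.2 then A else A ^ 2) * (key i).1
  · rw [e2]
    simp only [coef_scale]
    linear_combination (if Odd i.2 then A else A ^ 2) * (key i).2.1
  · rw [coef_scale, (key (0, l)).2.2 rfl, mul_zero]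

end CriticalData

end BonaSmith

namespace BonaSmith

open Coefs

/-! ### Products of the first harmonics -/

namespace Coefs

variable {k q : ℕ}

theorem sinEl_neg_left (a b : ℤ) : sinEl k q (-a) b = -sinEl k q a b := by
  simp [sinEl]

theorem sinEl_neg_right (a b : ℤ) : sinEl k q a (-b) = -sinEl k q a b := by
  simp [sinEl]

theorem cosEl_neg_left (a b : ℤ) : cosEl k q (-a) b = cosEl k q a b := by
  simp [cosEl]

theorem cosEl_neg_right (a b : ℤ) : cosEl k q a (-b) = cosEl k q a b := by
  simp [cosEl]

theorem sinEl_natCast (a b : ℕ) :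
    sinEl k q a b = if a = 0 ∨ b = 0 then 0 else basis (a, b) := by
  rcases Nat.eq_zero_or_pos a with rfl | ha
  · simp [sinEl]
  rcases Nat.eq_zero_or_pos b with rfl | hb
  · simp [sinEl]
  rw [if_neg (by omega), sinEl, Int.sign_natCast_of_ne_zero ha.ne',
    Int.sign_natCast_of_ne_zero hb.ne']
  simp

theorem cosEl_natCast (a b : ℕ) : cosEl k q a b = basis (a, b) := rfl

end Coefs

namespace CriticalData

variable (D : CriticalData) (k : ℕ)

theorem mulSC_first_first : mulSC k D.q (basis (D.p, 1)) (basis (D.p, 1)) =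
    (1 / 4 : ℝ) • basis (2 * D.p, 2) := by
  have hp := D.p_pos
  rw [mulSC_basis]
  have e1 : ((D.p : ℤ) + D.p) = ((2 * D.p : ℕ) : ℤ) := by push_cast; ring
  have e2 : (((1 : ℕ) : ℤ) + (1 : ℕ)) = ((2 : ℕ) : ℤ) := by norm_num
  have e3 : (((1 : ℕ) : ℤ) - (1 : ℕ)) = ((0 : ℕ) : ℤ) := by norm_num
  have e4 : ((D.p : ℤ) - D.p) = ((0 : ℕ) : ℤ) := by norm_num
  simp only [e1, e2, e3, e4, sinEl_natCast]
  simp [hp.ne']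

theorem mulSS_first_first : mulSS k D.q (basis (D.p, 1)) (basis (D.p, 1)) =
    (1 / 4 : ℝ) • (basis (2 * D.p, 2) - basis (2 * D.p, 0) - basis (0, 2) + basis (0, 0)) := by
  rw [mulSS_basis]
  have e1 : ((D.p : ℤ) + D.p) = ((2 * D.p : ℕ) : ℤ) := by push_cast; ring
  have e2 : (((1 : ℕ) : ℤ) + (1 : ℕ)) = ((2 : ℕ) : ℤ) := by norm_num
  have e3 : (((1 : ℕ) : ℤ) - (1 : ℕ)) = ((0 : ℕ) : ℤ) := by norm_num
  have e4 : ((D.p : ℤ) - D.p) = ((0 : ℕ) : ℤ) := by norm_num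
  simp only [e1, e2, e3, e4, cosEl_natCast, sub_eq_add_neg]

theorem int_freq : ((D.p : ℤ) + ((2 * D.p : ℕ) : ℤ)) = ((3 * D.p : ℕ) : ℤ) ∧
    ((D.p : ℤ) - ((2 * D.p : ℕ) : ℤ)) = -(D.p : ℤ) ∧
    ((((2 * D.p : ℕ) : ℤ)) + (D.p : ℤ)) = ((3 * D.p : ℕ) : ℤ) ∧
    ((((2 * D.p : ℕ) : ℤ)) - (D.p : ℤ)) = (D.p : ℤ) ∧
    (((2 * D.p : ℕ) : ℤ) + ((2 * D.p : ℕ) : ℤ)) = ((4 * D.p : ℕ) : ℤ) ∧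
    (((2 * D.p : ℕ) : ℤ) - ((2 * D.p : ℕ) : ℤ)) = ((0 : ℕ) : ℤ) ∧
    ((D.p : ℤ) + D.p) = ((2 * D.p : ℕ) : ℤ) ∧ ((D.p : ℤ) - D.p) = ((0 : ℕ) : ℤ) := by
  push_cast
  refine ⟨?_, ?_, ?_, ?_, ?_, ?_, ?_, ?_⟩ <;> ring

theorem int_freq_time : (((1 : ℕ) : ℤ) + ((2 : ℕ) : ℤ)) = ((3 : ℕ) : ℤ) ∧
    (((1 : ℕ) : ℤ) - ((2 : ℕ) : ℤ)) = -((1 : ℕ) : ℤ) ∧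
    (((2 : ℕ) : ℤ) + ((1 : ℕ) : ℤ)) = ((3 : ℕ) : ℤ) ∧
    (((2 : ℕ) : ℤ) - ((1 : ℕ) : ℤ)) = ((1 : ℕ) : ℤ) ∧
    (((2 : ℕ) : ℤ) + ((2 : ℕ) : ℤ)) = ((4 : ℕ) : ℤ) ∧
    (((2 : ℕ) : ℤ) - ((2 : ℕ) : ℤ)) = ((0 : ℕ) : ℤ) ∧
    (((1 : ℕ) : ℤ) + ((1 : ℕ) : ℤ)) = ((2 : ℕ) : ℤ) ∧
    (((1 : ℕ) : ℤ) - ((1 : ℕ) : ℤ)) = ((0 : ℕ) : ℤ) ∧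
    (∀ n : ℕ, ((n : ℤ) + ((0 : ℕ) : ℤ)) = (n : ℤ)) ∧
    (∀ n : ℕ, ((n : ℤ) - ((0 : ℕ) : ℤ)) = (n : ℤ)) := by
  norm_num

/-- The coefficient of a product at the critical mode, for the products which occur. -/
theorem coef_mulSC_table :
    coef (D.p, 1) (mulSC k D.q (basis (D.p, 1)) (basis (D.p, 1))) = 0 ∧
    coef (D.p, 1) (mulSC k D.q (basis (D.p, 1)) (basis (2 * D.p, 0))) = -1 / 2 ∧
    coef (D.p, 1) (mulSC k D.q (basis (D.p, 1)) (basis (2 * D.p, 2))) = 1 / 4 ∧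
    coef (D.p, 1) (mulSC k D.q (basis (2 * D.p, 2)) (basis (D.p, 1))) = 1 / 4 ∧
    coef (D.p, 1) (mulSC k D.q (basis (2 * D.p, 2)) (basis (2 * D.p, 0))) = 0 ∧
    coef (D.p, 1) (mulSC k D.q (basis (2 * D.p, 2)) (basis (2 * D.p, 2))) = 0 := by
  have hp := D.p_pos
  obtain ⟨a1, a2, a3, a4, a5, a6, a7, a8⟩ := D.int_freq
  obtain ⟨b1, b2, b3, b4, b5, b6, b7, b8, b9, b10⟩ := int_freq_time
  have c2 : 2 * D.p ≠ D.p := by omega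
  have c3 : 3 * D.p ≠ D.p := by omega
  have c4 : 4 * D.p ≠ D.p := by omega
  simp only [mulSC_basis, a1, a2, a3, a4, a5, a6, a7, a8, b1, b2, b3, b4, b5, b6, b7, b8, b9, b10,
    sinEl_neg_left, sinEl_neg_right, sinEl_natCast]
  refine ⟨?_, ?_, ?_, ?_, ?_, ?_⟩ <;> simp [hp.ne']
  norm_num

theorem coef_mulSS_table :
    coef (D.p, 1) (mulSS k D.q (basis (D.p, 1)) (basis (D.p, 1))) = 0 ∧
    coef (D.p, 1) (mulSS k D.q (basis (D.p, 1)) (basis (2 * D.p, 2))) = 1 / 4 ∧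
    coef (D.p, 1) (mulSS k D.q (basis (2 * D.p, 2)) (basis (D.p, 1))) = 1 / 4 ∧
    coef (D.p, 1) (mulSS k D.q (basis (2 * D.p, 2)) (basis (2 * D.p, 2))) = 0 := by
  have hp := D.p_pos
  obtain ⟨a1, a2, a3, a4, a5, a6, a7, a8⟩ := D.int_freq
  obtain ⟨b1, b2, b3, b4, b5, b6, b7, b8, b9, b10⟩ := int_freq_time
  have c2 : 2 * D.p ≠ D.p := by omega
  have c3 : 3 * D.p ≠ D.p := by omega
  have c4 : 4 * D.p ≠ D.p := by omega
  simp only [mulSS_basis, a1, a2, a3, a4, a5, a6, a7, a8, b1, b2, b3, b4, b5, b6, b7, b8,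
    cosEl_neg_left, cosEl_neg_right, cosEl_natCast]
  refine ⟨?_, ?_, ?_, ?_⟩ <;> simp [c2, c3, c4]

/-! ### The state at the bifurcation point -/

/-- The first and second harmonics at the bifurcation point. -/
def baseState : State k D.q :=
  ((2 * D.p : ℝ) • basis (D.p, 1) + (2 * D.p * alpha20 D.α D.γ D.p) • basis (2 * D.p, 0)
      + (2 * D.p * (2 * alpha1 D.α D.β D.γ D.p D.q)) • basis (2 * D.p, 2),
    (2 * sFac D.α D.γ D.p) • basis (D.p, 1)
      + (-2 * beta1 D.α D.β D.γ D.p D.q) • basis (2 * D.p, 2))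

theorem den_factor_pos :
    0 < 2 - D.γ + 5 * D.α * (D.p : ℝ) ^ 2 + 4 * D.γ * D.α ^ 2 * (D.p : ℝ) ^ 4 := by
  have := D.α_pos
  have := D.γ_pos
  have := D.γ_lt_one
  have : 0 ≤ 5 * D.α * (D.p : ℝ) ^ 2 + 4 * D.γ * D.α ^ 2 * (D.p : ℝ) ^ 4 := by positivity
  linarith

theorem divX_basis (i : ℕ × ℕ) :
    D.divX k (basis i) = ((i.1 : ℝ))⁻¹ • basis i := by rw [divX, diag_basis]

theorem divX_baseState : D.divX k (D.baseState k).1 = (2 : ℝ) • basis (D.p, 1)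
    + alpha20 D.α D.γ D.p • basis (2 * D.p, 0)
    + (2 * alpha1 D.α D.β D.γ D.p D.q) • basis (2 * D.p, 2) := by
  have hp : (D.p : ℝ) ≠ 0 := by exact_mod_cast D.p_pos.ne'
  simp only [baseState, map_add, map_smul, divX_basis, smul_smul]
  push_cast
  rw [show 2 * (D.p : ℝ) * ((D.p : ℝ))⁻¹ = 2 by field_simp,
    show 2 * (D.p : ℝ) * alpha20 D.α D.γ D.p * (2 * (D.p : ℝ))⁻¹ = alpha20 D.α D.γ D.p by
      field_simp,
    show 2 * (D.p : ℝ) * (2 * alpha1 D.α D.β D.γ D.p D.q) * (2 * (D.p : ℝ))⁻¹ =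
      2 * alpha1 D.α D.β D.γ D.p D.q by field_simp]

/-- Only products of the first harmonic with a second harmonic return to the mode (p, 1); the
remaining products have even time frequency. -/
theorem coef_pairRest_baseState :
    coef (D.p, 1) (D.pairRest k (D.baseState k) (D.baseState k)).1 =
      -(sFac D.α D.γ D.p * alpha20 D.α D.γ D.p) + sFac D.α D.γ D.p * alpha1 D.α D.β D.γ D.p D.q
        - beta1 D.α D.β D.γ D.p D.q ∧
    coef (D.p, 1) (D.pairRest k (D.baseState k) (D.baseState k)).2 =
      -(2 * sFac D.α D.γ D.p * beta1 D.α D.β D.γ D.p D.q) := by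
  obtain ⟨h1, h2⟩ := D.coef_pairOdd k (D.baseState k) (D.baseState k)
  rw [pairOdd_apply] at h1 h2
  dsimp only at h1 h2
  simp only [pairRest_apply, map_sub, h1, h2, sub_zero]
  rw [divX_baseState]
  obtain ⟨a1, a2, a3, a4, a5, a6⟩ := D.coef_mulSC_table k
  obtain ⟨b1, b2, b3, b4⟩ := D.coef_mulSS_table k
  simp only [baseState, map_add, map_smul, add_apply, smul_apply, smul_eq_mul, a1, a2, a3, a4, a5,
    a6, b1, b2, b3, b4]
  constructor <;> ring

theorem pairOdd_xiState : D.pairOdd k (D.xiState k) (D.xiState k) =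
    (sFac D.α D.γ D.p • basis (2 * D.p, 2), sFac D.α D.γ D.p ^ 2 •
      (basis (2 * D.p, 2) - basis (2 * D.p, 0) - basis (0, 2) + basis (0, 0))) := by
  have hp : (D.p : ℝ) ≠ 0 := by exact_mod_cast D.p_pos.ne'
  rw [pairOdd_apply]
  simp only [xiState, oddMul_apply, map_smul, divX_basis, oddPart_basis, odd_one, if_true,
    smul_apply, mulSC_first_first, mulSS_first_first, smul_smul]
  refine Prod.ext ?_ ?_
  · dsimp only
    congr 1
    field_simp
    ring
  · dsimp only
    congr 1
    ring

/-- Together with `γ_eq`, this turns the second harmonic identities into identities between rational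
functions of α, p, q and s, without square roots. -/
theorem β_eq : D.β = D.q * (1 + D.α * (D.p : ℝ) ^ 2) / (D.p * sFac D.α D.γ D.p) := by
  have hp : (D.p : ℝ) ≠ 0 := by exact_mod_cast D.p_pos.ne'
  have hs := (D.sFac_pos D.p).ne'
  rw [D.kernel]
  field_simp

theorem γ_eq : D.γ = (sFac D.α D.γ D.p ^ 2 - 1) / (D.α * (D.p : ℝ) ^ 2) := by
  have hp : (D.p : ℝ) ≠ 0 := by exact_mod_cast D.p_pos.ne'
  have hα := D.α_pos.ne'
  rw [D.sFac_sq]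
  field_simp
  ring

theorem symb_double : D.symb (2 * D.p) (2 * D.q) = -(12 * D.α * (D.q : ℝ) ^ 2 * (D.p : ℝ) ^ 2 *
    (2 - D.γ + 5 * D.α * (D.p : ℝ) ^ 2 + 4 * D.γ * D.α ^ 2 * (D.p : ℝ) ^ 4)) /
      sFac D.α D.γ D.p ^ 2 := by
  have hp : (D.p : ℝ) ≠ 0 := by exact_mod_cast D.p_pos.ne'
  have hs := (D.sFac_pos D.p).ne'
  have hα := D.α_pos.ne'
  have e1 := D.β_eq
  have e2 := D.γ_eq
  rw [symb]
  push_cast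
  generalize sFac D.α D.γ D.p = s at *
  rw [e1, e2]
  field_simp
  ring

theorem symb_double_zero : D.symb (2 * D.p) (D.q * 0) =
    4 * D.β ^ 2 * (D.p : ℝ) ^ 2 * (1 + 4 * D.γ * D.α * (D.p : ℝ) ^ 2) := by
  rw [symb]
  push_cast
  ring

/-- The left side is the (2p, 2) coefficient of the first component of −βN(ξ, ξ); the next two
lemmas treat the other nonzero coefficients. -/
theorem second_harmonic_eta :
    -(D.β * (D.t11 (2 * D.p, 2) * (2 * D.p) * sFac D.α D.γ D.p
      - 1 / 2 * (D.t12 (2 * D.p, 2) * (2 * D.p) * sFac D.α D.γ D.p ^ 2))) =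
      2 * D.p * (2 * alpha1 D.α D.β D.γ D.p D.q) := by
  have hp : (D.p : ℝ) ≠ 0 := by exact_mod_cast D.p_pos.ne'
  have hq : (D.q : ℝ) ≠ 0 := by exact_mod_cast D.q_pos.ne'
  have hs := (D.sFac_pos D.p).ne'
  have hα := D.α_pos.ne'
  have hd := D.den_factor_pos.ne'
  have e1 := D.β_eq
  have e3 := D.symb_double
  have hi : (2 * D.p, 2).1 ≠ 0 ∧ (2 * D.p, 2) ≠ (D.p, 1) :=
    ⟨by have := D.p_pos; simp; omega, by simp⟩
  simp only [t11, t12, invSymb, if_pos hi, mul_comm D.q 2, e3, alpha1, den22]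
  push_cast
  generalize 2 - D.γ + 5 * D.α * (D.p : ℝ) ^ 2 + 4 * D.γ * D.α ^ 2 * (D.p : ℝ) ^ 4 = d at *
  generalize sFac D.α D.γ D.p = s at *
  rw [e1]
  field_simp
  ring

theorem second_harmonic_u :
    -(D.β * (D.t21 (2 * D.p, 2) * (2 * D.p) * sFac D.α D.γ D.p
      - 1 / 2 * (D.t22 (2 * D.p, 2) * (2 * D.p) * sFac D.α D.γ D.p ^ 2))) =
      -2 * beta1 D.α D.β D.γ D.p D.q := by
  have hp : (D.p : ℝ) ≠ 0 := by exact_mod_cast D.p_pos.ne'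
  have hq : (D.q : ℝ) ≠ 0 := by exact_mod_cast D.q_pos.ne'
  have hs := (D.sFac_pos D.p).ne'
  have hα := D.α_pos.ne'
  have hd := D.den_factor_pos.ne'
  have e1 := D.β_eq
  have e2 := D.γ_eq
  have e3 := D.symb_double
  have hi : (2 * D.p, 2).1 ≠ 0 ∧ (2 * D.p, 2) ≠ (D.p, 1) :=
    ⟨by have := D.p_pos; simp; omega, by simp⟩
  simp only [t21, t22, invSymb, critInv, if_pos hi, if_neg hi.2, mul_comm D.q 2, e3, beta1, den22]
  push_cast
  generalize 2 - D.γ + 5 * D.α * (D.p : ℝ) ^ 2 + 4 * D.γ * D.α ^ 2 * (D.p : ℝ) ^ 4 = d at *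
  generalize sFac D.α D.γ D.p = s at *
  rw [e1]
  generalize D.γ = g at *
  subst e2
  field_simp
  ring

theorem mean_harmonic_eta :
    -(D.β * (1 / 2 * (D.t12 (2 * D.p, 0) * (2 * D.p) * sFac D.α D.γ D.p ^ 2))) =
      2 * D.p * alpha20 D.α D.γ D.p := by
  have hp : (D.p : ℝ) ≠ 0 := by exact_mod_cast D.p_pos.ne'
  have hβ := D.β_pos.ne'
  have hα := D.α_pos
  have hγ := D.γ_pos
  have hd : 1 + 4 * D.γ * D.α * (D.p : ℝ) ^ 2 ≠ 0 := by positivity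
  have hi : (2 * D.p, 0).1 ≠ 0 ∧ (2 * D.p, 0) ≠ (D.p, 1) :=
    ⟨by have := D.p_pos; simp; omega, by simp⟩
  simp only [t12, invSymb, if_pos hi, D.symb_double_zero, alpha20, D.sFac_sq]
  push_cast
  field_simp
  ring

theorem opQuad_basis (i : ℕ × ℕ) :
    D.opQuad k (basis i, 0) = ((D.t11 i * i.1) • basis i, (D.t21 i * i.1) • basis i) ∧
    D.opQuad k (0, basis i) = ((-(1 / 2) * (D.t12 i * i.1)) • basis i,
      (-(1 / 2) * (D.t22 i * i.1)) • basis i) := by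
  simp only [opQuad, blockOp_apply, map_zero, diag_basis, add_zero, zero_add, smul_apply,
    smul_smul, and_self]

/-- The product of the kernel vector with itself has modes (2p, 2), (2p, 0), (0, 2), (0, 0). The
last two are annihilated by the x-derivative of the nonlinear terms, and (2p, 0) reaches only η,
since `t22` carries the time frequency as a factor. -/
theorem baseState_eq :
    D.baseState k = D.xiState k - D.β • D.quadOdd k (D.xiState k) (D.xiState k) := by
  have e22 : D.t22 (2 * D.p, 0) = 0 := by simp [t22]
  have h1 := fun (c : ℝ) (i : ℕ × ℕ) => (D.opQuad k).map_smul c (basis i, 0)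
  have h2 := fun (c : ℝ) (i : ℕ × ℕ) => (D.opQuad k).map_smul c (0, basis i)
  have key : D.opQuad k (D.pairOdd k (D.xiState k) (D.xiState k)) =
      sFac D.α D.γ D.p • D.opQuad k (basis (2 * D.p, 2), 0)
      + sFac D.α D.γ D.p ^ 2 • (D.opQuad k (0, basis (2 * D.p, 2))
        - D.opQuad k (0, basis (2 * D.p, 0)) - D.opQuad k (0, basis (0, 2))
        + D.opQuad k (0, basis (0, 0))) := by
    rw [pairOdd_xiState]
    simp only [← map_smul, ← map_add, ← map_sub]
    congr 1
    simp
  rw [quadOdd_apply, key]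
  simp only [(D.opQuad_basis k _).1, (D.opQuad_basis k _).2, baseState, xiState, e22,
    ← D.second_harmonic_eta, ← D.second_harmonic_u, ← D.mean_harmonic_eta]
  push_cast
  refine Prod.ext ?_ ?_
  · simp only [Prod.fst_sub, Prod.fst_add, Prod.smul_fst, mul_zero, zero_smul]
    module
  · simp only [Prod.snd_sub, Prod.snd_add, Prod.smul_snd, mul_zero, zero_mul, zero_smul]
    module

end CriticalData

end BonaSmith

namespace BonaSmith

/-! ### The cubic coefficient -/

theorem integral_cos_nat_mul {n : ℕ} (hn : n ≠ 0) :
    ∫ x in (-Real.pi)..Real.pi, Real.cos (n * x) = 0 := by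
  have hn' : (n : ℝ) ≠ 0 := by exact_mod_cast hn
  rw [intervalIntegral.integral_comp_mul_left (fun x => Real.cos x) hn', integral_cos]
  simp [Real.sin_nat_mul_pi]

theorem integral_sin_double_sin {p : ℕ} (hp : p ≠ 0) :
    ∫ x in (-Real.pi)..Real.pi, Real.sin (2 * p * x) * Real.sin (p * x) = 0 := by
  have e : ∀ x : ℝ, Real.sin (2 * p * x) * Real.sin (p * x) =
      1 / 2 * Real.cos (p * x) - 1 / 2 * Real.cos ((3 * p : ℕ) * x) := fun x => by
    have h1 := Real.cos_sub (2 * p * x) (p * x)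
    have h2 := Real.cos_add (2 * p * x) (p * x)
    rw [show 2 * (p : ℝ) * x - p * x = p * x by ring] at h1
    rw [show 2 * (p : ℝ) * x + p * x = (3 * p : ℕ) * x by push_cast; ring] at h2
    linarith
  simp only [e]
  rw [intervalIntegral.integral_sub (Continuous.intervalIntegrable (by fun_prop) _ _)
    (Continuous.intervalIntegrable (by fun_prop) _ _), intervalIntegral.integral_const_mul,
    intervalIntegral.integral_const_mul, integral_cos_nat_mul hp, integral_cos_nat_mul (by omega)]
  simp

theorem integral_cubic {p : ℕ} (hp : p ≠ 0) (a b : ℝ) :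
    ∫ x in (-Real.pi)..Real.pi,
      (a * (Real.sin (2 * p * x) * Real.sin (p * x) * Real.cos (p * x))
        + b * (Real.cos (2 * p * x) * Real.sin (p * x) ^ 2)) = Real.pi * (a - b) / 2 := by
  have e : ∀ x : ℝ, a * (Real.sin (2 * p * x) * Real.sin (p * x) * Real.cos (p * x))
        + b * (Real.cos (2 * p * x) * Real.sin (p * x) ^ 2) =
      (a - b) / 4 + (-(a + b) / 4) * Real.cos ((4 * p : ℕ) * x)
        + b / 2 * Real.cos ((2 * p : ℕ) * x) := fun x => by
    have h1 := Real.cos_two_mul (2 * p * x)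
    have h2 := Real.sin_two_mul (p * x)
    have h3 := Real.cos_two_mul' (p * x)
    have h4 := Real.sin_sq_add_cos_sq (p * x)
    have h5 := Real.sin_sq_add_cos_sq (2 * p * x)
    rw [show 2 * (2 * (p : ℝ) * x) = (4 * p : ℕ) * x by push_cast; ring] at h1
    rw [← mul_assoc] at h2 h3
    rw [show ((2 * p : ℕ) : ℝ) * x = 2 * p * x by push_cast; ring, h1]
    have h6 : Real.sin (p * x) * Real.cos (p * x) = Real.sin (2 * p * x) / 2 := by
      rw [h2]; ring
    have h7 : Real.sin (p * x) ^ 2 = (1 - Real.cos (2 * p * x)) / 2 := by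
      rw [h3]; linarith
    rw [mul_assoc (Real.sin (2 * p * x)), h6, h7]
    linear_combination (a / 2) * h5
  simp only [e]
  rw [intervalIntegral.integral_add (Continuous.intervalIntegrable (by fun_prop) _ _)
    (Continuous.intervalIntegrable (by fun_prop) _ _),
    intervalIntegral.integral_add (Continuous.intervalIntegrable (by fun_prop) _ _)
    (Continuous.intervalIntegrable (by fun_prop) _ _), intervalIntegral.integral_const_mul,
    intervalIntegral.integral_const_mul, integral_cos_nat_mul (by omega),
    integral_cos_nat_mul (by omega), intervalIntegral.integral_const, smul_eq_mul]
  ring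

theorem fluct_zero : fluct (fun _ _ => (0 : ℂ)) = fun _ _ => 0 := by
  funext x t
  simp [fluct]

theorem fluct_eq_self {g : ℝ → ℝ → ℂ} (h : ∀ t, ∫ y in (-Real.pi)..Real.pi, g y t = 0) :
    fluct g = g := by
  funext x t
  simp [fluct, h]

/-- The time exponentials in the Hermitian product cancel, so the integrand depends on x only and
the time integral is a factor 2π. The result is the form comparable with `cubicFactor`. -/
theorem beta2_eq (α β γ : ℝ) {p : ℕ} (hp : p ≠ 0) (q : ℕ) : beta2 α β γ p q =
    β / 2 * (-(sFac α γ p ^ 2 * alpha20 α γ p) + sFac α γ p ^ 2 * alpha1 α β γ p q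
      - 2 * sFac α γ p * beta1 α β γ p q) := by
  have hI : Complex.I * Complex.I = -1 := Complex.I_mul_I
  have he : ∀ t : ℝ, conj (Complex.exp (Complex.I * q * t)) =
      Complex.exp (-(Complex.I * q * t)) := fun t => by
    rw [← Complex.exp_conj]
    simp
  have h1 : (fun x t => (y20 α γ p).2 x t * (xi α γ p q).2 x t) = fun _ _ => (0 : ℂ) := by
    funext x t
    simp [y20]
  have hval : ∀ x t : ℝ, (y22 α β γ p q).2 x t * (xiBar α γ p q).2 x t =
      -((beta1 α β γ p q * sFac α γ p : ℝ) : ℂ) * Complex.exp (Complex.I * q * t) *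
        ((Real.sin (2 * p * x) * Real.sin (p * x) : ℝ) : ℂ) := fun x t => by
    have : Complex.exp (2 * Complex.I * q * t) * Complex.exp (-(Complex.I * q * t)) =
        Complex.exp (Complex.I * q * t) := by
      rw [← Complex.exp_add]; ring_nf
    simp only [y22, xiBar, xi, map_mul, map_neg, Complex.conj_I, Complex.conj_ofReal, he, neg_neg]
    rw [← this]
    push_cast
    linear_combination ((beta1 α β γ p q : ℂ) * Complex.sin (2 * p * x) *
      Complex.exp (2 * Complex.I * q * t) * sFac α γ p * Complex.exp (-(Complex.I * q * t)) *
      Complex.sin (p * x)) * hI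
  -- Removing the x-average changes nothing, because sin 2px sin px has mean zero.
  have h2 : fluct (fun x t => (y22 α β γ p q).2 x t * (xiBar α γ p q).2 x t) =
      fun x t => (y22 α β γ p q).2 x t * (xiBar α γ p q).2 x t := by
    apply fluct_eq_self
    intro t
    simp only [hval]
    rw [intervalIntegral.integral_const_mul, intervalIntegral.integral_ofReal,
      integral_sin_double_sin hp]
    simp
  obtain ⟨s, hs⟩ : ∃ s, s = sFac α γ p := ⟨_, rfl⟩
  obtain ⟨b, hb⟩ : ∃ b, b = beta1 α β γ p q := ⟨_, rfl⟩
  obtain ⟨a, ha⟩ : ∃ a, a = alpha1 α β γ p q := ⟨_, rfl⟩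
  obtain ⟨c, hc⟩ : ∃ c, c = alpha20 α γ p := ⟨_, rfl⟩
  have key : ∀ x t : ℝ,
      (twoN (y20 α γ p) (xi α γ p q) + twoN (y22 α β γ p q) (xiBar α γ p q)).1 x t *
        conj ((xi α γ p q).1 x t) +
      (twoN (y20 α γ p) (xi α γ p q) + twoN (y22 α β γ p q) (xiBar α γ p q)).2 x t *
        conj ((xi α γ p q).2 x t) =
      (((-2 * s * b) * (Real.sin (2 * p * x) * Real.sin (p * x) * Real.cos (p * x))
        + (s ^ 2 * c - s ^ 2 * a) * (Real.cos (2 * p * x) * Real.sin (p * x) ^ 2) : ℝ) : ℂ) := by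
    intro x t
    have e1 : Complex.exp (Complex.I * q * t) * Complex.exp (-(Complex.I * q * t)) = 1 := by
      rw [← Complex.exp_add]; simp
    have e2 : Complex.exp (2 * Complex.I * q * t) = Complex.exp (Complex.I * q * t) ^ 2 := by
      rw [← Complex.exp_nat_mul]; push_cast; ring_nf
    simp only [twoN, Prod.fst_add, Prod.snd_add, Pi.add_apply, h1, h2, fluct_zero]
    simp only [y20, y22, xi, xiBar, map_mul, map_neg, Complex.conj_I, Complex.conj_ofReal,
      he, neg_neg, e2, ← hs, ← hb, ← ha, ← hc]
    generalize Complex.exp (Complex.I * q * t) = E at *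
    generalize Complex.exp (-(Complex.I * q * t)) = F at *
    push_cast
    generalize Complex.sin (2 * p * x) = S2
    generalize Complex.cos (2 * p * x) = C2
    generalize Complex.sin (p * x) = S
    generalize Complex.cos (p * x) = C
    generalize (s : ℂ) = s
    generalize (a : ℂ) = a
    generalize (b : ℂ) = b
    generalize (c : ℂ) = c
    have hI2 : Complex.I ^ 2 = -1 := Complex.I_sq
    calc _ = Complex.I ^ 2 * ((E * F) ^ 2 * (2 * b * s * S2 * S * C + s ^ 2 * a * C2 * S ^ 2)
          - E * F * (s ^ 2 * c * C2 * S ^ 2)) := by ring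
      _ = _ := by rw [hI2, e1]; ring
  have hin : ∀ G : ℝ, (∫ _ in (-Real.pi)..Real.pi, (G : ℂ)) = ((2 * Real.pi * G : ℝ) : ℂ) := by
    intro G
    rw [intervalIntegral.integral_const, Complex.real_smul]
    push_cast
    ring
  rw [beta2, herm]
  simp only [key, hin]
  rw [intervalIntegral.integral_ofReal, intervalIntegral.integral_const_mul, integral_cubic hp,
    Complex.ofReal_re, ← hs, ← hb, ← ha, ← hc]
  have hpi := Real.pi_ne_zero
  field_simp
  ring

end BonaSmith

/-! ### The branch of solutions through the base state -/

namespace BonaSmith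

open Filter Topology Asymptotics

/-- The implicit function theorem at a zero of `z - ξ + b N(z, z)`, with `N` nilpotent. -/
theorem exists_branch_of_nilpotent {V : Type*} [NormedAddCommGroup V] [NormedSpace ℝ V]
    [CompleteSpace V] {F : (ℝ × ℝ) × V → V} {N : V →L[ℝ] V →L[ℝ] V} {b : ℝ} {ξ z₀ : V}
    (hN₁ : ∀ x y z, N (N x y) z = 0) (hN₂ : ∀ x y z, N x (N y z) = 0)
    (hz₀ : z₀ = ξ - b • N ξ ξ) (hF₀ : ∀ z, F (0, z) = z - ξ + b • N z z)
    (hF : ContDiffAt ℝ 1 F (0, z₀)) :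
    ∃ g : ℝ × ℝ → V, g 0 = z₀ ∧ (∀ᶠ P in 𝓝 0, F (P, g P) = 0) ∧
      (fun P => g P - z₀) =O[𝓝 0] fun P => P := by
  have hd := hF.hasStrictFDerivAt one_ne_zero
  set f' := fderiv ℝ F (0, z₀)
  -- T is the derivative of z ↦ b N(z, z) at z₀. Both slots of N annihilate its range, so T² = 0.
  set T : V →L[ℝ] V := b • (N z₀ + N.flip z₀) with hT
  have hTT : ∀ v, T (T v) = 0 := fun v => by
    simp [hT, hN₁, hN₂]
  have h1 : HasFDerivAt (fun z => F (0, z)) (f' ∘L .inr ℝ (ℝ × ℝ) V) z₀ :=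
    HasFDerivAt.comp (g := F) z₀ hd.hasFDerivAt (hasFDerivAt_prodMk_right 0 z₀)
  have h2 : HasFDerivAt (fun z => F (0, z)) (.id ℝ V + T) z₀ := by
    simp only [hF₀]
    have := ((hasFDerivAt_id (𝕜 := ℝ) z₀).sub_const ξ).add
      ((N.hasFDerivAt_of_bilinear (hasFDerivAt_id (𝕜 := ℝ) z₀)
        (hasFDerivAt_id (𝕜 := ℝ) z₀)).const_smul b)
    have e : (.id ℝ V + T : V →L[ℝ] V) = .id ℝ V + b • (N.precompR V (id z₀) (.id ℝ V) +
        N.precompL V (.id ℝ V) (id z₀)) := by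
      congr 1
    rw [e]
    exact this
  have h3 : f' ∘L .inr ℝ (ℝ × ℝ) V = .id ℝ V + T := h1.unique h2
  have hinv : (f' ∘L .inr ℝ (ℝ × ℝ) V).IsInvertible := by
    rw [h3]
    -- As T² = 0, the inverse of id + T is id − T; no smallness of b or ξ is needed.
    refine ⟨ContinuousLinearEquiv.equivOfInverse (.id ℝ V + T) (.id ℝ V - T)
      (fun v => ?_) (fun v => ?_), ?_⟩
    · simp [hTT]
    · simp [hTT]
    · ext v; rfl
  -- Nilpotency gives N(z₀, z₀) = N(ξ, ξ), so a single iteration solves the equation exactly.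
  have hval : F (0, z₀) = 0 := by
    rw [hF₀, hz₀]
    simp [hN₁, hN₂]
  refine ⟨hd.implicitFunctionOfProdDomain hinv, ?_, ?_, ?_⟩
  · exact (hd.eventually_apply_eq_iff_implicitFunctionOfProdDomain hinv).self_of_nhds.mp rfl
  · simpa only [hval] using hd.eventually_apply_implicitFunctionOfProdDomain hinv
  · have h := (hd.hasStrictFDerivAt_implicitFunctionOfProdDomain hinv).hasFDerivAt.isBigO_sub
    rw [(hd.eventually_apply_eq_iff_implicitFunctionOfProdDomain hinv).self_of_nhds.mp rfl] at h
    simpa using h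

open Coefs

namespace CriticalData

variable (D : CriticalData) (k : ℕ)

theorem kappa_zero : D.kappa 0 = 0 := by simp [kappa]

theorem critDet_zero : D.critDet 0 = 0 := by
  have h1 := D.kernel
  have h2 := D.sFac_sq D.p
  simp only [critDet, Prod.fst_zero, Prod.snd_zero, add_zero]
  rw [← h2, ← mul_pow, ← mul_pow, ← mul_pow, h1, sub_self]

theorem ampSqOf_zero (z : State k D.q) : D.ampSqOf k 0 z = 0 := by
  simp [ampSqOf, D.critDet_zero]

theorem residual_zero (z : State k D.q) :
    D.residual k (0, z) = z - D.xiState k + D.β • D.quadOdd k z z := by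
  simp [residual, D.kappa_zero, D.ampSqOf_zero]

theorem quadOdd_congr {z z' w w' : State k D.q} (h₂ : oddPart z.2 = oddPart z'.2)
    (h₁ : oddPart w.1 = oddPart w'.1) (h₃ : oddPart w.2 = oddPart w'.2) :
    D.quadOdd k z w = D.quadOdd k z' w' := by
  simp only [quadOdd_apply, pairOdd_apply, oddMul_apply, divX, oddPart_diag, h₁, h₂, h₃]

theorem oddPart_opQuad {w : State k D.q} (h₁ : oddPart w.1 = 0) (h₂ : oddPart w.2 = 0) :
    oddPart (D.opQuad k w).1 = 0 ∧ oddPart (D.opQuad k w).2 = 0 := by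
  simp only [opQuad, blockOp_apply, map_add, smul_apply, map_smul, oddPart_diag, h₁, h₂, map_zero,
    smul_zero, add_zero, and_self]

theorem oddPart_quadOdd (z w : State k D.q) :
    oddPart (D.quadOdd k z w).1 = 0 ∧ oddPart (D.quadOdd k z w).2 = 0 := by
  rw [quadOdd_apply]
  apply oddPart_opQuad
  · rw [pairOdd_apply]; exact graded_mulSC.oddPart_oddMul _ _
  · rw [pairOdd_apply]; exact graded_mulSS.oddPart_oddMul _ _

/-- `quadOdd` depends only on the odd parts of its arguments, and the odd part of its values is zero
because the solving operator is diagonal in the modes. -/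
theorem quadOdd_quadOdd_left (x y z : State k D.q) : D.quadOdd k (D.quadOdd k x y) z = 0 := by
  rw [D.quadOdd_congr k (z' := 0) (w' := z) _ rfl rfl]
  · simp
  · rw [(D.oddPart_quadOdd k x y).2]; simp

theorem quadOdd_quadOdd_right (x y z : State k D.q) : D.quadOdd k x (D.quadOdd k y z) = 0 := by
  rw [D.quadOdd_congr k (z' := x) (w' := 0) rfl _ _]
  · simp
  · rw [(D.oddPart_quadOdd k y z).1]; simp
  · rw [(D.oddPart_quadOdd k y z).2]; simp

/-- Identifies the solvability coefficient with β₂, so β₂ ≠ 0 is what permits solving for A² near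
the base state. -/
theorem cubicFactor_baseState : D.cubicFactor k 0 (D.baseState k) =
    2 * D.β * (D.p : ℝ) ^ 2 * beta2 D.α D.β D.γ D.p D.q := by
  obtain ⟨h1, h2⟩ := D.coef_pairRest_baseState k
  rw [cubicFactor, h1, h2, beta2_eq _ _ _ D.p_pos.ne']
  simp only [Prod.fst_zero, Prod.snd_zero, add_zero]
  rw [D.kernel]
  ring

theorem contDiff_cubicFactor : ContDiff ℝ 1 fun Pz : (ℝ × ℝ) × State k D.q =>
    D.cubicFactor k Pz.1 Pz.2 := by
  unfold cubicFactor
  fun_prop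

theorem contDiff_kappa : ContDiff ℝ 1 D.kappa := by
  unfold kappa
  fun_prop

theorem contDiff_critDet : ContDiff ℝ 1 D.critDet := by
  unfold critDet
  fun_prop

/-- All terms are polynomial in P and in bounded linear and bilinear maps of z, apart from the
division by `cubicFactor`. -/
theorem contDiffAt_residual (h : D.cubicFactor k 0 (D.baseState k) ≠ 0) :
    ContDiffAt ℝ 1 (D.residual k) (0, D.baseState k) := by
  have h1 := D.contDiff_kappa
  have h2 : ContDiffAt ℝ 1 (fun Pz : (ℝ × ℝ) × State k D.q => D.ampSqOf k Pz.1 Pz.2)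
      (0, D.baseState k) := by
    have h3 := D.contDiff_critDet
    unfold ampSqOf
    refine ContDiffAt.div ?_ (D.contDiff_cubicFactor k).contDiffAt h
    fun_prop
  unfold residual
  fun_prop

end CriticalData

end BonaSmith

/-! ### Asymptotics of the amplitude and of the first harmonic along the branch -/

namespace BonaSmith

open Filter Topology Asymptotics Coefs

namespace CriticalData

variable (D : CriticalData) (k : ℕ)

/-- The principal part of the squared amplitude. -/
def ampSqLin (P : ℝ × ℝ) : ℝ := ampSq D.α D.β D.γ D.p D.q P.1 P.2

theorem isBigO_fst : (fun P : ℝ × ℝ => P.1) =O[𝓝 0] fun P => P :=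
  isBigO_of_le _ fun P => norm_fst_le P

theorem isBigO_snd : (fun P : ℝ × ℝ => P.2) =O[𝓝 0] fun P => P :=
  isBigO_of_le _ fun P => norm_snd_le P

theorem isBigO_of_contDiff {f : ℝ × ℝ → ℝ} (hf : ContDiff ℝ 1 f) (h₀ : f 0 = 0) :
    f =O[𝓝 0] fun P => P := by
  simpa [h₀] using ((hf.differentiable one_ne_zero).differentiableAt (x := 0)).isBigO_sub

theorem isBigO_mul_sq {V : Type*} [NormedAddCommGroup V] [NormedSpace ℝ V] {f : ℝ × ℝ → ℝ}
    {g : ℝ × ℝ → V} (hf : f =O[𝓝 0] fun P => P) (hg : g =O[𝓝 0] fun P => P) :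
    (fun P => f P • g P) =O[𝓝 0] fun P => ‖P‖ ^ 2 := by
  simpa [pow_two] using hf.norm_right.smul hg.norm_right

theorem isBigO_critDet_add (hb : beta2 D.α D.β D.γ D.p D.q ≠ 0) :
    (fun P : ℝ × ℝ => D.critDet P + D.β * (D.p : ℝ) ^ 2 *
      beta2 D.α D.β D.γ D.p D.q * D.ampSqLin P) =O[𝓝 0] fun P => ‖P‖ ^ 2 := by
  -- The remainder is exactly ν·h1 + μ·h2: the terms of degree at least two in the expansion of the
  -- determinant. The linear terms are −βp²β₂R.
  have h1 : (fun P : ℝ × ℝ => P.2 * ((D.p : ℝ) ^ 2 *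
      (sFac D.α D.γ D.p ^ 2 + D.γ * (D.p : ℝ) ^ 2 * P.1)) + P.1 * (2 * D.β * D.γ * (D.p : ℝ) ^ 4))
      =O[𝓝 0] fun P => P := isBigO_of_contDiff (by fun_prop) (by simp)
  have h2 : (fun P : ℝ × ℝ => -((D.q : ℝ) ^ 2 * (D.p : ℝ) ^ 4) * P.1) =O[𝓝 0] fun P => P :=
    isBigO_of_contDiff (by fun_prop) (by simp)
  refine ((isBigO_mul_sq isBigO_snd h1).add (isBigO_mul_sq isBigO_fst h2)).congr_left fun P => ?_
  have hs := D.sFac_sq D.p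
  have hker := D.kernel
  rw [ampSqLin, ampSq, critDet]
  simp only [smul_eq_mul]
  generalize sFac D.α D.γ D.p = s at *
  have hγ : D.γ * D.α * (D.p : ℝ) ^ 2 = s ^ 2 - 1 := by rw [hs]; ring
  field_simp
  linear_combination
    (D.q * (1 + D.α * (D.p : ℝ) ^ 2) + D.β * D.p * s + 2 * D.q * P.1 * (D.p : ℝ) ^ 2) * hker
    - (D.p : ℝ) ^ 2 * (D.β ^ 2 + P.2 ^ 2) * hγ

theorem isBigO_ampSqLin : D.ampSqLin =O[𝓝 0] fun P => P := by
  apply isBigO_of_contDiff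
  · unfold ampSqLin ampSq
    fun_prop
  · simp [ampSqLin, ampSq]

theorem isBigO_prodMk_sub {g : ℝ × ℝ → State k D.q}
    (hg : (fun P => g P - D.baseState k) =O[𝓝 0] fun P => P) :
    (fun P => (P, g P) - (0, D.baseState k)) =O[𝓝 0] fun P => P := by
  simp only [Prod.mk_sub_mk, sub_zero]
  exact (isBigO_refl _ _).prod_left hg

theorem tendsto_of_isBigO_sub {V : Type*} [NormedAddCommGroup V] {g : ℝ × ℝ → V} {z₀ : V}
    (hg : (fun P => g P - z₀) =O[𝓝 0] fun P => P) : Tendsto g (𝓝 0) (𝓝 z₀) := by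
  have := (hg.trans_tendsto tendsto_id).add_const z₀
  simpa using this

theorem isBigO_cubicFactor_sub {g : ℝ × ℝ → State k D.q}
    (hg : (fun P => g P - D.baseState k) =O[𝓝 0] fun P => P) :
    (fun P => D.cubicFactor k P (g P) - D.cubicFactor k 0 (D.baseState k)) =O[𝓝 0]
      fun P => P := by
  have h := D.isBigO_prodMk_sub k hg
  have h1 := (((D.contDiff_cubicFactor k).differentiable one_ne_zero).differentiableAt
    (x := (0, D.baseState k))).isBigO_sub
  exact (h1.comp_tendsto (tendsto_of_isBigO_sub h)).trans h

/-- To first order A² is −2 `critDet` / (2βp²β₂), which is R; the normalisation κ and the variation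
of `cubicFactor` enter only in products with first-order quantities. -/
theorem isBigO_ampSqOf_sub {g : ℝ × ℝ → State k D.q}
    (hb : beta2 D.α D.β D.γ D.p D.q ≠ 0)
    (hg : (fun P => g P - D.baseState k) =O[𝓝 0] fun P => P) :
    (fun P => D.ampSqOf k P (g P) - D.ampSqLin P) =O[𝓝 0] fun P => ‖P‖ ^ 2 := by
  have hβ := D.β_pos.ne'
  have hp : (D.p : ℝ) ≠ 0 := by exact_mod_cast D.p_pos.ne'
  have hc0 : D.cubicFactor k 0 (D.baseState k) ≠ 0 := by
    rw [cubicFactor_baseState]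
    positivity
  have hc := D.isBigO_cubicFactor_sub k hg
  have hct := tendsto_of_isBigO_sub hc
  have hinv : (fun P => (D.cubicFactor k P (g P))⁻¹) =O[𝓝 0] fun _ => (1 : ℝ) :=
    (hct.inv₀ hc0).isBigO_one ℝ
  have hk := isBigO_of_contDiff D.contDiff_kappa D.kappa_zero
  have hd := isBigO_of_contDiff D.contDiff_critDet D.critDet_zero
  -- With F the cubic factor and F₀ its base value 2βp²β₂, F(A² − R) = −2(critDet + βp²β₂R) − 2κ
  -- critDet − R(F − F₀), and each summand is quadratic in P.
  have hnum := (((D.isBigO_critDet_add hb).const_mul_left (-2)).sub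
    ((isBigO_mul_sq hk hd).const_mul_left 2)).sub (isBigO_mul_sq D.isBigO_ampSqLin hc)
  refine ((hinv.mul hnum).congr' ?_ (by simp))
  filter_upwards [hct.eventually_ne hc0] with P hP
  rw [ampSqOf, cubicFactor_baseState]
  simp only [smul_eq_mul]
  field_simp
  ring

/-- The only odd time mode of the base state is the critical one, where `t11` and `t12` vanish.
Hence the parameter changes do not move the odd part of η at first order, apart from the prescribed
factor 1 + κ. -/
theorem oddPart_fst_baseState :
    oddPart (D.opAlpha k (D.baseState k)).1 = 0 ∧ oddPart (D.opBeta k (D.baseState k)).1 = 0 ∧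
      oddPart (D.opMixed k (D.baseState k)).1 = 0 ∧
      oddPart (D.baseState k).1 = (D.xiState k).1 := by
  have e1 : D.t11 (D.p, 1) = 0 := by simp [t11, invSymb]
  have e2 : D.t12 (D.p, 1) = 0 := by simp [t12, invSymb]
  have e3 : ¬ Odd 2 := by decide
  simp [opAlpha, opBeta, opMixed, baseState, xiState, diag_basis, oddPart_basis, e1, e2, e3]

/-- The first harmonic of the first component, up to quadratic terms. -/
theorem isBigO_oddPart_fst {g : ℝ × ℝ → State k D.q}
    (hg : (fun P => g P - D.baseState k) =O[𝓝 0] fun P => P)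
    (h : ∀ᶠ P in 𝓝 0, D.residual k (P, g P) = 0) :
    (fun P => oddPart (g P).1 - (1 + D.kappa P) • (D.xiState k).1) =O[𝓝 0]
      fun P => ‖P‖ ^ 2 + |D.ampSqOf k P (g P)| := by
  obtain ⟨a1, a2, a3, -⟩ := D.oddPart_fst_baseState k
  have hL : ∀ L : State k D.q →L[ℝ] State k D.q, oddPart (L (D.baseState k)).1 = 0 →
      (fun P => oddPart (L (g P)).1) =O[𝓝 0] fun P => P := fun L hL => by
    have := (((oddPart.comp (.fst ℝ (Coefs k D.q) (Coefs k D.q))).comp L).isBigO_comp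
      (fun P => g P - D.baseState k) (𝓝 0)).trans hg
    simpa [hL] using this
  have b1 : (fun P : ℝ × ℝ => (D.β + P.2) * P.1) =O[𝓝 0] fun P => P :=
    isBigO_of_contDiff (by fun_prop) (by simp)
  -- Each factor μ, ν or (β+ν)μ is O(P) and multiplies an odd part which vanishes at the base state,
  -- so these terms are quadratic in P.
  have hsum := ((isBigO_mul_sq isBigO_fst (hL _ a1)).add (isBigO_mul_sq isBigO_snd (hL _ a2))).add
    (isBigO_mul_sq b1 (hL _ a3))
  have hr : (fun P : ℝ × ℝ => (D.β + P.2) • oddPart (D.quadRest k (g P) (g P)).1) =O[𝓝 0]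
      fun _ => (1 : ℝ) := by
    have hc : Continuous fun Pz : (ℝ × ℝ) × State k D.q =>
        (D.β + Pz.1.2) • oddPart (D.quadRest k Pz.2 Pz.2).1 := by fun_prop
    exact ((hc.tendsto _).comp (tendsto_of_isBigO_sub (D.isBigO_prodMk_sub k hg))).isBigO_one ℝ
  have hr' := (isBigO_refl (fun P => D.ampSqOf k P (g P)) (𝓝 0)).smul hr
  have e1 : (fun P : ℝ × ℝ => ‖P‖ ^ 2) =O[𝓝 0] fun P => ‖P‖ ^ 2 + |D.ampSqOf k P (g P)| :=
    isBigO_of_le _ fun P => by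
      rw [Real.norm_of_nonneg (by positivity), Real.norm_of_nonneg (by positivity)]
      linarith [abs_nonneg (D.ampSqOf k P (g P))]
  have e2 : (fun P : ℝ × ℝ => D.ampSqOf k P (g P) • (1 : ℝ)) =O[𝓝 0]
      fun P => ‖P‖ ^ 2 + |D.ampSqOf k P (g P)| :=
    isBigO_of_le _ fun P => by
      rw [smul_eq_mul, mul_one, Real.norm_eq_abs]
      rw [Real.norm_of_nonneg (by positivity)]
      linarith [sq_nonneg ‖P‖]
  refine ((hsum.trans e1).add (hr'.trans e2)).neg_left.congr' ?_ EventuallyEq.rfl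
  filter_upwards [h] with P hP
  have h1 := congrArg (fun z => oddPart z.1) hP
  have hx : oddPart (D.xiState k).1 = (D.xiState k).1 := by simp [xiState, oddPart_basis]
  simp only [residual, Prod.fst_add, Prod.fst_sub, Prod.smul_fst, map_add, map_sub, map_smul,
    (D.oddPart_quadOdd k (g P) (g P)).1, hx, Prod.fst_zero, map_zero, zero_add] at h1
  rw [neg_eq_iff_eq_neg, ← sub_eq_zero, ← h1]
  module

end CriticalData

end BonaSmith

/-! ### From the branch to the expansions of the standing waves -/

namespace BonaSmith

open Filter Topology Asymptotics Coefs

/-- A coefficient vector is close to the odd part of a nearby one after rescaling. -/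
theorem norm_scale_sub_le {k q : ℕ} {w w₀ : Coefs k q} {A δ m : ℝ} (hA : 0 ≤ A) (hδ₀ : 0 ≤ δ)
    (hδ : δ ≤ 1) (hm : 0 ≤ m) (h : ‖w - w₀‖ ≤ m * δ) :
    ‖scale A w - A • oddPart w₀‖ ≤
      ((1 + ‖(oddPart : Coefs k q →L[ℝ] Coefs k q)‖) * (m + ‖w₀‖)) * (A * (δ + A)) := by
  set n := ‖(oddPart : Coefs k q →L[ℝ] Coefs k q)‖
  have hn : 0 ≤ n := norm_nonneg _
  -- The odd deviation is O(Aδ); the whole even part is only counted as O(A²).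
  have e : scale A w - A • oddPart w₀ =
      A • oddPart (w - w₀) + A ^ 2 • ((w - w₀) - oddPart (w - w₀) + (w₀ - oddPart w₀)) := by
    rw [scale]
    simp only [map_sub]
    module
  have h1 : ‖oddPart (w - w₀)‖ ≤ n * (m * δ) :=
    (oddPart.le_opNorm _).trans (mul_le_mul_of_nonneg_left h hn)
  have h2 : ‖oddPart w₀‖ ≤ n * ‖w₀‖ := oddPart.le_opNorm _
  have h3 : ‖(w - w₀) - oddPart (w - w₀) + (w₀ - oddPart w₀)‖ ≤
      m * δ + n * (m * δ) + (‖w₀‖ + n * ‖w₀‖) :=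
    (norm_add_le _ _).trans (add_le_add ((norm_sub_le _ _).trans (add_le_add h h1))
      ((norm_sub_le _ _).trans (add_le_add le_rfl h2)))
  have h4 : m * δ ≤ m := by nlinarith
  rw [e]
  refine (norm_add_le _ _).trans ?_
  rw [norm_smul, norm_smul, Real.norm_of_nonneg hA, Real.norm_of_nonneg (sq_nonneg A)]
  have h5 : A * ‖oddPart (w - w₀)‖ ≤ A * (n * (m * δ)) := mul_le_mul_of_nonneg_left h1 hA
  have h6 : A ^ 2 * ‖(w - w₀) - oddPart (w - w₀) + (w₀ - oddPart w₀)‖ ≤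
      A ^ 2 * ((1 + n) * (m + ‖w₀‖)) := by
    apply mul_le_mul_of_nonneg_left (h3.trans _) (sq_nonneg A)
    nlinarith
  have h7 : n * m ≤ (1 + n) * (m + ‖w₀‖) := by
    have : 0 ≤ m + (1 + n) * ‖w₀‖ := by positivity
    linarith
  have h8 := mul_le_mul_of_nonneg_right h7 (mul_nonneg hA hδ₀)
  linarith

namespace CriticalData

variable (D : CriticalData) (k : ℕ)

/-- The first harmonic of `η`. -/
def firstEta : Coefs k D.q := (2 : ℝ) • basis (D.p, 1)

/-- The first harmonic of `u`. -/
def firstU : Coefs k D.q := (2 * sFac D.α D.γ D.p) • basis (D.p, 1)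

/-- The second harmonics of `η`. -/
def secondEta : Coefs k D.q := alpha20 D.α D.γ D.p • basis (2 * D.p, 0)
  + (2 * alpha1 D.α D.β D.γ D.p D.q) • basis (2 * D.p, 2)

/-- Standing waves of amplitude `A` with the expansion of their coefficients. -/
def HasCoefFamily (P : ℝ × ℝ) (A C : ℝ) : Prop := ∃ a b : Coefs k D.q,
  ModeEquations (D.α + P.1) (D.β + P.2) D.γ a b ∧ (∀ l, coef (0, l) a = 0) ∧
  ‖a - A • D.firstEta k‖ ≤ C * (A * (|P.1| + |P.2| + A)) ∧
  ‖b - A • D.firstU k‖ ≤ C * (A * (|P.1| + |P.2| + A)) ∧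
  ‖a - ((A * (1 + D.kappa P)) • D.firstEta k + A ^ 2 • D.secondEta k)‖ ≤
    C * (A + |P.1| + |P.2|) ^ 3

theorem cosSum_sub_apply {k q : ℕ} (f g : Coefs k q) (x t : ℝ) :
    cosSum (f - g) x t = cosSum f x t - cosSum g x t := by
  simp [cosSum]

theorem sinSum_sub_apply {k q : ℕ} (f g : Coefs k q) (x t : ℝ) :
    sinSum (f - g) x t = sinSum f x t - sinSum g x t := by
  simp [sinSum]

variable {k}

variable {D} in
theorem HasCoefFamily.hasWaveFamily {P : ℝ × ℝ} {A C : ℝ} (h : D.HasCoefFamily k P A C) :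
    HasWaveFamily k D.α D.β D.γ D.p D.q P.1 P.2 A C := by
  obtain ⟨a, b, hab, ha0, h1, h2, h3⟩ := h
  refine ⟨cosSum a, sinSum b,
    isStandingWave_shift (isStandingWave_of_modeEquations hab ha0), ?_, ?_, ?_⟩
  · convert sizeLE_cosSum h1 using 1
    funext x t
    rw [cosSum_sub_apply]
    simp [firstEta, cosSum, cosFun_apply]
    ring
  · convert sizeLE_sinSum h2 using 1
    funext x t
    rw [sinSum_sub_apply]
    simp [firstU, sinSum, sinFun_apply]
    ring
  · convert sizeLE_cosSum h3 using 1
    funext x t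
    rw [cosSum_sub_apply]
    congr 1
    simp [firstEta, secondEta, cosSum, cosFun_apply, etaExpansion, kappa, alpha20, alpha1]
    ring_nf

/-- The amplitude may be changed by a small relative amount. -/
theorem HasCoefFamily.change {P : ℝ × ℝ} {A A' C K L : ℝ} (h : D.HasCoefFamily k P A C)
    (hC : 0 ≤ C) (hK : 0 ≤ K) (hL : 0 ≤ L) (hA : 0 ≤ A) (hA' : 0 ≤ A')
    (hδ : |P.1| + |P.2| ≤ 1) (hκ : |D.kappa P| ≤ 1)
    (h1 : |A - A'| ≤ K * ((|P.1| + |P.2|) * A')) (h2 : |A ^ 2 - A' ^ 2| ≤ K * (|P.1| + |P.2|) ^ 2)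
    (h3 : |P.1| + |P.2| ≤ L * A' ^ 2) :
    D.HasCoefFamily k P A' (C * (1 + K) ^ 3 + (K + 2 * K * L + K * L) * (‖D.firstEta k‖ +
      ‖D.firstU k‖ + ‖D.secondEta k‖)) := by
  obtain ⟨a, b, hab, ha0, e1, e2, e3⟩ := h
  rw [add_assoc] at e3
  set δ := |P.1| + |P.2| with hδ'
  have hδ₀ : 0 ≤ δ := by positivity
  obtain ⟨x, hx⟩ : ∃ x, x = ‖D.firstEta k‖ := ⟨_, rfl⟩
  obtain ⟨y, hy⟩ : ∃ y, y = ‖D.firstU k‖ := ⟨_, rfl⟩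
  obtain ⟨z, hz⟩ : ∃ z, z = ‖D.secondEta k‖ := ⟨_, rfl⟩
  have hx0 : 0 ≤ x := hx ▸ norm_nonneg _
  have hy0 : 0 ≤ y := hy ▸ norm_nonneg _
  have hz0 : 0 ≤ z := hz ▸ norm_nonneg _
  -- The relative closeness of the amplitudes lets the old error terms in A be bounded by those in
  -- A', at the price of powers of 1 + K.
  have hAA : A ≤ (1 + K) * A' := by
    have : δ * A' ≤ A' := mul_le_of_le_one_left hA' hδ
    have := mul_le_mul_of_nonneg_left this hK
    linarith [le_abs_self (A - A')]
  have hAδ : A + δ ≤ (1 + K) * (A' + δ) := by nlinarith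
  have hlin : ∀ (v f : Coefs k D.q) (s : ℝ), 0 ≤ s → ‖v - A • f‖ ≤ C * (A * (δ + A)) →
      ‖f‖ ≤ s → ‖v - A' • f‖ ≤ (C * (1 + K) ^ 3 + (K + 2 * K * L + K * L) * s) *
        (A' * (δ + A')) := by
    intro v f s hs hv hf
    have h4 : v - A' • f = (v - A • f) + (A - A') • f := by module
    have h5 : ‖(A - A') • f‖ ≤ K * (δ * A') * s := by
      rw [norm_smul]
      exact mul_le_mul h1 hf (norm_nonneg _) (by positivity)
    have h6 : A * (δ + A) ≤ ((1 + K) * A') * ((1 + K) * (A' + δ)) :=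
      mul_le_mul hAA (by linarith) (by positivity) (by positivity)
    have h7 : A * (δ + A) ≤ (1 + K) ^ 3 * (A' * (δ + A')) := by
      refine h6.trans ?_
      have : 0 ≤ K * ((1 + K) ^ 2 * (A' * (δ + A'))) := by positivity
      linarith
    have h8 := mul_le_mul_of_nonneg_left h7 hC
    rw [h4]
    refine (norm_add_le _ _).trans ((add_le_add (hv.trans h8) h5).trans ?_)
    have : 0 ≤ (2 * K * L + K * L) * s * (A' * (δ + A')) + K * s * (A' * A') := by positivity
    linarith
  refine ⟨a, b, hab, ha0, ?_, ?_, ?_⟩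
  · exact hlin a _ _ (by positivity) e1 (by rw [← hx, ← hy, ← hz]; linarith)
  · exact hlin b _ _ (by positivity) e2 (by rw [← hx, ← hy, ← hz]; linarith)
  · rw [add_assoc A', ← hδ']
    have h4 : a - ((A' * (1 + D.kappa P)) • D.firstEta k + A' ^ 2 • D.secondEta k) =
        a - ((A * (1 + D.kappa P)) • D.firstEta k + A ^ 2 • D.secondEta k) +
        (((A - A') * (1 + D.kappa P)) • D.firstEta k + (A ^ 2 - A' ^ 2) • D.secondEta k) := by
      module
    have h5 : ‖((A - A') * (1 + D.kappa P)) • D.firstEta k‖ ≤ K * (δ * A') * 2 * x := by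
      rw [norm_smul, norm_mul, ← hx]
      refine mul_le_mul_of_nonneg_right (mul_le_mul h1 ?_ (norm_nonneg _) (by positivity)) hx0
      exact (norm_add_le _ _).trans (by rw [norm_one, Real.norm_eq_abs]; linarith)
    have h6 : ‖(A ^ 2 - A' ^ 2) • D.secondEta k‖ ≤ K * δ ^ 2 * z := by
      rw [norm_smul, ← hz]
      exact mul_le_mul_of_nonneg_right h2 hz0
    have h7 : (A + δ) ^ 3 ≤ (1 + K) ^ 3 * (A' + δ) ^ 3 := by
      rw [← mul_pow]
      exact pow_le_pow_left₀ (by positivity) hAδ 3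
    -- Here δ ≤ L A'² is decisive: the changes δA' in the first harmonic and δ² in the second become
    -- cubic errors.
    have h8 : δ * A' ≤ L * (A' + δ) ^ 3 := by
      have := mul_le_mul_of_nonneg_right h3 hA'
      have : 0 ≤ L * (3 * A' ^ 2 * δ + 3 * A' * δ ^ 2 + δ ^ 3) := by positivity
      linarith
    have h9 : δ ^ 2 ≤ L * (A' + δ) ^ 3 := by
      have := mul_le_mul_of_nonneg_right h3 hδ₀
      have : 0 ≤ L * (A' ^ 3 + 2 * A' ^ 2 * δ + 3 * A' * δ ^ 2 + δ ^ 3) := by positivity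
      linarith
    have h10 := mul_le_mul_of_nonneg_left h7 hC
    have h11 := mul_le_mul_of_nonneg_left h8 (by positivity : 0 ≤ 2 * K * x)
    have h12 := mul_le_mul_of_nonneg_left h9 (by positivity : 0 ≤ K * z)
    rw [h4, ← hx, ← hy, ← hz]
    refine (norm_add_le _ _).trans ((add_le_add e3
      ((norm_add_le _ _).trans (add_le_add h5 h6))).trans ?_)
    have : 0 ≤ (K * (x + y + z) + 2 * K * L * (y + z) + K * L * (x + y)) * (A' + δ) ^ 3 := by
      positivity
    linarith

variable (k)

theorem oddPart_divX_baseState : oddPart (D.divX k (D.baseState k).1) = D.firstEta k := by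
  have e3 : ¬ Odd 2 := by decide
  simp [divX_baseState, firstEta, oddPart_basis, e3]

theorem divX_baseState_eq :
    D.divX k (D.baseState k).1 = D.firstEta k + D.secondEta k := by
  rw [divX_baseState, firstEta, secondEta, add_assoc]

theorem oddPart_snd_baseState : oddPart (D.baseState k).2 = D.firstU k := by
  have e3 : ¬ Odd 2 := by decide
  simp [baseState, firstU, oddPart_basis, e3]

theorem divX_xiState : D.divX k (D.xiState k).1 = D.firstEta k := by
  have hp : (D.p : ℝ) ≠ 0 := by exact_mod_cast D.p_pos.ne'
  rw [xiState, map_smul, divX_basis, smul_smul, firstEta]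
  congr 1
  field_simp

theorem hasCoefFamily_zero (P : ℝ × ℝ) {C : ℝ} (hC : 0 ≤ C) : D.HasCoefFamily k P 0 C := by
  refine ⟨0, 0, ⟨fun i => by simp, fun i => by simp⟩, fun l => by simp, ?_, ?_, ?_⟩
  · simp
  · simp
  · simp only [zero_mul, zero_smul, ne_eq, OfNat.ofNat_ne_zero, not_false_eq_true, zero_pow,
      add_zero, sub_zero, norm_zero]
    positivity

/-- The family of standing waves belonging to a zero of `residual`. -/
theorem hasCoefFamily_of_residual {P : ℝ × ℝ} {z : State k D.q} {A K C : ℝ} (hA : 0 ≤ A)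
    (hK : 0 ≤ K) (hβ : D.β + P.2 ≠ 0) (hz : D.cubicFactor k P z ≠ 0)
    (h : D.residual k (P, z) = 0) (hr : A ^ 2 = D.ampSqOf k P z) (hδ : |P.1| + |P.2| ≤ 1)
    (h1 : ‖z - D.baseState k‖ ≤ K * (|P.1| + |P.2|))
    (h2 : ‖oddPart z.1 - (1 + D.kappa P) • (D.xiState k).1‖ ≤
      K * ((|P.1| + |P.2|) ^ 2 + A ^ 2))
    (hC : (1 + ‖(oddPart : Coefs k D.q →L[ℝ] Coefs k D.q)‖) * (1 + ‖D.divX k‖) *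
      (K + ‖D.divX k (D.baseState k).1‖ + ‖(D.baseState k).2‖) ≤ C) :
    D.HasCoefFamily k P A C := by
  obtain ⟨hmode, h0⟩ := D.modeEquations_of_residual k hβ hz h hr
  have hδ₀ : 0 ≤ |P.1| + |P.2| := by positivity
  have h3 : ‖D.divX k z.1 - D.divX k (D.baseState k).1‖ ≤
      ‖D.divX k‖ * K * (|P.1| + |P.2|) := by
    rw [← map_sub, mul_assoc]
    exact (ContinuousLinearMap.le_opNorm _ _).trans
      (mul_le_mul_of_nonneg_left ((norm_fst_le (z - D.baseState k)).trans h1) (norm_nonneg _))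
  have h4 : ‖z.2 - (D.baseState k).2‖ ≤ K * (|P.1| + |P.2|) :=
    (norm_snd_le (z - D.baseState k)).trans h1
  have b1 := norm_scale_sub_le hA hδ₀ hδ (mul_nonneg (norm_nonneg (D.divX k)) hK) h3
  have b2 := norm_scale_sub_le hA hδ₀ hδ hK h4
  have b3 : ‖scale A (D.divX k z.1) -
      ((A * (1 + D.kappa P)) • D.firstEta k + A ^ 2 • D.secondEta k)‖ ≤
      A * (‖D.divX k‖ * (K * ((|P.1| + |P.2|) ^ 2 + A ^ 2))) + A ^ 2 *
        ((1 + ‖(oddPart : Coefs k D.q →L[ℝ] Coefs k D.q)‖) *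
          (‖D.divX k‖ * K * (|P.1| + |P.2|))) := by
    -- The odd part enters with A and an error O(δ² + A²), the even part with A² and an error O(δ);
    -- both products are cubic.
    have e : scale A (D.divX k z.1) -
        ((A * (1 + D.kappa P)) • D.firstEta k + A ^ 2 • D.secondEta k) =
        A • D.divX k (oddPart z.1 - (1 + D.kappa P) • (D.xiState k).1) +
        A ^ 2 • ((D.divX k z.1 - D.divX k (D.baseState k).1) -
          oddPart (D.divX k z.1 - D.divX k (D.baseState k).1)) := by
      have e1 : oddPart (D.divX k z.1) = D.divX k (oddPart z.1) := oddPart_diag _ _ _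
      rw [scale, map_sub, map_sub, map_smul, divX_xiState, oddPart_divX_baseState,
        divX_baseState_eq, e1]
      module
    rw [e]
    refine (norm_add_le _ _).trans ?_
    rw [norm_smul, norm_smul, Real.norm_of_nonneg hA, Real.norm_of_nonneg (sq_nonneg A)]
    refine add_le_add (mul_le_mul_of_nonneg_left ?_ hA)
      (mul_le_mul_of_nonneg_left ?_ (sq_nonneg A))
    · exact (ContinuousLinearMap.le_opNorm _ _).trans
        (mul_le_mul_of_nonneg_left h2 (norm_nonneg _))
    · rw [add_mul, one_mul]
      exact (norm_sub_le _ _).trans (add_le_add h3 ((ContinuousLinearMap.le_opNorm _ _).trans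
        (mul_le_mul_of_nonneg_left h3 (norm_nonneg _))))
  rw [oddPart_divX_baseState] at b1
  rw [oddPart_snd_baseState] at b2
  generalize hδ' : |P.1| + |P.2| = δ at *
  have hn := norm_nonneg (oddPart : Coefs k D.q →L[ℝ] Coefs k D.q)
  have hd := norm_nonneg (D.divX k)
  have hW := norm_nonneg (D.divX k (D.baseState k).1)
  have hU := norm_nonneg (D.baseState k).2
  generalize ‖(oddPart : Coefs k D.q →L[ℝ] Coefs k D.q)‖ = n at *
  generalize ‖D.divX k‖ = d at *
  generalize ‖D.divX k (D.baseState k).1‖ = W at *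
  generalize ‖(D.baseState k).2‖ = U at *
  refine ⟨_, _, hmode, h0, ?_, ?_, ?_⟩
  · rw [hδ']
    refine b1.trans (mul_le_mul_of_nonneg_right (le_trans ?_ hC) (by positivity))
    have : 0 ≤ (1 + n) * (K + d * W + U + d * U) := by positivity
    linarith
  · rw [hδ']
    refine b2.trans (mul_le_mul_of_nonneg_right (le_trans ?_ hC) (by positivity))
    have : 0 ≤ (1 + n) * (d * K + W + d * W + d * U) := by positivity
    linarith
  · rw [add_assoc A, hδ']
    refine b3.trans (le_trans ?_ (mul_le_mul_of_nonneg_right hC (by positivity)))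
    have : 0 ≤ (1 + n) * (K + (1 + d) * (W + U)) * (A + δ) ^ 3 := by positivity
    have : 0 ≤ (1 + n) * (d * K) * (2 * A ^ 2 * δ + 2 * A * δ ^ 2 + δ ^ 3) := by positivity
    have : 0 ≤ n * (d * K) * (A * (δ ^ 2 + A ^ 2)) := by positivity
    linarith

/-- Gathers the implicit function branch with its asymptotics in one neighbourhood. The bounds on
|μ| + |ν| and κ are included because the later change of amplitude needs them at the same
parameters. -/
theorem exists_hasCoefFamily (hb : beta2 D.α D.β D.γ D.p D.q ≠ 0) :
    ∃ ε > 0, ∃ C > 0, ∀ P : ℝ × ℝ, |P.1| < ε → |P.2| < ε → |P.1| + |P.2| ≤ 1 ∧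
      |D.kappa P| ≤ 1 ∧ (0 ≤ D.ampSqLin P → ∃ A : ℝ, 0 ≤ A ∧
        |A ^ 2 - D.ampSqLin P| ≤ C * (|P.1| + |P.2|) ^ 2 ∧ D.HasCoefFamily k P A C) := by
  have hβ := D.β_pos
  have hp : (D.p : ℝ) ≠ 0 := by exact_mod_cast D.p_pos.ne'
  have hc0 : D.cubicFactor k 0 (D.baseState k) ≠ 0 := by
    rw [cubicFactor_baseState]
    have := hβ.ne'
    positivity
  obtain ⟨g, -, hres, hg⟩ := exists_branch_of_nilpotent (D.quadOdd_quadOdd_left k)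
    (D.quadOdd_quadOdd_right k) (D.baseState_eq k) (D.residual_zero k)
    (D.contDiffAt_residual k hc0)
  have hcub := (tendsto_of_isBigO_sub (D.isBigO_cubicFactor_sub k hg)).eventually_ne hc0
  have hβ' : ∀ᶠ P : ℝ × ℝ in 𝓝 0, D.β + P.2 ≠ 0 :=
    (by fun_prop : Continuous fun P : ℝ × ℝ => D.β + P.2).continuousAt.eventually_ne
      (by simpa using hβ.ne')
  have hκ : ∀ᶠ P : ℝ × ℝ in 𝓝 0, |D.kappa P| < 1 :=
    (D.contDiff_kappa.continuous.abs.continuousAt (x := 0)).eventually_lt continuousAt_const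
      (by simp [D.kappa_zero])
  obtain ⟨K₁, hK₁, h1⟩ := hg.exists_pos
  obtain ⟨K₂, hK₂, h2⟩ := (D.isBigO_oddPart_fst k hg hres).exists_pos
  obtain ⟨K₃, hK₃, h3⟩ := (D.isBigO_ampSqOf_sub k hb hg).exists_pos
  obtain ⟨ε, hε, hall⟩ := Metric.eventually_nhds_iff.1 (hres.and (hcub.and (hβ'.and (hκ.and
    (h1.bound.and (h2.bound.and h3.bound))))))
  obtain ⟨C, hC⟩ : ∃ C, C = (1 + ‖(oddPart : Coefs k D.q →L[ℝ] Coefs k D.q)‖) *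
      (1 + ‖D.divX k‖) * (K₁ + K₂ + ‖D.divX k (D.baseState k).1‖ + ‖(D.baseState k).2‖) :=
    ⟨_, rfl⟩
  have hC0 : 0 ≤ C := by rw [hC]; positivity
  refine ⟨min ε (1 / 2), by positivity, C + K₃, by positivity, fun P hP1 hP2 => ?_⟩
  have hδ : |P.1| + |P.2| ≤ 1 := by
    have := hP1.trans_le (min_le_right _ _)
    have := hP2.trans_le (min_le_right _ _)
    linarith
  have hn : ‖P‖ ≤ |P.1| + |P.2| := by
    rw [Prod.norm_def]
    exact max_le (by simp) (by simp)
  obtain ⟨a1, a2, a3, a4, a5, a6, a7⟩ := hall (y := P) (by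
    rw [dist_zero_right, Prod.norm_def]
    exact max_lt (hP1.trans_le (min_le_left _ _)) (hP2.trans_le (min_le_left _ _)))
  have hn2 : ‖P‖ ^ 2 ≤ (|P.1| + |P.2|) ^ 2 := pow_le_pow_left₀ (norm_nonneg _) hn 2
  refine ⟨hδ, a4.le, fun hR => ?_⟩
  rw [Real.norm_eq_abs, Real.norm_of_nonneg (r := ‖P‖ ^ 2) (by positivity)] at a7
  have a7' : |D.ampSqOf k P (g P) - D.ampSqLin P| ≤ (C + K₃) * (|P.1| + |P.2|) ^ 2 := by
    refine a7.trans ((mul_le_mul_of_nonneg_left hn2 hK₃.le).trans ?_)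
    have : 0 ≤ C * (|P.1| + |P.2|) ^ 2 := by positivity
    linarith
  rcases le_or_gt 0 (D.ampSqOf k P (g P)) with hr | hr
  · refine ⟨√(D.ampSqOf k P (g P)), Real.sqrt_nonneg _, ?_, ?_⟩
    · rwa [Real.sq_sqrt hr]
    · rw [Real.norm_of_nonneg (by positivity), abs_of_nonneg hr] at a6
      refine D.hasCoefFamily_of_residual k (K := K₁ + K₂) (Real.sqrt_nonneg _) (by positivity)
        a3 a2 a1 (Real.sq_sqrt hr) hδ ?_ ?_ (by rw [← hC]; linarith)
      · exact a5.trans (mul_le_mul (by linarith) hn (norm_nonneg _) (by positivity))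
      · rw [Real.sq_sqrt hr]
        exact a6.trans (mul_le_mul (by linarith) (by linarith) (by positivity) (by positivity))
  -- The branch would need a negative A². Since R ≥ 0, it is at most the distance from R to that
  -- value, hence quadratically small, and the zero solution is admissible.
  · refine ⟨0, le_rfl, le_trans ?_ a7', D.hasCoefFamily_zero k P (by positivity)⟩
    rw [abs_sub_comm, abs_sub_comm (D.ampSqOf k P (g P))]
    rw [abs_of_nonneg (by simpa using hR), abs_of_nonneg (by linarith)]
    linarith

/-- For small parameters the amplitude may be prescribed by its principal part. -/
theorem exists_hasCoefFamily_sqrt (hb : beta2 D.α D.β D.γ D.p D.q ≠ 0) {c : ℝ} (hc : 0 < c) :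
    ∃ ε > 0, ∃ C > 0, ∀ P : ℝ × ℝ, |P.1| < ε → |P.2| < ε →
      c * (|P.1| + |P.2|) ≤ D.ampSqLin P → D.HasCoefFamily k P (√(D.ampSqLin P)) C := by
  obtain ⟨ε, hε, C, hC, h⟩ := D.exists_hasCoefFamily k hb
  refine ⟨ε, hε, C * (1 + (C / c + C)) ^ 3 + ((C / c + C) + 2 * (C / c + C) * c⁻¹ +
    (C / c + C) * c⁻¹) * (‖D.firstEta k‖ + ‖D.firstU k‖ + ‖D.secondEta k‖), by positivity,
    fun P hP1 hP2 hR => ?_⟩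
  obtain ⟨hδ, hκ, hA⟩ := h P hP1 hP2
  have hδ₀ : 0 ≤ |P.1| + |P.2| := by positivity
  have hR0 : 0 ≤ D.ampSqLin P := (by positivity : 0 ≤ c * (|P.1| + |P.2|)).trans hR
  obtain ⟨A, hA0, hAR, hfam⟩ := hA hR0
  have hsq := Real.sq_sqrt hR0
  have hs0 := Real.sqrt_nonneg (D.ampSqLin P)
  rw [← hsq] at hR hAR
  have h3 : |P.1| + |P.2| ≤ c⁻¹ * √(D.ampSqLin P) ^ 2 := by
    rw [inv_mul_eq_div, le_div_iff₀ hc]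
    linarith
  -- One constant must bound both the relative change of A, which needs C/c, and the change of A²,
  -- which needs C; hence their sum.
  have h2 : |A ^ 2 - √(D.ampSqLin P) ^ 2| ≤ (C / c + C) * (|P.1| + |P.2|) ^ 2 := by
    have : 0 ≤ C / c * (|P.1| + |P.2|) ^ 2 := by positivity
    linarith
  refine HasCoefFamily.change D hfam hC.le (by positivity) (by positivity) hA0 hs0 hδ hκ ?_ h2 h3
  generalize √(D.ampSqLin P) = B at *
  generalize |P.1| + |P.2| = δ at *
  -- If √R = 0, then δ = 0, and the estimate for A² forces A = 0 as well.
  rcases hs0.eq_or_lt with rfl | hB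
  · have : δ = 0 := le_antisymm (by simpa using h3) hδ₀
    subst this
    have : A = 0 := by simpa using hAR
    simp [this]
  · have h4 : |A - B| * (A + B) ≤ C * δ ^ 2 := by
      have e : A ^ 2 - B ^ 2 = (A - B) * (A + B) := by ring
      rwa [e, abs_mul, abs_of_nonneg (add_nonneg hA0 hs0)] at hAR
    -- From |A − B|(A + B) ≤ Cδ² and δ ≤ B²/c; division by B gives the relative bound.
    have h5 : |A - B| * B ≤ C / c * (δ * B) * B := by
      have e1 : |A - B| * B ≤ |A - B| * (A + B) :=
        mul_le_mul_of_nonneg_left (by linarith) (abs_nonneg _)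
      have e2 := mul_le_mul_of_nonneg_left h3 (by positivity : 0 ≤ C * δ)
      have e3 : C * δ * (c⁻¹ * B ^ 2) = C / c * (δ * B) * B := by ring
      linarith
    have h6 := le_of_mul_le_mul_right h5 hB
    have : 0 ≤ C * (δ * B) := by positivity
    linarith

end CriticalData

end BonaSmith

end

/-! ### The main theorem -/

theorem mainTheorem2 (k : ℕ) (hk : 2 ≤ k) (α₀ β₀ γ₀ : ℝ) (hα : 0 < α₀) (hβ : 0 < β₀)
    (hγ : 0 < γ₀) (hγ1 : γ₀ < 1) (p₀ q₀ : ℕ)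
    (hcrit : BonaSmith.criticalSet α₀ β₀ γ₀ = {(p₀, q₀)})
    (hres : ∀ q : ℕ, α₀ * (q : ℝ) ^ 2 ≠ γ₀ * β₀ ^ 2)
    (hβ2 : BonaSmith.beta2 α₀ β₀ γ₀ p₀ q₀ ≠ 0) :
    (∃ ε > 0, ∃ C > 0, ∀ μ ν : ℝ, |μ| < ε → |ν| < ε →
      0 ≤ BonaSmith.ampSq α₀ β₀ γ₀ p₀ q₀ μ ν →
      ∃ A : ℝ, 0 ≤ A ∧
        |A ^ 2 - BonaSmith.ampSq α₀ β₀ γ₀ p₀ q₀ μ ν| ≤ C * (|μ| + |ν|) ^ 2 ∧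
        BonaSmith.HasWaveFamily k α₀ β₀ γ₀ p₀ q₀ μ ν A C) ∧
    (∀ c > 0, ∃ ε > 0, ∃ C > 0, ∀ μ ν : ℝ, |μ| < ε → |ν| < ε →
      c * (|μ| + |ν|) ≤ BonaSmith.ampSq α₀ β₀ γ₀ p₀ q₀ μ ν →
      BonaSmith.HasWaveFamily k α₀ β₀ γ₀ p₀ q₀ μ ν
        (Real.sqrt (BonaSmith.ampSq α₀ β₀ γ₀ p₀ q₀ μ ν)) C) := by
  obtain ⟨hp, hq, hker⟩ : (p₀, q₀) ∈ BonaSmith.criticalSet α₀ β₀ γ₀ := by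
    rw [hcrit]
    rfl
  let D : BonaSmith.CriticalData :=
    { α := α₀, β := β₀, γ := γ₀, p := p₀, q := q₀, α_pos := hα, β_pos := hβ, γ_pos := hγ
      γ_lt_one := hγ1, p_pos := hp, q_pos := hq, kernel := sub_eq_zero.1 hker
      unique := fun m n hm hn h => by
        have : (m, n) ∈ BonaSmith.criticalSet α₀ β₀ γ₀ := ⟨hm, hn, sub_eq_zero.2 h⟩
        rw [hcrit] at this
        exact Prod.mk.inj this
      nonres := hres }
  refine ⟨?_, fun c hc => ?_⟩
  · obtain ⟨ε, hε, C, hC, h⟩ := D.exists_hasCoefFamily k hβ2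
    refine ⟨ε, hε, C, hC, fun μ ν hμ hν hR => ?_⟩
    obtain ⟨A, hA, hAR, hfam⟩ := (h (μ, ν) hμ hν).2.2 hR
    exact ⟨A, hA, hAR, hfam.hasWaveFamily⟩
  · obtain ⟨ε, hε, C, hC, h⟩ := D.exists_hasCoefFamily_sqrt k hβ2 hc
    exact ⟨ε, hε, C, hC, fun μ ν hμ hν hR => (h (μ, ν) hμ hν hR).hasWaveFamily⟩
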